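/- Let $n\ge 1$, let $U\subseteq\mathbb{R}^{n}$ be open (a coordinate representation of a statistical manifold $\mathcal{M}$), and, for a fixed value of the control parameters $\theta$, let $g_{ij}(x)=g_{ij}(x|\theta)$ be a smooth Riemannian metric on $U$ with Riemannian distance $\ell(\cdot,\cdot)$, and let $\bar{x}\in U$ be a point such that every $x\in U$ is joined to $\bar{x}$ by a geodesic of arc-length $\ell(x,\bar{x})$. Let $dp$ be a probability distribution on $U$ in the Riemannian gaussian representation $$dp(x)=\frac{1}{Z}\,e^{-\frac12\ell^{2}(x,\bar{x})}\,d\mu(x),\qquad d\mu(x)=\sqrt{\det\bigl(g_{ij}(x)/2\pi\bigr)}\,dx,\qquad Z>0.$$ For a unit tangent vector $e$ at $\bar{x}$ let $x_g(\cdot\,;e)$ be the geodesic with $x_g(0;e)=\bar{x}$ and $\dot{x}_g(0;e)=e$; call $(\ell,e)$ with $\ell>0$ admissible if for some $L>\ell$ this geodesic exists on $[0,L]$ and $\ell(x_g(L;e),\bar{x})=L$. (a) Let $q\mapsto e(q)$, with $q$ in an open set $Q\subseteq\mathbb{R}^{n-1}$, be a smooth injective immersion into the unit sphere of the tangent space at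 $\bar{x}$. Put $D=\{(\ell,q): q\in Q,\ (\ell,e(q))\text{ admissible}\}$ and $\Phi(\ell,q)=x_g(\ell;e(q))$. Then $D$ is a Borel set, $\Phi$ is injective on $D$, and at each point of $D$ it is smooth with invertible differential, so that $(\ell,q)$ are (geodesic spherical) coordinates centred at $\bar{x}$. The point $\Phi(\ell,q)$ lies on the geodesic sphere $\mathbb{S}^{(n-1)}(\bar{x}|\ell)=\{x\in U:\ell(x,\bar{x})=\ell\}$. In these coordinates $g_{\ell\ell}=1$ and $g_{\ell\alpha}=0$ for all $\alpha$, and on $\Phi(D)$ $$dp(\ell,q)=\frac{1}{Z}\,\frac{1}{\sqrt{2\pi}}\,e^{-\frac12\ell^{2}}\,d\ell\,d\Sigma_g(q|\ell),\qquad d\Sigma_g(q|\ell)=\sqrt{\det\bigl(g_{\alpha\beta}(\ell,q)/2\pi\bigr)}\,dq,$$ where $g_{\alpha\beta}=g_{ij}\,\partial_{q^\alpha}\Phi^{i}\,\partial_{q^\beta}\Phi^{j}$ is the metric induced on the geodesic sphere of radius $\ell$. That is, the restriction of $dp$ to $\Phi(D)$ is the image under $\Phi$ of the measure on $D$ with this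 density with respect to $d\ell\,dq$. (b) The points $x_g(\ell;e)$ with $(\ell,e)$ admissible fill $U$ up to a set of Lebesgue measure zero. -/

import Mathlib

open MeasureTheory Set
open scoped ContDiff

noncomputable section

namespace FluctuationGeometry

/-- `g` is a smooth Riemannian metric, given by its components `g_ij (x)`, on the open coordinate
domain `U ⊆ ℝ^d`. -/
structure IsRiemannianMetricOn {d : ℕ} (U : Set (Fin d → ℝ))
    (g : (Fin d → ℝ) → Matrix (Fin d) (Fin d) ℝ) : Prop where
  isOpen : IsOpen U
  contDiffOn : ∀ i j, ContDiffOn ℝ ∞ (fun x => g x i j) U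
  posDef : ∀ x ∈ U, (g x).PosDef

/-- The inner product `g_ij (x) v^i w^j` of two tangent vectors at `x`. -/
def metricInner {d : ℕ} (g : (Fin d → ℝ) → Matrix (Fin d) (Fin d) ℝ)
    (x v w : Fin d → ℝ) : ℝ :=
  ∑ i, ∑ j, g x i j * v i * w j

/-- The partial derivative `∂ f / ∂ x^k` at `x`. -/
def partialDeriv {d : ℕ} (k : Fin d) (f : (Fin d → ℝ) → ℝ) (x : Fin d → ℝ) : ℝ :=
  fderiv ℝ f x (Pi.single k 1)

/-- The Levi-Civita connection (Christoffel symbols)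
`Γ^k_ij = g^km (∂_j g_im + ∂_i g_jm - ∂_m g_ij) / 2`. -/
def christoffel {d : ℕ} (g : (Fin d → ℝ) → Matrix (Fin d) (Fin d) ℝ)
    (k i j : Fin d) (x : Fin d → ℝ) : ℝ :=
  ∑ m, (g x)⁻¹ k m * ((1 / 2) *
    (partialDeriv j (fun y => g y i m) x + partialDeriv i (fun y => g y j m) x
      - partialDeriv m (fun y => g y i j) x))

/-- On the time interval `[0, L]`, `γ` is the geodesic in `U` that starts at `a` with
velocity `e`; its velocity field is `v`. -/
def IsGeodesicFrom {d : ℕ} (U : Set (Fin d → ℝ)) (g : (Fin d → ℝ) → Matrix (Fin d) (Fin d) ℝ)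
    (a e : Fin d → ℝ) (L : ℝ) (γ : ℝ → Fin d → ℝ) : Prop :=
  ∃ v : ℝ → Fin d → ℝ, γ 0 = a ∧ v 0 = e ∧ ∀ t ∈ Icc 0 L,
    γ t ∈ U ∧ HasDerivWithinAt γ (v t) (Icc 0 L) t ∧
    HasDerivWithinAt v (fun k => -∑ i, ∑ j, christoffel g k i j (γ t) * v t i * v t j)
      (Icc 0 L) t

open Classical in
/-- The point `x_g (ℓ; e)` at parameter `ℓ` of the geodesic that starts at `a` with velocity `e`
(and `a` if that geodesic does not exist up to `ℓ`). -/
def geodesicPoint {d : ℕ} (U : Set (Fin d → ℝ)) (g : (Fin d → ℝ) → Matrix (Fin d) (Fin d) ℝ)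
    (a e : Fin d → ℝ) (ℓ : ℝ) : Fin d → ℝ :=
  if h : ∃ γ, IsGeodesicFrom U g a e ℓ γ then h.choose ℓ else a

/-- The Riemannian length of a curve `c` on `[0, 1]`. -/
def curveLength {d : ℕ} (g : (Fin d → ℝ) → Matrix (Fin d) (Fin d) ℝ)
    (c : ℝ → Fin d → ℝ) : ℝ :=
  ∫ t in (0 : ℝ)..1, √(metricInner g (c t)
    (derivWithin c (Icc 0 1) t) (derivWithin c (Icc 0 1) t))

/-- The Riemannian (separation) distance of `(U, g)`: the infimum of the lengths of the `C^1`
curves in `U` from `a` to `b`. -/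
def riemannianDist {d : ℕ} (U : Set (Fin d → ℝ)) (g : (Fin d → ℝ) → Matrix (Fin d) (Fin d) ℝ)
    (a b : Fin d → ℝ) : ℝ :=
  sInf {L : ℝ | ∃ c : ℝ → Fin d → ℝ, ContDiffOn ℝ 1 c (Icc 0 1) ∧ MapsTo c (Icc 0 1) U ∧
    c 0 = a ∧ c 1 = b ∧ curveLength g c = L}

/-- The geodesic sphere of radius `ℓ` centred at `a`. -/
def geodesicSphere {d : ℕ} (U : Set (Fin d → ℝ)) (g : (Fin d → ℝ) → Matrix (Fin d) (Fin d) ℝ)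
    (a : Fin d → ℝ) (ℓ : ℝ) : Set (Fin d → ℝ) :=
  {x | x ∈ U ∧ riemannianDist U g a x = ℓ}

/-- `e` is a tangent vector of unit length at `a`. -/
def IsUnitAt {d : ℕ} (g : (Fin d → ℝ) → Matrix (Fin d) (Fin d) ℝ) (a e : Fin d → ℝ) : Prop :=
  metricInner g a e e = 1

/-- For a unit vector `e`: the geodesic that starts at `a` with velocity `e` exists up to the
parameter `L` (which is its arc-length) and realises there the distance to `a`. -/
def MinimizesUpTo {d : ℕ} (U : Set (Fin d → ℝ)) (g : (Fin d → ℝ) → Matrix (Fin d) (Fin d) ℝ)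
    (a e : Fin d → ℝ) (L : ℝ) : Prop :=
  ∃ γ, IsGeodesicFrom U g a e L γ ∧ riemannianDist U g a (γ L) = L

/-- Every point of `U` is joined to `a` by a geodesic whose arc-length is the distance. -/
def IsGeodesicallyJoined {d : ℕ} (U : Set (Fin d → ℝ))
    (g : (Fin d → ℝ) → Matrix (Fin d) (Fin d) ℝ) (a : Fin d → ℝ) : Prop :=
  ∀ x ∈ U, ∃ e L γ, 0 ≤ L ∧ IsUnitAt g a e ∧ IsGeodesicFrom U g a e L γ ∧ γ L = x ∧
    riemannianDist U g a x = L

/-- The invariant volume element `dμ = √|g_ij / 2π| dx` (`|·|` is the determinant). -/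
def invariantVolume {d : ℕ} (U : Set (Fin d → ℝ)) (g : (Fin d → ℝ) → Matrix (Fin d) (Fin d) ℝ) :
    Measure (Fin d → ℝ) :=
  (volume.restrict U).withDensity fun x =>
    ENNReal.ofReal (√(((2 * Real.pi)⁻¹ • g x).det))

/-- `dp = Z⁻¹ exp (- ℓ(x, a)² / 2) dμ`. -/
def IsRiemannianGaussian {d : ℕ} (U : Set (Fin d → ℝ))
    (g : (Fin d → ℝ) → Matrix (Fin d) (Fin d) ℝ) (a : Fin d → ℝ) (Z : ℝ)
    (p : Measure (Fin d → ℝ)) : Prop :=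
  0 < Z ∧ p = (invariantVolume U g).withDensity fun x =>
    ENNReal.ofReal (Z⁻¹ * Real.exp (-(1 / 2) * riemannianDist U g a x ^ 2))

/-- A smooth local parametrization `q ↦ e (q)`, `q ∈ Q ⊆ ℝ^n`, of the unit sphere of the tangent
space at `a` of an `(n+1)`-dimensional domain. -/
structure IsDirectionChart {n : ℕ} (g : (Fin (n + 1) → ℝ) → Matrix (Fin (n + 1)) (Fin (n + 1)) ℝ)
    (a : Fin (n + 1) → ℝ) (Q : Set (Fin n → ℝ)) (e : (Fin n → ℝ) → Fin (n + 1) → ℝ) : Prop where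
  isOpen : IsOpen Q
  contDiffOn : ContDiffOn ℝ ∞ e Q
  unit : ∀ q ∈ Q, IsUnitAt g a (e q)
  injOn : InjOn e Q
  immersion : ∀ q ∈ Q, Function.Injective (fderiv ℝ e q)

/-- The spherical coordinate map `(ℓ, q) ↦ x_g (ℓ; e (q))`. -/
def sphericalMap {n : ℕ} (U : Set (Fin (n + 1) → ℝ))
    (g : (Fin (n + 1) → ℝ) → Matrix (Fin (n + 1)) (Fin (n + 1)) ℝ) (a : Fin (n + 1) → ℝ)
    (e : (Fin n → ℝ) → Fin (n + 1) → ℝ) (z : ℝ × (Fin n → ℝ)) : Fin (n + 1) → ℝ :=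
  geodesicPoint U g a (e z.2) z.1

/-- The range of the spherical coordinates `(ℓ, q)`: `q ∈ Q`, `ℓ > 0`, and the geodesic with
direction `e (q)` is still minimizing slightly beyond `ℓ` (so that the point lies before the cut
point). -/
def sphericalDomain {n : ℕ} (U : Set (Fin (n + 1) → ℝ))
    (g : (Fin (n + 1) → ℝ) → Matrix (Fin (n + 1)) (Fin (n + 1)) ℝ) (a : Fin (n + 1) → ℝ)
    (Q : Set (Fin n → ℝ)) (e : (Fin n → ℝ) → Fin (n + 1) → ℝ) : Set (ℝ × (Fin n → ℝ)) :=
  {z | z.2 ∈ Q ∧ 0 < z.1 ∧ ∃ L, z.1 < L ∧ MinimizesUpTo U g a (e z.2) L}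

/-- The radial coordinate field `υ = ∂x/∂ℓ` of a map `x = Φ (ℓ, q)`. -/
def radialField {n : ℕ} (Φ : ℝ × (Fin n → ℝ) → Fin (n + 1) → ℝ) (z : ℝ × (Fin n → ℝ)) :
    Fin (n + 1) → ℝ :=
  fderiv ℝ Φ z (1, 0)

/-- The angular coordinate fields `τ_α = ∂x/∂q^α` of a map `x = Φ (ℓ, q)`. -/
def angularField {n : ℕ} (Φ : ℝ × (Fin n → ℝ) → Fin (n + 1) → ℝ) (α : Fin n)
    (z : ℝ × (Fin n → ℝ)) : Fin (n + 1) → ℝ :=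
  fderiv ℝ Φ z (0, Pi.single α 1)

/-- The metric `g_αβ (ℓ, q) = g_ij (x) τ^i_α τ^j_β` induced on the geodesic spheres. -/
def inducedMetric {n : ℕ} (g : (Fin (n + 1) → ℝ) → Matrix (Fin (n + 1)) (Fin (n + 1)) ℝ)
    (Φ : ℝ × (Fin n → ℝ) → Fin (n + 1) → ℝ) (z : ℝ × (Fin n → ℝ)) : Matrix (Fin n) (Fin n) ℝ :=
  Matrix.of fun α β => metricInner g (Φ z) (angularField Φ α z) (angularField Φ β z)

/-- The density with respect to `dq` of the hyper-surface element
`dΣ_g (q | ℓ) = √|g_αβ (ℓ, q) / 2π| dq`. -/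
def surfaceDensity {n : ℕ} (g : (Fin (n + 1) → ℝ) → Matrix (Fin (n + 1)) (Fin (n + 1)) ℝ)
    (Φ : ℝ × (Fin n → ℝ) → Fin (n + 1) → ℝ) (z : ℝ × (Fin n → ℝ)) : ℝ :=
  √(((2 * Real.pi)⁻¹ • inducedMetric g Φ z).det)

end FluctuationGeometry

end

open FluctuationGeometry

noncomputable section

/-! ### Smooth flows of compactly supported vector fields -/

section Flow

universe u

open Metric Filter Topology

/-! Before the cut point, geodesics issuing from a = `xbar` neither meet nor focus, and the cut
points form a null set; the rest is the Gauss lemma and a change of variables.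

Everything about minimality comes from one inequality, `IsGeodesicLift.exists_metricInner_le`. If a
unit speed geodesic z from a minimizes up to L > ℓ, then, uniformly for t ≤ ℓ and small η, the
distance d from a satisfies d(z(t) + η) ≥ t + ⟨z'(t), η⟩ - C|η|². For the proof, z(t) + η is joined
to z(L) by adding to z a perturbation that decays linearly, and the Euler-Lagrange equation
evaluates the first-order change of energy. Since d ≤ t holds along every unit speed geodesic from
a, this support function controls competitors to first and second order. Tested along another
geodesic that arrives at z(ℓ) at time ℓ, it forces equality in Cauchy-Schwarz, hence equal
velocities (`IsGeodesicLift.eq_of_fst_eq`); this gives injectivity of Φ. Tested on a variation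
through unit speed geodesics, it shows that a variation field vanishing at ℓ also has zero
derivative there (`IsGeodesicLift.deriv_eq_zero_of_jacobi_eq_zero`); this gives invertibility of dΦ
without the index form.

By the Gauss lemma the metric in the coordinates (ℓ, q) is the block matrix 1 ⊕ g_αβ, so det(dΦ)²
det g = det g_αβ. The block has one row less than g, which leaves one factor 1/√(2π), and d(Φ(ℓ, q))
= ℓ turns the weight into exp(-ℓ²/2).

For (b), the tangent vectors whose geodesic minimizes up to time 1 but no further meet each ray at
most once, so infinitely many disjoint dilates of a bounded piece fit into a ball and the set is
null. Its image under the differentiable exponential map is null, and it contains every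
non-admissible point of U other than a.

Smooth dependence of geodesics on initial data is obtained by cutting the geodesic field off near a
compact piece of orbit, which makes its flow global, and by induction on the order of
differentiability through the variational equation. -/

theorem exists_taylor_bound_of_hasCompactSupport {E F : Type*} [NormedAddCommGroup E]
    [NormedSpace ℝ E] [NormedAddCommGroup F] [NormedSpace ℝ F] {f : E → F}
    (hf : ContDiff ℝ ∞ f) (hc : HasCompactSupport f) :
    ∃ C : ℝ, 0 ≤ C ∧ ∀ x h, ‖f (x + h) - f x - fderiv ℝ f x h‖ ≤ C * ‖h‖ ^ 2 := by
  obtain ⟨C, hC⟩ := ContDiff.lipschitzWith_of_hasCompactSupport (𝕂 := ℝ) (hc.fderiv ℝ)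
    (hf.fderiv_right (m := ∞) (by simp)) (by simp)
  refine ⟨C, C.2, fun x h => ?_⟩
  have := (convex_closedBall x ‖h‖).norm_image_sub_le_of_norm_fderiv_le' (𝕜 := ℝ) (f := f)
    (φ := fderiv ℝ f x) (C := C * ‖h‖) (x := x) (y := x + h)
    (fun y _ => hf.differentiable (by simp) y) (fun y hy => ?_) (by simp) (by simp)
  · simpa [pow_two, mul_assoc] using this
  · refine (hC.norm_sub_le y x).trans ?_
    gcongr
    simpa [dist_eq_norm] using hy

theorem ContDiff.exists_bound_fderiv {E F : Type*} [NormedAddCommGroup E]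
    [NormedSpace ℝ E] [NormedAddCommGroup F] [NormedSpace ℝ F] {f : E → F}
    (hf : ContDiff ℝ ∞ f) (hc : HasCompactSupport f) :
    ∃ K : NNReal, LipschitzWith K f ∧ ∀ x, ‖fderiv ℝ f x‖ ≤ K := by
  obtain ⟨C, hC⟩ := ContDiff.lipschitzWith_of_hasCompactSupport (𝕂 := ℝ) hc
    hf (by simp)
  exact ⟨C, hC, fun x => norm_fderiv_le_of_lipschitz ℝ hC⟩

/-- `φ` is the global flow of the vector field `f`. -/
structure IsFlow {E : Type*} [NormedAddCommGroup E] [NormedSpace ℝ E] (f : E → E)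
    (φ : ℝ → E → E) : Prop where
  zero : ∀ x, φ 0 x = x
  hasDerivAt : ∀ t x, HasDerivAt (fun τ => φ τ x) (f (φ t x)) t

/-- As ‖f‖ ≤ B, a solution cannot leave the ball of radius B(N + 1) within time N + 1, so
Picard-Lindelöf applies on the whole interval for each N; uniqueness glues the solutions. -/
theorem exists_isFlow {E : Type*} [NormedAddCommGroup E] [NormedSpace ℝ E] [CompleteSpace E]
    {f : E → E} {K : NNReal} (hK : LipschitzWith K f) {B : NNReal} (hB : ∀ x, ‖f x‖ ≤ B) :
    ∃ φ, IsFlow f φ := by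
  have key : ∀ (x : E) (N : ℕ), ∃ α : ℝ → E, α 0 = x ∧ ∀ t ∈ Ioo (-(N + 1 : ℝ)) (N + 1),
      HasDerivAt α (f (α t)) t := by
    intro x N
    have hN : (0 : ℝ) ∈ Icc (-(N + 1 : ℝ)) (N + 1) := by
      constructor <;> linarith [N.cast_nonneg (α := ℝ)]
    obtain ⟨α, h0, hα⟩ := (IsPicardLindelof.of_time_independent (f := f) (tmin := -(N + 1 : ℝ))
      (tmax := N + 1) (t₀ := ⟨0, hN⟩) (x₀ := x) (a := B * (N + 1)) (r := 0) (L := B) (K := K)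
      (fun x _ => hB x) hK.lipschitzOnWith
        (by simp)).exists_eq_forall_mem_Icc_hasDerivWithinAt₀
    exact ⟨α, h0, fun t ht => (hα t (Ioo_subset_Icc_self ht)).hasDerivAt (Icc_mem_nhds ht.1 ht.2)⟩
  choose α h0 hα using key
  have huniq : ∀ x (N M : ℕ), N ≤ M → EqOn (α x N) (α x M) (Ioo (-(N + 1 : ℝ)) (N + 1)) := by
    intro x N M h
    have hNM : (N : ℝ) ≤ M := by exact_mod_cast h
    refine ODE_solution_unique_of_mem_Ioo (v := fun _ => f) (s := fun _ => univ) (K := K) (t₀ := 0)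
      (fun t _ => hK.lipschitzOnWith)
      (by constructor <;> linarith [N.cast_nonneg (α := ℝ)])
      (fun t ht => ⟨hα x N t ht, mem_univ _⟩) (fun t ht => ⟨hα x M t ?_, mem_univ _⟩)
      (by rw [h0, h0])
    exact ⟨by linarith [ht.1], by linarith [ht.2]⟩
  refine ⟨fun t x => α x ⌈|t|⌉₊ t, fun x => h0 _ _, fun t x => ?_⟩
  -- The index ⌈|s|⌉₊ jumps with s; the single solution of index M serves all s near t.
  set M := ⌈|t|⌉₊ + 1 with hM
  have hMt : |t| < M := by
    rw [hM]; push_cast; linarith [Nat.le_ceil |t|]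
  have hmem : ∀ s : ℝ, |s| < M → s ∈ Ioo (-(M + 1 : ℝ)) (M + 1) := fun s hs => by
    constructor <;> linarith [abs_lt.1 hs]
  have heq : ∀ s : ℝ, |s| < M → α x ⌈|s|⌉₊ s = α x M s := fun s hs => by
    apply huniq x
    · exact Nat.ceil_le.2 hs.le
    · have := Nat.le_ceil |s|
      constructor <;> linarith [abs_le.1 this]
  rw [heq t hMt]
  refine (hα x M t (hmem t hMt)).congr_of_eventuallyEq ?_
  filter_upwards [(isOpen_lt continuous_abs continuous_const).mem_nhds hMt] with s hs using heq s hs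

namespace IsFlow

variable {E : Type*} [NormedAddCommGroup E] [NormedSpace ℝ E] {f : E → E} {φ : ℝ → E → E}
  {K : NNReal}

theorem eq_of_hasDerivAt (h : IsFlow f φ) (hK : LipschitzWith K f) {z : ℝ → E}
    (hz : ∀ t, HasDerivAt z (f (z t)) t) (t : ℝ) : z t = φ t (z 0) :=
  congrFun (ODE_solution_unique_univ (v := fun _ => f) (s := fun _ => univ) (K := K) (t₀ := 0)
    (fun _ => hK.lipschitzOnWith) (fun t => ⟨hz t, mem_univ _⟩)
    (fun t => ⟨h.hasDerivAt t (z 0), mem_univ _⟩) (h.zero _).symm) t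

theorem add (h : IsFlow f φ) (hK : LipschitzWith K f) (s t : ℝ) (x : E) :
    φ (t + s) x = φ t (φ s x) := by
  have := h.eq_of_hasDerivAt hK (z := fun t => φ (t + s) x)
    (fun t => (h.hasDerivAt (t + s) x).comp_add_const t s) t
  simpa using this

theorem continuous_time (h : IsFlow f φ) (x : E) : Continuous fun t => φ t x :=
  continuous_iff_continuousAt.2 fun t => (h.hasDerivAt t x).continuousAt

theorem eqOn_of_hasDerivWithinAt (h : IsFlow f φ) (hK : LipschitzWith K f) {z : ℝ → E} {T : ℝ}
    (hz : ∀ t ∈ Icc 0 T, HasDerivWithinAt z (f (z t)) (Icc 0 T) t) :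
    ∀ t ∈ Icc 0 T, z t = φ t (z 0) :=
  ODE_solution_unique (v := fun _ => f) (K := K) (fun _ => hK)
    (fun t ht => (hz t ht).continuousWithinAt)
    (fun t ht => (hz t (Ico_subset_Icc_self ht)).mono_of_mem_nhdsWithin
      (Icc_mem_nhdsGE_of_mem ht))
    (h.continuous_time _).continuousOn
    (fun t _ => (h.hasDerivAt t _).hasDerivWithinAt) (h.zero _).symm

theorem dist_le (h : IsFlow f φ) (hK : LipschitzWith K f) (x y : E) {t : ℝ} (ht : 0 ≤ t) :
    dist (φ t x) (φ t y) ≤ dist x y * Real.exp (K * t) := by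
  have := dist_le_of_trajectories_ODE (v := fun _ => f) (K := K) (a := 0) (b := t)
    (f := fun t => φ t x) (g := fun t => φ t y) (δ := dist x y) (fun _ => hK)
    (h.continuous_time _).continuousOn
    (fun t _ => (h.hasDerivAt t _).hasDerivWithinAt) (h.continuous_time _).continuousOn
    (fun t _ => (h.hasDerivAt t _).hasDerivWithinAt) (by simp [h.zero]) t ⟨ht, le_rfl⟩
  simpa using this

theorem continuous_one (h : IsFlow f φ) (hK : LipschitzWith K f) : Continuous (φ 1) :=
  (LipschitzWith.of_dist_le_mul (K := ⟨Real.exp K, (Real.exp_pos _).le⟩) fun x y => by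
    have := h.dist_le hK x y zero_le_one
    rw [mul_one, mul_comm] at this
    exact this).continuous

end IsFlow

/-- The derivative of the time-one map is given by the variational equation. -/
theorem IsFlow.hasFDerivAt_one {E : Type*} [NormedAddCommGroup E] [NormedSpace ℝ E]
    {f : E → E} {φ : ℝ → E → E} (h : IsFlow f φ) (hf : ContDiff ℝ ∞ f) (hc : HasCompactSupport f)
    {x : E} {A : ℝ → E →L[ℝ] E} (hA0 : A 0 = ContinuousLinearMap.id ℝ E)
    (hA : ∀ t ∈ Icc (0 : ℝ) 1, HasDerivAt A ((fderiv ℝ f (φ t x)).comp (A t)) t) :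
    HasFDerivAt (φ 1) (A 1) x := by
  obtain ⟨K, hK, hK'⟩ := hf.exists_bound_fderiv hc
  obtain ⟨C, hC0, hC⟩ := exists_taylor_bound_of_hasCompactSupport hf hc
  -- Nearby orbits separate by at most exp K on [0, 1], so M‖y‖² bounds the Taylor remainder of f
  -- along the orbit. It is the inhomogeneity in Grönwall's inequality, whose bound is linear in it.
  set M := C * Real.exp K ^ 2 with hM
  have hM0 : 0 ≤ M := by positivity
  have main : ∀ y : E, ‖φ 1 (x + y) - φ 1 x - A 1 y‖ ≤ M * gronwallBound 0 K 1 1 * ‖y‖ ^ 2 := by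
    intro y
    have hd : ∀ t ∈ Icc (0 : ℝ) 1, HasDerivAt (fun t => φ t (x + y) - φ t x - A t y)
        (f (φ t (x + y)) - f (φ t x) - fderiv ℝ f (φ t x) (A t y)) t := fun t ht =>
      ((h.hasDerivAt t _).sub (h.hasDerivAt t _)).sub
        (by simpa using (hA t ht).clm_apply (hasDerivAt_const t y))
    have hb := norm_le_gronwallBound_of_norm_deriv_right_le (a := 0) (b := 1) (δ := 0) (K := K)
      (ε := M * ‖y‖ ^ 2) (fun t ht => (hd t ht).continuousAt.continuousWithinAt)
      (fun t ht => (hd t (Ico_subset_Icc_self ht)).hasDerivWithinAt) (by simp [h.zero, hA0])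
      (fun t ht => ?_) 1 ⟨zero_le_one, le_rfl⟩
    · refine hb.trans (le_of_eq ?_)
      by_cases hK0 : (K : ℝ) = 0
      · simp [hK0, gronwallBound_K0]
      · simp [gronwallBound_of_K_ne_0 hK0]; ring
    · have h1 := hC (φ t x) (φ t (x + y) - φ t x)
      rw [add_sub_cancel] at h1
      have h2 : ‖φ t (x + y) - φ t x‖ ≤ Real.exp K * ‖y‖ := by
        have := h.dist_le hK (x + y) x ht.1
        rw [dist_eq_norm, dist_eq_norm, add_sub_cancel_left] at this
        refine this.trans ?_
        rw [mul_comm]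
        gcongr
        nlinarith [K.2, ht.2]
      have h3 : f (φ t (x + y)) - f (φ t x) - fderiv ℝ f (φ t x) (A t y) =
          fderiv ℝ f (φ t x) (φ t (x + y) - φ t x - A t y) +
          (f (φ t (x + y)) - f (φ t x) - fderiv ℝ f (φ t x) (φ t (x + y) - φ t x)) := by
        simp only [map_sub]; abel
      rw [h3]
      refine (norm_add_le _ _).trans (add_le_add ?_ ?_)
      · exact (ContinuousLinearMap.le_opNorm _ _).trans (by gcongr; exact hK' _)
      · refine h1.trans ?_
        rw [hM, mul_assoc, ← mul_pow]
        gcongr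
  rw [hasFDerivAt_iff_isLittleO_nhds_zero]
  have : (fun y => φ 1 (x + y) - φ 1 x - A 1 y) =O[𝓝 0] fun y : E => ‖y‖ ^ 2 :=
    Asymptotics.IsBigO.of_bound (M * gronwallBound 0 K 1 1) (Eventually.of_forall fun y => by
      simpa using main y)
  exact this.trans_isLittleO (by
    simpa using Asymptotics.isLittleO_norm_pow_id one_lt_two)

/-- The derivative of the time-one map is itself a component of a time-one map, that of the
variational field (f x, Df(x) A) on E × (E →L E). The induction therefore changes the space, and E
is quantified inside it. -/
theorem IsFlow.contDiff_one (n : ℕ) : ∀ (E : Type u) [NormedAddCommGroup E] [NormedSpace ℝ E]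
    [FiniteDimensional ℝ E] (f : E → E) (φ : ℝ → E → E), IsFlow f φ → ContDiff ℝ ∞ f →
    HasCompactSupport f → ContDiff ℝ n (φ 1) := by
  induction n with
  | zero =>
    intro E _ _ _ f φ h hf hc
    obtain ⟨K, hK, -⟩ := hf.exists_bound_fderiv hc
    exact contDiff_zero.2 (h.continuous_one hK)
  | succ n ih =>
    intro E _ _ _ f φ h hf hc
    obtain ⟨K, hK, hK'⟩ := hf.exists_bound_fderiv hc
    let R : ℝ := Real.exp K + 1
    -- The variational field is linear in A, so it needs a cutoff in A to have compact support.
    let b : ContDiffBump (0 : E →L[ℝ] E) := ⟨R, R + 1, by positivity, by linarith⟩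
    let F : E × (E →L[ℝ] E) → E × (E →L[ℝ] E) :=
      fun z => b z.2 • (f z.1, (fderiv ℝ f z.1).comp z.2)
    have hF : ContDiff ℝ ∞ F := by
      refine (b.contDiff.comp contDiff_snd).smul ((hf.comp contDiff_fst).prodMk ?_)
      exact ((hf.fderiv_right (m := ∞) (by simp)).comp contDiff_fst).clm_comp contDiff_snd
    have hFc : HasCompactSupport F := by
      refine HasCompactSupport.intro (hc.isCompact.prod b.hasCompactSupport.isCompact) ?_
      rintro ⟨x, A⟩ hz
      by_cases hA : A ∈ tsupport b
      · have hx : x ∉ tsupport f := fun hx => hz ⟨hx, hA⟩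
        have h1 : f x = 0 := image_eq_zero_of_notMem_tsupport hx
        have h2 : fderiv ℝ f x = 0 := by
          by_contra hne
          exact hx (support_fderiv_subset ℝ hne)
        simp [F, h1, h2]
      · simp [F, image_eq_zero_of_notMem_tsupport hA]
    obtain ⟨KF, hKF, -⟩ := hF.exists_bound_fderiv hFc
    obtain ⟨BF, hBF⟩ := hFc.exists_bound_of_continuous hF.continuous
    obtain ⟨Ψ, hΨ⟩ := exists_isFlow hKF (B := ⟨max BF 0, le_max_right _ _⟩)
      (fun z => (hBF z).trans (le_max_left _ _))
    have ihΨ := ih _ F Ψ hΨ hF hFc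
    let z : E → ℝ → E × (E →L[ℝ] E) := fun x t => Ψ t (x, ContinuousLinearMap.id ℝ E)
    have hz1 : ∀ x t, HasDerivAt (fun t => (z x t).1) (F (z x t)).1 t := fun x t =>
      (hasFDerivAt_fst (𝕜 := ℝ) (p := z x t)).comp_hasDerivAt t
      (hΨ.hasDerivAt t (x, ContinuousLinearMap.id ℝ E))
    have hz2 : ∀ x t, HasDerivAt (fun t => (z x t).2) (F (z x t)).2 t := fun x t =>
      (hasFDerivAt_snd (𝕜 := ℝ) (p := z x t)).comp_hasDerivAt t
      (hΨ.hasDerivAt t (x, ContinuousLinearMap.id ℝ E))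
    -- Because b ≤ 1, Grönwall gives ‖A(t)‖ ≤ exp K < R for orbits starting at the identity: the
    -- cutoff is never felt up to time 1.
    have hbound : ∀ x, ∀ t ∈ Icc (0 : ℝ) 1, ‖(z x t).2‖ ≤ R := by
      intro x t ht
      have := norm_le_gronwallBound_of_norm_deriv_right_le (a := 0) (b := 1) (δ := 1) (K := K)
        (ε := 0) (f := fun t => (z x t).2) (fun t ht => (hz2 x t).continuousAt.continuousWithinAt)
        (fun t ht => (hz2 x t).hasDerivWithinAt) (by
          simp only [z, hΨ.zero]; exact ContinuousLinearMap.norm_id_le)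
        (fun t ht => ?_) t ht
      · refine this.trans ?_
        rw [gronwallBound_ε0]
        have : Real.exp (K * (t - 0)) ≤ Real.exp K := Real.exp_le_exp.2 (by nlinarith [K.2, ht.2])
        simp only [R]; linarith
      · simp only [F, Prod.smul_snd, add_zero, norm_smul, Real.norm_eq_abs, abs_of_nonneg b.nonneg]
        calc b (z x t).2 * ‖(fderiv ℝ f (z x t).1).comp (z x t).2‖
            ≤ 1 * (‖fderiv ℝ f (z x t).1‖ * ‖(z x t).2‖) := by
              gcongr
              · exact b.le_one
              · exact ContinuousLinearMap.opNorm_comp_le _ _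
          _ ≤ K * ‖(z x t).2‖ := by rw [one_mul]; gcongr; exact hK' _
    have hb1 : ∀ x, ∀ t ∈ Icc (0 : ℝ) 1, b (z x t).2 = 1 := fun x t ht =>
      b.one_of_mem_closedBall (by simpa using hbound x t ht)
    have hφ : ∀ x, ∀ t ∈ Icc (0 : ℝ) 1, (z x t).1 = φ t x := by
      intro x t ht
      have := h.eqOn_of_hasDerivWithinAt hK (z := fun t => (z x t).1) (T := 1) (fun t ht => by
        have := (hz1 x t).hasDerivWithinAt (s := Icc 0 1)
        simpa [F, hb1 x t ht] using this) t ht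
      simpa [z, hΨ.zero] using this
    have hder : ∀ x, HasFDerivAt (φ 1) (z x 1).2 x := fun x =>
      h.hasFDerivAt_one hf hc (A := fun t => (z x t).2) (by simp [z, hΨ.zero]) (fun t ht => by
        have := hz2 x t
        simpa [F, hb1 x t ht, hφ x t ht] using this)
    push_cast
    rw [contDiff_succ_iff_fderiv]
    refine ⟨fun x => (hder x).differentiableAt, by simp, ?_⟩
    rw [show fderiv ℝ (φ 1) = fun x => (z x 1).2 from funext fun x => (hder x).fderiv]
    exact contDiff_snd.comp (ihΨ.comp (contDiff_id.prodMk contDiff_const))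

/-- Time becomes an initial value: the field (0, s f x) on ℝ × E has time-one map (s, φ_s x). The
factor s is cut off outside a neighbourhood of the times considered, again to get compact support.
-/
theorem IsFlow.contDiff_uncurry {E : Type u} [NormedAddCommGroup E] [NormedSpace ℝ E]
    [FiniteDimensional ℝ E] {f : E → E} {φ : ℝ → E → E} (h : IsFlow f φ) (hf : ContDiff ℝ ∞ f)
    (hc : HasCompactSupport f) : ContDiff ℝ ∞ fun z : ℝ × E => φ z.1 z.2 := by
  obtain ⟨K, hK, -⟩ := hf.exists_bound_fderiv hc
  rw [contDiff_iff_contDiffAt]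
  rintro ⟨t₀, x₀⟩
  let b : ContDiffBump (0 : ℝ) := ⟨|t₀| + 1, |t₀| + 2, by positivity, by linarith⟩
  let F : ℝ × E → ℝ × E := fun z => (0, (b z.1 * z.1) • f z.2)
  have hF : ContDiff ℝ ∞ F :=
    contDiff_const.prodMk (((b.contDiff.comp contDiff_fst).mul contDiff_fst).smul
      (hf.comp contDiff_snd))
  have hFc : HasCompactSupport F := by
    refine HasCompactSupport.intro (b.hasCompactSupport.isCompact.prod hc.isCompact) ?_
    rintro ⟨s, x⟩ hz
    by_cases hs : s ∈ tsupport b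
    · have hx : x ∉ tsupport f := fun hx => hz ⟨hs, hx⟩
      simp [F, image_eq_zero_of_notMem_tsupport hx]
    · simp [F, image_eq_zero_of_notMem_tsupport hs]
  obtain ⟨KF, hKF, -⟩ := hF.exists_bound_fderiv hFc
  obtain ⟨BF, hBF⟩ := hFc.exists_bound_of_continuous hF.continuous
  obtain ⟨Ψ, hΨ⟩ := exists_isFlow hKF (B := ⟨max BF 0, le_max_right _ _⟩)
    (fun z => (hBF z).trans (le_max_left _ _))
  have hsm : ContDiff ℝ ∞ (Ψ 1) := contDiff_infty.2 fun n =>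
    IsFlow.contDiff_one n _ F Ψ hΨ hF hFc
  have heq : ∀ s, |s| < |t₀| + 1 → ∀ x, φ s x = (Ψ 1 (s, x)).2 := by
    intro s hs x
    have hb : b s = 1 := b.one_of_mem_closedBall (by simpa using hs.le)
    have := hΨ.eq_of_hasDerivAt hKF (z := fun t => (s, φ (t * s) x)) (fun t => by
      have h1 := (h.hasDerivAt (t * s) x).scomp t ((hasDerivAt_id t).mul_const s)
      have := (hasDerivAt_const t s).prodMk h1
      simpa [F, hb] using this) 1
    rw [zero_mul, h.zero] at this
    rw [← this, one_mul]
  refine ((contDiff_snd.comp hsm).contDiffAt (x := (t₀, x₀))).congr_of_eventuallyEq ?_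
  have : ∀ᶠ z : ℝ × E in 𝓝 (t₀, x₀), |z.1| < |t₀| + 1 :=
    (isOpen_lt (continuous_abs.comp continuous_fst) continuous_const).mem_nhds (by simp)
  filter_upwards [this] with z hz using heq z.1 hz z.2

/-- This is the Jacobi equation; it follows from the symmetry of the second derivative of (t, x) ↦
φ_t x by differentiating ∂_t φ = f ∘ φ in x. -/
theorem IsFlow.hasDerivAt_fderiv {E : Type u} [NormedAddCommGroup E] [NormedSpace ℝ E]
    [FiniteDimensional ℝ E] {f : E → E} {φ : ℝ → E → E} (h : IsFlow f φ) (hf : ContDiff ℝ ∞ f)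
    (hc : HasCompactSupport f) (t : ℝ) (x w : E) :
    HasDerivAt (fun t => fderiv ℝ (φ t) x w) (fderiv ℝ f (φ t x) (fderiv ℝ (φ t) x w)) t := by
  have hs := h.contDiff_uncurry hf hc
  set G : ℝ × E → E := fun z => φ z.1 z.2 with hG
  have hGd : Differentiable ℝ G := hs.differentiable (by simp)
  have hGd' : Differentiable ℝ (fderiv ℝ G) :=
    (hs.fderiv_right (m := ∞) (by simp)).differentiable (by simp)
  have hx : ∀ t, HasFDerivAt (φ t) ((fderiv ℝ G (t, x)).comp (ContinuousLinearMap.inr ℝ ℝ E)) x :=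
    fun t => (hGd (t, x)).hasFDerivAt.comp x (hasFDerivAt_prodMk_right t x)
  have ht : ∀ z : ℝ × E, fderiv ℝ G z (1, 0) = f (G z) := by
    rintro ⟨t, x⟩
    have := (hGd (t, x)).hasFDerivAt.comp_hasDerivAt t
      ((hasDerivAt_id t).prodMk (hasDerivAt_const t x))
    exact this.unique (h.hasDerivAt t x)
  have h1 : ∀ t, fderiv ℝ (φ t) x w = fderiv ℝ G (t, x) (0, w) := fun t => by
    rw [(hx t).fderiv]; simp
  simp only [h1]
  have h2 : HasDerivAt (fun t => fderiv ℝ G (t, x) (0, w))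
      (fderiv ℝ (fderiv ℝ G) (t, x) (1, 0) (0, w)) t := by
    have := (hGd' (t, x)).hasFDerivAt.comp_hasDerivAt t
      ((hasDerivAt_id t).prodMk (hasDerivAt_const t x))
    simpa using this.clm_apply (hasDerivAt_const t ((0, w) : ℝ × E))
  have hsymm : fderiv ℝ (fderiv ℝ G) (t, x) (1, 0) (0, w) =
      fderiv ℝ (fderiv ℝ G) (t, x) (0, w) (1, 0) :=
    (hs.contDiffAt.isSymmSndFDerivAt (by
      rw [minSmoothness_of_isRCLikeNormedField]; exact WithTop.coe_le_coe.2 le_top)).eq _ _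
  have h3 : fderiv ℝ (fderiv ℝ G) (t, x) (0, w) (1, 0) =
      fderiv ℝ f (φ t x) (fderiv ℝ G (t, x) (0, w)) := by
    have e1 : HasFDerivAt (fun z => fderiv ℝ G z (1, 0))
        ((fderiv ℝ (fderiv ℝ G) (t, x)).flip (1, 0)) (t, x) := by
      have := (hGd' (t, x)).hasFDerivAt.clm_apply (hasFDerivAt_const ((1, 0) : ℝ × E) (t, x))
      simpa using this
    have e2 : HasFDerivAt (fun z => fderiv ℝ G z (1, 0))
        ((fderiv ℝ f (G (t, x))).comp (fderiv ℝ G (t, x))) (t, x) := by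
      rw [show (fun z => fderiv ℝ G z (1, 0)) = fun z => f (G z) from funext ht]
      exact ((hf.differentiable (by simp) _).hasFDerivAt).comp _ (hGd (t, x)).hasFDerivAt
    have := congrArg (fun L => L (0, w)) (e1.unique e2)
    simpa using this
  rw [hsymm, h3] at h2
  exact h2

/-- A map that is smooth on an open set agrees near a compact subset with a globally smooth map of
compact support. -/
theorem exists_contDiff_hasCompactSupport_eqOn {E F : Type*} [NormedAddCommGroup E]
    [NormedSpace ℝ E] [FiniteDimensional ℝ E] [NormedAddCommGroup F] [NormedSpace ℝ F]
    {Ω K : Set E} {f : E → F} (hΩ : IsOpen Ω) (hf : ContDiffOn ℝ ∞ f Ω) (hK : IsCompact K)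
    (hKΩ : K ⊆ Ω) :
    ∃ (h : E → F) (O : Set E), ContDiff ℝ ∞ h ∧ HasCompactSupport h ∧ IsOpen O ∧ K ⊆ O ∧ O ⊆ Ω ∧
      EqOn h f O := by
  obtain ⟨K₁, hK₁, hKK₁, hK₁Ω⟩ := exists_compact_between hK hΩ hKΩ
  obtain ⟨χ, hχ1, hχ0, -⟩ := exists_contMDiffMap_one_nhds_of_subset_interior (n := (⊤ : ℕ∞))
    (modelWithCornersSelf ℝ E) hK.isClosed hKK₁
  obtain ⟨O, hO, hKO, hOχ⟩ := mem_nhdsSet_iff_exists.1 hχ1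
  have hχ : ContDiff ℝ ∞ χ := χ.contMDiff.contDiff
  have hsupp : tsupport χ ⊆ K₁ := closure_minimal (fun x hx => by
    by_contra h; exact hx (hχ0 x h)) hK₁.isClosed
  refine ⟨fun x => χ x • f x, O ∩ interior K₁, ?_, ?_, hO.inter isOpen_interior,
    subset_inter hKO hKK₁, fun x hx => hK₁Ω (interior_subset hx.2), fun x hx => ?_⟩
  · rw [contDiff_iff_contDiffAt]
    intro x
    by_cases hx : x ∈ Ω
    · exact hχ.contDiffAt.smul (hf.contDiffAt (hΩ.mem_nhds hx))
    · have : x ∉ tsupport χ := fun h => hx (hK₁Ω (hsupp h))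
      refine (contDiffAt_const (c := (0 : F))).congr_of_eventuallyEq ?_
      filter_upwards [notMem_tsupport_iff_eventuallyEq.1 this] with y hy
      simp [hy]
  · exact HasCompactSupport.intro hK₁ fun x hx => by simp [hχ0 x hx]
  · have : χ x = 1 := hOχ hx.1
    simp [this]

end Flow
end

noncomputable section

namespace FluctuationGeometry

open Metric Filter Topology

variable {d : ℕ} {U : Set (Fin d → ℝ)} {g : (Fin d → ℝ) → Matrix (Fin d) (Fin d) ℝ}

/-! ### The inner product -/

theorem metricInner_eq_dotProduct (x v w : Fin d → ℝ) :
    metricInner g x v w = v ⬝ᵥ (g x).mulVec w := by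
  simp only [metricInner, dotProduct, Matrix.mulVec, Finset.mul_sum]
  exact Finset.sum_congr rfl fun i _ => Finset.sum_congr rfl fun j _ => by ring

theorem metricInner_add_right (x v w w' : Fin d → ℝ) :
    metricInner g x v (w + w') = metricInner g x v w + metricInner g x v w' := by
  simp [metricInner_eq_dotProduct, Matrix.mulVec_add, dotProduct_add]

theorem metricInner_sub_left (x v v' w : Fin d → ℝ) :
    metricInner g x (v - v') w = metricInner g x v w - metricInner g x v' w := by
  simp [metricInner_eq_dotProduct, sub_dotProduct]

theorem metricInner_sub_right (x v w w' : Fin d → ℝ) :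
    metricInner g x v (w - w') = metricInner g x v w - metricInner g x v w' := by
  simp [metricInner_eq_dotProduct, Matrix.mulVec_sub, dotProduct_sub]

theorem metricInner_smul_left (x : Fin d → ℝ) (c : ℝ) (v w : Fin d → ℝ) :
    metricInner g x (c • v) w = c * metricInner g x v w := by
  simp [metricInner_eq_dotProduct]

theorem metricInner_smul_right (x : Fin d → ℝ) (c : ℝ) (v w : Fin d → ℝ) :
    metricInner g x v (c • w) = c * metricInner g x v w := by
  simp [metricInner_eq_dotProduct, Matrix.mulVec_smul]

theorem metricInner_zero_left (x w : Fin d → ℝ) : metricInner g x 0 w = 0 := by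
  simp [metricInner_eq_dotProduct]

theorem metricInner_zero_right (x v : Fin d → ℝ) : metricInner g x v 0 = 0 := by
  simp [metricInner_eq_dotProduct]

namespace IsRiemannianMetricOn

variable (hg : IsRiemannianMetricOn U g)

include hg

theorem apply_comm {x : Fin d → ℝ} (hx : x ∈ U) (i j : Fin d) : g x i j = g x j i := by
  simpa using (hg.posDef x hx).isHermitian.apply j i

theorem metricInner_comm {x : Fin d → ℝ} (hx : x ∈ U) (v w : Fin d → ℝ) :
    metricInner g x v w = metricInner g x w v := by
  simp only [metricInner]
  rw [Finset.sum_comm]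
  exact Finset.sum_congr rfl fun i _ => Finset.sum_congr rfl fun j _ => by
    rw [hg.apply_comm hx j i]; ring

theorem metricInner_self_pos {x : Fin d → ℝ} (hx : x ∈ U) {v : Fin d → ℝ} (hv : v ≠ 0) :
    0 < metricInner g x v v := by
  have := (hg.posDef x hx).dotProduct_mulVec_pos hv
  rw [metricInner_eq_dotProduct]
  simpa using this

theorem metricInner_self_nonneg {x : Fin d → ℝ} (hx : x ∈ U) (v : Fin d → ℝ) :
    0 ≤ metricInner g x v v := by
  by_cases hv : v = 0
  · simp [hv, metricInner_zero_left]
  · exact (hg.metricInner_self_pos hx hv).le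

theorem eq_zero_of_metricInner_self_le_zero {x : Fin d → ℝ} (hx : x ∈ U) {v : Fin d → ℝ}
    (h : metricInner g x v v ≤ 0) : v = 0 := by
  by_contra hv
  exact absurd (hg.metricInner_self_pos hx hv) (not_lt.2 h)

theorem differentiableAt {x : Fin d → ℝ} (hx : x ∈ U) (i j : Fin d) :
    DifferentiableAt ℝ (fun x => g x i j) x :=
  ((hg.contDiffOn i j).contDiffAt (hg.isOpen.mem_nhds hx)).differentiableAt (by simp)

theorem contDiffAt_metricInner {E : Type*} [NormedAddCommGroup E] [NormedSpace ℝ E]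
    {x v w : E → Fin d → ℝ} {z : E} (hxU : x z ∈ U) (hx : ContDiffAt ℝ ∞ x z)
    (hv : ContDiffAt ℝ ∞ v z) (hw : ContDiffAt ℝ ∞ w z) :
    ContDiffAt ℝ ∞ (fun z => metricInner g (x z) (v z) (w z)) z := by
  unfold metricInner
  refine ContDiffAt.sum fun i _ => ContDiffAt.sum fun j _ => ?_
  exact ((((hg.contDiffOn i j).contDiffAt (hg.isOpen.mem_nhds hxU)).comp z hx).mul
    (contDiffAt_pi.1 hv i)).mul (contDiffAt_pi.1 hw j)

theorem continuousOn_metricInner {E : Type*} [TopologicalSpace E] {s : Set E}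
    {x v w : E → Fin d → ℝ} (hxU : MapsTo x s U) (hx : ContinuousOn x s)
    (hv : ContinuousOn v s) (hw : ContinuousOn w s) :
    ContinuousOn (fun z => metricInner g (x z) (v z) (w z)) s := by
  unfold metricInner
  refine continuousOn_finsetSum _ fun i _ => continuousOn_finsetSum _ fun j _ => ?_
  exact (((hg.contDiffOn i j).continuousOn.comp hx hxU).mul
    (continuousOn_pi.1 hv i)).mul (continuousOn_pi.1 hw j)

theorem hasDerivAt_metricInner {x v w : ℝ → Fin d → ℝ} {x' v' w' : Fin d → ℝ} {t : ℝ}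
    (hxU : x t ∈ U) (hx : HasDerivAt x x' t) (hv : HasDerivAt v v' t) (hw : HasDerivAt w w' t) :
    HasDerivAt (fun t => metricInner g (x t) (v t) (w t))
      (∑ i, ∑ j, fderiv ℝ (fun y => g y i j) (x t) x' * v t i * w t j +
        metricInner g (x t) v' (w t) + metricInner g (x t) (v t) w') t := by
  have h : ∀ i j, HasDerivAt (fun t => g (x t) i j * v t i * w t j)
      ((fderiv ℝ (fun y => g y i j) (x t) x' * v t i + g (x t) i j * v' i) * w t j +
        g (x t) i j * v t i * w' j) t := fun i j =>
    (((hg.differentiableAt hxU i j).hasFDerivAt.comp_hasDerivAt t hx).mul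
      (hasDerivAt_pi.1 hv i)).mul (hasDerivAt_pi.1 hw j)
  unfold metricInner
  refine (HasDerivAt.fun_sum (u := Finset.univ) fun i _ =>
    HasDerivAt.fun_sum (u := Finset.univ) fun j _ => h i j).congr_deriv ?_
  simp only [← Finset.sum_add_distrib]
  exact Finset.sum_congr rfl fun i _ => Finset.sum_congr rfl fun j _ => by ring

/-- For unit vectors v these determinants are the cofactors that enter the inverse metric. -/
theorem contDiffOn_det_updateRow {v : Fin d → ℝ} (i : Fin d) :
    ContDiffOn ℝ ∞ (fun x => ((g x).updateRow i v).det) U := by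
  simp only [Matrix.det_apply]
  refine ContDiffOn.sum fun σ _ => ContDiffOn.const_smul _ (contDiffOn_prod fun k _ => ?_)
  by_cases h : σ k = i
  · simp only [h, Matrix.updateRow_self]; exact contDiffOn_const
  · simp only [Matrix.updateRow_ne h]; exact hg.contDiffOn _ _

theorem contDiffOn_det : ContDiffOn ℝ ∞ (fun x => (g x).det) U := by
  simp only [Matrix.det_apply]
  exact ContDiffOn.sum fun σ _ => ContDiffOn.const_smul _ (contDiffOn_prod fun k _ =>
    hg.contDiffOn _ _)

theorem det_pos {x : Fin d → ℝ} (hx : x ∈ U) : 0 < (g x).det := (hg.posDef x hx).det_pos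

theorem contDiffOn_inv (i j : Fin d) : ContDiffOn ℝ ∞ (fun x => (g x)⁻¹ i j) U := by
  simp only [Matrix.inv_def, Matrix.smul_apply, Matrix.adjugate_apply, Ring.inverse_eq_inv',
    smul_eq_mul]
  exact (hg.contDiffOn_det.inv fun x hx => (hg.det_pos hx).ne').mul (hg.contDiffOn_det_updateRow _)

theorem contDiffOn_partialDeriv (k i j : Fin d) :
    ContDiffOn ℝ ∞ (fun x => partialDeriv k (fun y => g y i j) x) U :=
  ((hg.contDiffOn i j).fderiv_of_isOpen hg.isOpen (m := ∞) (by simp)).clm_apply contDiffOn_const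

theorem contDiffOn_christoffel (k i j : Fin d) : ContDiffOn ℝ ∞ (christoffel g k i j) U := by
  unfold christoffel
  refine ContDiffOn.sum fun m _ => (hg.contDiffOn_inv k m).mul (contDiffOn_const.mul ?_)
  exact ((hg.contDiffOn_partialDeriv _ _ _).add (hg.contDiffOn_partialDeriv _ _ _)).sub
    (hg.contDiffOn_partialDeriv _ _ _)

end IsRiemannianMetricOn

/-! ### The geodesic field and the Euler-Lagrange identity -/

/-- The geodesic vector field on the tangent bundle `U × ℝ^d`. -/
def geodesicField (g : (Fin d → ℝ) → Matrix (Fin d) (Fin d) ℝ)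
    (z : (Fin d → ℝ) × (Fin d → ℝ)) : (Fin d → ℝ) × (Fin d → ℝ) :=
  (z.2, fun k => -∑ i, ∑ j, christoffel g k i j z.1 * z.2 i * z.2 j)

/-- The Lagrangian `g_ij (x) v^i v^j / 2`. -/
def kinetic (g : (Fin d → ℝ) → Matrix (Fin d) (Fin d) ℝ)
    (z : (Fin d → ℝ) × (Fin d → ℝ)) : ℝ :=
  1 / 2 * metricInner g z.1 z.2 z.2

theorem IsRiemannianMetricOn.contDiffOn_geodesicField (hg : IsRiemannianMetricOn U g) :
    ContDiffOn ℝ ∞ (geodesicField g) (U ×ˢ univ) := by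
  refine contDiffOn_snd.prodMk (contDiffOn_pi.2 fun k => ContDiffOn.neg ?_)
  refine ContDiffOn.sum fun i _ => ContDiffOn.sum fun j _ => ?_
  refine (((hg.contDiffOn_christoffel k i j).comp contDiffOn_fst fun z hz => hz.1).mul
    (contDiffOn_pi.1 contDiffOn_snd i)).mul (contDiffOn_pi.1 contDiffOn_snd j)

theorem IsRiemannianMetricOn.contDiffOn_kinetic (hg : IsRiemannianMetricOn U g) :
    ContDiffOn ℝ ∞ (kinetic g) (U ×ˢ univ) := fun _ hz =>
  (contDiffAt_const.mul (hg.contDiffAt_metricInner (x := Prod.fst) hz.1 contDiffAt_fst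
    contDiffAt_snd contDiffAt_snd)).contDiffWithinAt

theorem fderiv_eq_sum_partialDeriv (f : (Fin d → ℝ) → ℝ) (x ξ : Fin d → ℝ) :
    fderiv ℝ f x ξ = ∑ k, partialDeriv k f x * ξ k := by
  conv_lhs => rw [pi_eq_sum_univ' ξ]
  simp only [map_sum, map_smul, smul_eq_mul, partialDeriv]
  refine Finset.sum_congr rfl fun k _ => ?_
  rw [mul_comm]

theorem IsRiemannianMetricOn.fderiv_kinetic (hg : IsRiemannianMetricOn U g)
    {x : Fin d → ℝ} (hx : x ∈ U) (v ξ ζ : Fin d → ℝ) :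
    fderiv ℝ (kinetic g) (x, v) (ξ, ζ) =
      1 / 2 * ∑ i, ∑ j, fderiv ℝ (fun y => g y i j) x ξ * v i * v j + metricInner g x v ζ := by
  have hd : DifferentiableAt ℝ (kinetic g) (x, v) :=
    (hg.contDiffOn_kinetic.contDiffAt ((hg.isOpen.prod isOpen_univ).mem_nhds
      ⟨hx, mem_univ _⟩)).differentiableAt (by simp)
  have hl : ∀ a b : Fin d → ℝ, HasDerivAt (fun t : ℝ => a + t • b) b 0 := fun a b => by
    simpa using ((hasDerivAt_id (0 : ℝ)).smul_const b).const_add a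
  have h0 : ((fun t : ℝ => (x + t • ξ, v + t • ζ)) 0) = (x, v) := by simp
  have h1 := (h0 ▸ hd.hasFDerivAt).comp_hasDerivAt (0 : ℝ)
    ((hl x ξ).prodMk (hl v ζ))
  have h2 := (hg.hasDerivAt_metricInner (x := fun t : ℝ => x + t • ξ) (by simpa using hx) (hl x ξ)
    (hl v ζ) (hl v ζ)).const_mul (1 / 2)
  have h3 := h1.unique h2
  simp only [zero_smul, add_zero] at h3
  rw [h3, hg.metricInner_comm hx ζ v]
  ring

/-- Here D k i j stands for ∂_k g_ij. Lowering the index cancels G⁻¹; the first two Christoffel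
terms then coincide after relabelling and cancel the transport term, so only half of the third
survives. -/
theorem christoffel_euler_lagrange {G : Matrix (Fin d) (Fin d) ℝ} (hG : IsUnit G.det)
    (hs : ∀ i j, G i j = G j i) (D : Fin d → Fin d → Fin d → ℝ) (v ξ : Fin d → ℝ) :
    ∑ i, ∑ j, (∑ k, D k i j * v k) * v i * ξ j +
      ∑ i, ∑ j, G i j * (-∑ a, ∑ b, (∑ m, G⁻¹ i m * ((1 / 2) * (D b a m + D a b m - D m a b))) *
        v a * v b) * ξ j =
      1 / 2 * ∑ i, ∑ j, (∑ k, D k i j * ξ k) * v i * v j := by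
  set Q : Fin d → ℝ := fun m => ∑ a, ∑ b, (1 / 2) * (D b a m + D a b m - D m a b) * v a * v b
  have h1 : ∀ i, ∑ a, ∑ b, (∑ m, G⁻¹ i m * ((1 / 2) * (D b a m + D a b m - D m a b))) *
      v a * v b = G⁻¹.mulVec Q i := by
    intro i
    simp only [Q, Matrix.mulVec, dotProduct, Finset.mul_sum, Finset.sum_mul]
    rw [Finset.sum_comm' (t' := Finset.univ) (s' := fun _ => Finset.univ) (by simp)]
    conv_rhs => rw [Finset.sum_comm]
    rw [Finset.sum_comm]
    refine Finset.sum_congr rfl fun a _ => ?_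
    rw [Finset.sum_comm]
    conv_rhs => rw [Finset.sum_comm]
    rw [Finset.sum_comm]
    exact Finset.sum_congr rfl fun b _ => Finset.sum_congr rfl fun m _ => by ring
  have h2 : ∑ i, ∑ j, G i j * (-(G⁻¹.mulVec Q i)) * ξ j = -∑ j, Q j * ξ j := by
    rw [Finset.sum_comm, ← Finset.sum_neg_distrib]
    refine Finset.sum_congr rfl fun j _ => ?_
    have : (G.mulVec (G⁻¹.mulVec Q)) j = Q j := by
      rw [Matrix.mulVec_mulVec, Matrix.mul_nonsing_inv _ hG, Matrix.one_mulVec]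
    rw [← this]
    simp only [Matrix.mulVec, dotProduct, Finset.sum_mul, ← Finset.sum_neg_distrib]
    refine Finset.sum_congr rfl fun i _ => ?_
    rw [hs i j, Finset.sum_neg_distrib]; ring
  simp only [h1]
  rw [h2]
  have h3 : ∑ j, Q j * ξ j = 1 / 2 * ∑ a, ∑ b, ∑ j, D b a j * v b * v a * ξ j +
      1 / 2 * ∑ a, ∑ b, ∑ j, D a b j * v a * v b * ξ j -
      1 / 2 * ∑ a, ∑ b, ∑ j, D j a b * ξ j * v a * v b := by
    simp only [Q, Finset.sum_mul, Finset.mul_sum, ← Finset.sum_add_distrib,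
      ← Finset.sum_sub_distrib]
    rw [Finset.sum_comm]
    refine Finset.sum_congr rfl fun a _ => ?_
    rw [Finset.sum_comm]
    exact Finset.sum_congr rfl fun b _ => Finset.sum_congr rfl fun m _ => by ring
  have h4 : ∑ a, ∑ b, ∑ j, D a b j * v a * v b * ξ j =
      ∑ a, ∑ b, ∑ j, D b a j * v b * v a * ξ j := by
    rw [Finset.sum_comm]
  have h5 : ∑ i, ∑ j, (∑ k, D k i j * v k) * v i * ξ j =
      ∑ a, ∑ b, ∑ j, D b a j * v b * v a * ξ j := by
    simp only [Finset.sum_mul]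
    exact Finset.sum_congr rfl fun a _ => Finset.sum_comm
  have h6 : ∑ i, ∑ j, (∑ k, D k i j * ξ k) * v i * v j =
      ∑ a, ∑ b, ∑ j, D j a b * ξ j * v a * v b := by
    simp only [Finset.sum_mul]
  rw [h3, h4, h5, h6]
  ring

/-- The Euler-Lagrange identity along a geodesic, tested with a vector field `ξ`. -/
theorem IsRiemannianMetricOn.hasDerivAt_momentum (hg : IsRiemannianMetricOn U g)
    {c : ℝ → (Fin d → ℝ) × (Fin d → ℝ)} {ξ : ℝ → Fin d → ℝ} {ξ' : Fin d → ℝ} {t : ℝ}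
    (hU : (c t).1 ∈ U) (hc : HasDerivAt c (geodesicField g (c t)) t) (hξ : HasDerivAt ξ ξ' t) :
    HasDerivAt (fun t => metricInner g (c t).1 (c t).2 (ξ t))
      (fderiv ℝ (kinetic g) (c t) (ξ t, ξ')) t := by
  have h1 : HasDerivAt (fun t => (c t).1) (c t).2 t :=
    (hasFDerivAt_fst (𝕜 := ℝ) (p := c t)).comp_hasDerivAt t hc
  have h2 : HasDerivAt (fun t => (c t).2) (geodesicField g (c t)).2 t :=
    (hasFDerivAt_snd (𝕜 := ℝ) (p := c t)).comp_hasDerivAt t hc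
  convert hg.hasDerivAt_metricInner (x := fun t => (c t).1) hU h1 h2 hξ using 1
  rw [← Prod.mk.eta (p := c t), hg.fderiv_kinetic hU]
  congr 1
  have := christoffel_euler_lagrange (hg.det_pos hU).ne'.isUnit (hg.apply_comm hU)
    (fun k i j => partialDeriv k (fun y => g y i j) (c t).1) (c t).2 (ξ t)
  simp only [fderiv_eq_sum_partialDeriv, metricInner, geodesicField, christoffel]
  exact this.symm

/-- Taking ξ to be the velocity, the derivative X of ⟨v, v⟩ is also the derivative of the kinetic
energy ⟨v, v⟩/2. Hence X = X/2 and X = 0. -/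
theorem IsRiemannianMetricOn.hasDerivAt_speed (hg : IsRiemannianMetricOn U g)
    {c : ℝ → (Fin d → ℝ) × (Fin d → ℝ)} {t : ℝ}
    (hU : (c t).1 ∈ U) (hc : HasDerivAt c (geodesicField g (c t)) t) :
    HasDerivAt (fun t => metricInner g (c t).1 (c t).2 (c t).2) 0 t := by
  have h2 : HasDerivAt (fun t => (c t).2) (geodesicField g (c t)).2 t :=
    (hasFDerivAt_snd (𝕜 := ℝ) (p := c t)).comp_hasDerivAt t hc
  have hm := hg.hasDerivAt_momentum hU hc h2
  have hk : HasDerivAt (fun t => kinetic g (c t))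
      (fderiv ℝ (kinetic g) (c t) (geodesicField g (c t))) t :=
    ((hg.contDiffOn_kinetic.contDiffAt ((hg.isOpen.prod isOpen_univ).mem_nhds
      ⟨hU, mem_univ _⟩)).differentiableAt (by simp)).hasFDerivAt.comp_hasDerivAt t hc
  have e := (hm.const_mul (1 / 2)).unique hk
  have : fderiv ℝ (kinetic g) (c t) ((c t).2, (geodesicField g (c t)).2) = 0 := by
    change 1 / 2 * fderiv ℝ (kinetic g) (c t) ((c t).2, (geodesicField g (c t)).2) =
      fderiv ℝ (kinetic g) (c t) ((c t).2, (geodesicField g (c t)).2) at e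
    linarith
  rwa [this] at hm

end FluctuationGeometry
end

noncomputable section

namespace FluctuationGeometry

open Metric Filter Topology

variable {d : ℕ} {U : Set (Fin d → ℝ)} {g : (Fin d → ℝ) → Matrix (Fin d) (Fin d) ℝ}

/-! ### Geodesics as integral curves -/

/-- `z = (γ, γ')` for a geodesic `γ` in `U` on the time interval `[0, T]`. -/
def IsGeodesicLift (U : Set (Fin d → ℝ)) (g : (Fin d → ℝ) → Matrix (Fin d) (Fin d) ℝ) (T : ℝ)
    (z : ℝ → (Fin d → ℝ) × (Fin d → ℝ)) : Prop :=
  ∀ t ∈ Icc 0 T, (z t).1 ∈ U ∧ HasDerivWithinAt z (geodesicField g (z t)) (Icc 0 T) t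

theorem isGeodesicFrom_iff {a e : Fin d → ℝ} {L : ℝ} {γ : ℝ → Fin d → ℝ} :
    IsGeodesicFrom U g a e L γ ↔
      ∃ z, IsGeodesicLift U g L z ∧ z 0 = (a, e) ∧ ∀ t, (z t).1 = γ t := by
  constructor
  · rintro ⟨v, h0, hv0, h⟩
    exact ⟨fun t => (γ t, v t), fun t ht => ⟨(h t ht).1, (h t ht).2.1.prodMk (h t ht).2.2⟩,
      by simp [h0, hv0], fun t => rfl⟩
  · rintro ⟨z, hz, h0, hγ⟩
    obtain rfl : (fun t => (z t).1) = γ := funext hγ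
    refine ⟨fun t => (z t).2, by simp [h0], by simp [h0], fun t ht => ⟨(hz t ht).1, ?_, ?_⟩⟩
    · exact (hasFDerivAt_fst (𝕜 := ℝ) (p := z t)).comp_hasDerivWithinAt t (hz t ht).2
    · exact (hasFDerivAt_snd (𝕜 := ℝ) (p := z t)).comp_hasDerivWithinAt t (hz t ht).2

/-- `φ` is the flow of a smooth field `f` of compact support that agrees with the geodesic field
on the open set `O`. -/
structure IsLocalGeodesicFlow (U : Set (Fin d → ℝ))
    (g : (Fin d → ℝ) → Matrix (Fin d) (Fin d) ℝ) (O : Set ((Fin d → ℝ) × (Fin d → ℝ)))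
    (f : (Fin d → ℝ) × (Fin d → ℝ) → (Fin d → ℝ) × (Fin d → ℝ))
    (φ : ℝ → (Fin d → ℝ) × (Fin d → ℝ) → (Fin d → ℝ) × (Fin d → ℝ)) : Prop where
  isFlow : IsFlow f φ
  contDiff : ContDiff ℝ ∞ f
  hasCompactSupport : HasCompactSupport f
  isOpen : IsOpen O
  subset : O ⊆ U ×ˢ univ
  eqOn : EqOn f (geodesicField g) O

/-- The geodesic field lives only over U and need not be complete. The field cut off near K has a
global smooth flow, whose orbits are geodesics as long as they stay in O. -/
theorem IsRiemannianMetricOn.exists_isLocalGeodesicFlow (hg : IsRiemannianMetricOn U g)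
    {K : Set ((Fin d → ℝ) × (Fin d → ℝ))} (hK : IsCompact K) (hKU : K ⊆ U ×ˢ univ) :
    ∃ O f φ, K ⊆ O ∧ IsLocalGeodesicFlow U g O f φ := by
  obtain ⟨f, O, hf, hc, hO, hKO, hOU, hfO⟩ := exists_contDiff_hasCompactSupport_eqOn
    (hg.isOpen.prod isOpen_univ) hg.contDiffOn_geodesicField hK hKU
  obtain ⟨C, hC, -⟩ := hf.exists_bound_fderiv hc
  obtain ⟨B, hB⟩ := hc.exists_bound_of_continuous hf.continuous
  obtain ⟨φ, hφ⟩ := exists_isFlow hC (B := ⟨max B 0, le_max_right _ _⟩)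
    (fun z => (hB z).trans (le_max_left _ _))
  exact ⟨O, f, φ, hKO, hφ, hf, hc, hO, hOU, hfO⟩

namespace IsLocalGeodesicFlow

variable {O : Set ((Fin d → ℝ) × (Fin d → ℝ))}
  {f : (Fin d → ℝ) × (Fin d → ℝ) → (Fin d → ℝ) × (Fin d → ℝ)}
  {φ : ℝ → (Fin d → ℝ) × (Fin d → ℝ) → (Fin d → ℝ) × (Fin d → ℝ)}
  (h : IsLocalGeodesicFlow U g O f φ)

include h

theorem exists_lipschitzWith : ∃ K, LipschitzWith K f :=
  let ⟨K, hK, _⟩ := h.contDiff.exists_bound_fderiv h.hasCompactSupport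
  ⟨K, hK⟩

theorem contDiff_flow : ContDiff ℝ ∞ fun z : ℝ × ((Fin d → ℝ) × (Fin d → ℝ)) => φ z.1 z.2 :=
  h.isFlow.contDiff_uncurry h.contDiff h.hasCompactSupport

theorem flow_neg_flow (t : ℝ) (w : (Fin d → ℝ) × (Fin d → ℝ)) : φ (-t) (φ t w) = w := by
  obtain ⟨K, hK⟩ := h.exists_lipschitzWith
  rw [← h.isFlow.add hK, neg_add_cancel, h.isFlow.zero]

theorem hasDerivAt {t : ℝ} {w : (Fin d → ℝ) × (Fin d → ℝ)} (hw : φ t w ∈ O) :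
    HasDerivAt (fun t => φ t w) (geodesicField g (φ t w)) t :=
  h.eqOn hw ▸ h.isFlow.hasDerivAt t w

theorem mem {z : (Fin d → ℝ) × (Fin d → ℝ)} (hz : z ∈ O) : z.1 ∈ U := (h.subset hz).1

theorem isGeodesicLift {T : ℝ} {w : (Fin d → ℝ) × (Fin d → ℝ)}
    (hw : ∀ t ∈ Icc 0 T, φ t w ∈ O) : IsGeodesicLift U g T fun t => φ t w := fun t ht =>
  ⟨h.mem (hw t ht), (h.hasDerivAt (hw t ht)).hasDerivWithinAt⟩

end IsLocalGeodesicFlow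

namespace IsGeodesicLift

variable {T : ℝ} {z z₁ z₂ : ℝ → (Fin d → ℝ) × (Fin d → ℝ)}

theorem continuousOn (h : IsGeodesicLift U g T z) : ContinuousOn z (Icc 0 T) := fun t ht =>
  (h t ht).2.continuousWithinAt

theorem isCompact_image (h : IsGeodesicLift U g T z) : IsCompact (z '' Icc 0 T) :=
  isCompact_Icc.image_of_continuousOn h.continuousOn

theorem image_subset (h : IsGeodesicLift U g T z) : z '' Icc 0 T ⊆ U ×ˢ univ := by
  rintro _ ⟨t, ht, rfl⟩
  exact ⟨(h t ht).1, mem_univ _⟩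

theorem eq_flow (h : IsGeodesicLift U g T z) {O f φ}
    (hf : IsLocalGeodesicFlow U g O f φ) (hO : z '' Icc 0 T ⊆ O) :
    ∀ t ∈ Icc 0 T, z t = φ t (z 0) := by
  obtain ⟨K, hK⟩ := hf.exists_lipschitzWith
  exact hf.isFlow.eqOn_of_hasDerivWithinAt hK fun t ht => by
    rw [hf.eqOn (hO ⟨t, ht, rfl⟩)]; exact (h t ht).2

/-- Cutting off near both orbits at once puts them in one global flow; uniqueness forwards and
backwards in time then follows from the flow laws. -/
theorem exists_common_flow (hg : IsRiemannianMetricOn U g) (h₁ : IsGeodesicLift U g T z₁)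
    (h₂ : IsGeodesicLift U g T z₂) :
    ∃ O f φ, IsLocalGeodesicFlow U g O f φ ∧ (∀ t ∈ Icc 0 T, z₁ t = φ t (z₁ 0)) ∧
      ∀ t ∈ Icc 0 T, z₂ t = φ t (z₂ 0) := by
  obtain ⟨O, f, φ, hO, hf⟩ := hg.exists_isLocalGeodesicFlow
    (h₁.isCompact_image.union h₂.isCompact_image) (union_subset h₁.image_subset h₂.image_subset)
  exact ⟨O, f, φ, hf, h₁.eq_flow hf (subset_union_left.trans hO),
    h₂.eq_flow hf (subset_union_right.trans hO)⟩

theorem eqOn (hg : IsRiemannianMetricOn U g) (h₁ : IsGeodesicLift U g T z₁)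
    (h₂ : IsGeodesicLift U g T z₂) (h0 : z₁ 0 = z₂ 0) : EqOn z₁ z₂ (Icc 0 T) := by
  obtain ⟨O, f, φ, hf, e₁, e₂⟩ := h₁.exists_common_flow hg h₂
  intro t ht
  rw [e₁ t ht, e₂ t ht, h0]

theorem eq_zero_of_eq (hg : IsRiemannianMetricOn U g) (h₁ : IsGeodesicLift U g T z₁)
    (h₂ : IsGeodesicLift U g T z₂) {t : ℝ} (ht : t ∈ Icc 0 T) (h : z₁ t = z₂ t) :
    z₁ 0 = z₂ 0 := by
  obtain ⟨O, f, φ, hf, e₁, e₂⟩ := h₁.exists_common_flow hg h₂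
  rw [e₁ t ht, e₂ t ht] at h
  rw [← hf.flow_neg_flow t (z₁ 0), h, hf.flow_neg_flow]

/-- The tube lemma provides the margin ε. In the initial value it yields smooth dependence; in time
it yields two-sided derivatives at 0 and T. -/
theorem exists_flow (hg : IsRiemannianMetricOn U g) (hT : 0 ≤ T) (h : IsGeodesicLift U g T z) :
    ∃ O f φ, IsLocalGeodesicFlow U g O f φ ∧ (∀ t ∈ Icc 0 T, z t = φ t (z 0)) ∧
      ∃ ε > 0, ∀ w ∈ ball (z 0) ε, ∀ t ∈ Icc (-ε) (T + ε), φ t w ∈ O := by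
  obtain ⟨O, f, φ, hO, hf⟩ := hg.exists_isLocalGeodesicFlow h.isCompact_image h.image_subset
  have e := h.eq_flow hf hO
  refine ⟨O, f, φ, hf, e, ?_⟩
  obtain ⟨u, v, hu, hv, hTu, hzv, huv⟩ := generalized_tube_lemma (isCompact_Icc (a := 0) (b := T))
    (isCompact_singleton (x := z 0)) (hf.isOpen.preimage hf.contDiff_flow.continuous) (by
      rintro ⟨t, w⟩ ⟨ht, hw⟩
      obtain rfl : w = z 0 := hw
      exact hO ⟨t, ht, e t ht⟩)
  obtain ⟨ε₁, hε₁, h1⟩ := Metric.isOpen_iff.1 hv (z 0) (hzv rfl)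
  obtain ⟨ε₂, hε₂, h2⟩ := isCompact_Icc.exists_thickening_subset_open hu hTu
  refine ⟨min ε₁ (ε₂ / 2), by positivity, fun w hw t ht => ?_⟩
  have hm1 := min_le_left ε₁ (ε₂ / 2)
  have hm2 := min_le_right ε₁ (ε₂ / 2)
  refine huv (Set.mk_mem_prod (h2 ?_) (h1 (ball_subset_ball hm1 hw)))
  rw [Metric.mem_thickening_iff]
  refine ⟨projIcc 0 T hT t, (projIcc 0 T hT t).2, ?_⟩
  rw [Real.dist_eq, coe_projIcc, abs_lt]
  constructor <;> rcases le_total T t with h1 | h1 <;> rcases le_total 0 t with h2 | h2 <;>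
    simp [min_eq_left, min_eq_right, h1, h2, hT] <;> linarith [ht.1, ht.2]

theorem mono (h : IsGeodesicLift U g T z) {T' : ℝ} (hT : T' ≤ T) : IsGeodesicLift U g T' z :=
  fun t ht => ⟨(h t ⟨ht.1, ht.2.trans hT⟩).1,
    (h t ⟨ht.1, ht.2.trans hT⟩).2.mono (Icc_subset_Icc_right hT)⟩

theorem rescale (h : IsGeodesicLift U g T z) {T' s : ℝ} (hs : 0 ≤ s) (hT : s * T' ≤ T) :
    IsGeodesicLift U g T' fun t => ((z (s * t)).1, s • (z (s * t)).2) := by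
  intro t ht
  have hmaps : MapsTo (fun t => s * t) (Icc 0 T') (Icc 0 T) := fun t ht =>
    ⟨mul_nonneg hs ht.1, (mul_le_mul_of_nonneg_left ht.2 hs).trans hT⟩
  obtain ⟨hU, hd⟩ := h (s * t) (hmaps ht)
  refine ⟨hU, ?_⟩
  have h1 := hd.scomp t ((hasDerivAt_id t).const_mul s).hasDerivWithinAt hmaps
  rw [mul_one] at h1
  have h2 := (hasFDerivAt_fst (𝕜 := ℝ) (p := z (s * t))).comp_hasDerivWithinAt t h1
  have h3 := ((hasFDerivAt_snd (𝕜 := ℝ) (p := z (s * t))).comp_hasDerivWithinAt t h1).const_smul s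
  refine (h2.prodMk h3).congr_deriv ?_
  refine Prod.ext rfl (funext fun k => ?_)
  simp only [geodesicField, ContinuousLinearMap.coe_snd', Prod.smul_snd, Pi.smul_apply,
    smul_eq_mul, mul_neg, Finset.mul_sum]
  refine congrArg _ (Finset.sum_congr rfl fun i _ => Finset.sum_congr rfl fun j _ => by ring)

theorem speed_eq (hg : IsRiemannianMetricOn U g) (h : IsGeodesicLift U g T z) {t : ℝ}
    (ht : t ∈ Icc 0 T) :
    metricInner g (z t).1 (z t).2 (z t).2 = metricInner g (z 0).1 (z 0).2 (z 0).2 := by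
  obtain ⟨O, f, φ, hf, e, ε, hε, hO⟩ := h.exists_flow hg (ht.1.trans ht.2)
  rw [e t ht]
  have hd : ∀ s ∈ Icc (-ε) (T + ε), HasDerivAt (fun s => metricInner g (φ s (z 0)).1 (φ s (z 0)).2
      (φ s (z 0)).2) 0 s := fun s hs => by
    have := hO (z 0) (mem_ball_self hε) s hs
    exact hg.hasDerivAt_speed (c := fun s => φ s (z 0)) (hf.mem this) (hf.hasDerivAt this)
  have := (convex_Icc (-ε) (T + ε)).is_const_of_fderivWithin_eq_zero (𝕜 := ℝ)
    (fun s hs => (hd s hs).differentiableAt.differentiableWithinAt)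
    (fun s hs => ?_) (x := t) (y := 0) ⟨by linarith [ht.1], by linarith [ht.2]⟩
    ⟨by linarith, by linarith [ht.1, ht.2]⟩
  · rw [this, hf.isFlow.zero]
  · rw [((hd s hs).hasFDerivAt.hasFDerivWithinAt).fderivWithin
      (uniqueDiffOn_Icc (by linarith [ht.1, ht.2]) s hs)]
    ext; simp

/-- Uniqueness of geodesics makes the choice inside `geodesicPoint` irrelevant. -/
theorem geodesicPoint_eq (hg : IsRiemannianMetricOn U g) (hT : 0 ≤ T) {a e : Fin d → ℝ}
    (h : IsGeodesicLift U g T z) (h0 : z 0 = (a, e)) : geodesicPoint U g a e T = (z T).1 := by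
  have hex : ∃ γ, IsGeodesicFrom U g a e T γ := ⟨_, isGeodesicFrom_iff.2 ⟨z, h, h0, fun _ => rfl⟩⟩
  obtain ⟨z', h', h0', he⟩ := isGeodesicFrom_iff.1 hex.choose_spec
  rw [geodesicPoint, dif_pos hex, ← he, h'.eqOn hg h (by rw [h0, h0']) ⟨hT, le_rfl⟩]

end IsGeodesicLift

/-! ### The exponential map -/

/-- The domain of the exponential map at `a`. -/
def expDomain (U : Set (Fin d → ℝ)) (g : (Fin d → ℝ) → Matrix (Fin d) (Fin d) ℝ)
    (a : Fin d → ℝ) : Set (Fin d → ℝ) :=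
  {v | ∃ z, IsGeodesicLift U g 1 z ∧ z 0 = (a, v)}

/-- The exponential map at `a`. -/
def expMap (U : Set (Fin d → ℝ)) (g : (Fin d → ℝ) → Matrix (Fin d) (Fin d) ℝ)
    (a v : Fin d → ℝ) : Fin d → ℝ :=
  geodesicPoint U g a v 1

theorem IsRiemannianMetricOn.exists_expMap_eq_flow (hg : IsRiemannianMetricOn U g)
    {a v : Fin d → ℝ} (hv : v ∈ expDomain U g a) :
    ∃ O f φ, IsLocalGeodesicFlow U g O f φ ∧
      ∀ᶠ w in 𝓝 v, w ∈ expDomain U g a ∧ expMap U g a w = (φ 1 (a, w)).1 := by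
  obtain ⟨z, hz, h0⟩ := hv
  obtain ⟨O, f, φ, hf, -, ε, hε, hO⟩ := hz.exists_flow hg zero_le_one
  refine ⟨O, f, φ, hf, ?_⟩
  filter_upwards [ball_mem_nhds v hε] with w hw
  have hw' : (a, w) ∈ ball (z 0) ε := by
    rw [h0, mem_ball, Prod.dist_eq, dist_self]
    exact max_lt hε hw
  have hl : IsGeodesicLift U g 1 fun t => φ t (a, w) := hf.isGeodesicLift fun t ht =>
    hO _ hw' t ⟨by linarith [ht.1], by linarith [ht.2]⟩
  exact ⟨⟨_, hl, hf.isFlow.zero _⟩, hl.geodesicPoint_eq hg zero_le_one (hf.isFlow.zero _)⟩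

theorem IsRiemannianMetricOn.isOpen_expDomain (hg : IsRiemannianMetricOn U g) (a : Fin d → ℝ) :
    IsOpen (expDomain U g a) := isOpen_iff_mem_nhds.2 fun v hv => by
  obtain ⟨O, f, φ, -, h⟩ := hg.exists_expMap_eq_flow hv
  filter_upwards [h] with w hw using hw.1

theorem IsRiemannianMetricOn.contDiffAt_expMap (hg : IsRiemannianMetricOn U g)
    {a v : Fin d → ℝ} (hv : v ∈ expDomain U g a) : ContDiffAt ℝ ∞ (expMap U g a) v := by
  obtain ⟨O, f, φ, hf, h⟩ := hg.exists_expMap_eq_flow hv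
  have : ContDiff ℝ ∞ fun w : Fin d → ℝ => (φ 1 (a, w)).1 :=
    contDiff_fst.comp (hf.contDiff_flow.comp (contDiff_const.prodMk
      (contDiff_const.prodMk contDiff_id)))
  exact this.contDiffAt.congr_of_eventuallyEq (h.mono fun w hw => hw.2)

theorem mem_expDomain_smul_iff {a e : Fin d → ℝ} {ℓ : ℝ} (hℓ : 0 < ℓ) :
    ℓ • e ∈ expDomain U g a ↔ ∃ z, IsGeodesicLift U g ℓ z ∧ z 0 = (a, e) := by
  constructor
  · rintro ⟨z, hz, h0⟩
    refine ⟨_, hz.rescale (T' := ℓ) (s := ℓ⁻¹) (by positivity) (by field_simp; exact le_rfl), ?_⟩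
    simp [h0, hℓ.ne']
  · rintro ⟨z, hz, h0⟩
    exact ⟨_, hz.rescale (T' := 1) (s := ℓ) hℓ.le (by simp), by simp [h0]⟩

theorem IsGeodesicLift.expMap_eq (hg : IsRiemannianMetricOn U g) {T : ℝ}
    {z : ℝ → (Fin d → ℝ) × (Fin d → ℝ)} {a e : Fin d → ℝ} (hT : 0 ≤ T)
    (h : IsGeodesicLift U g T z) (h0 : z 0 = (a, e)) : expMap U g a (T • e) = (z T).1 := by
  have := (h.rescale (T' := 1) (s := T) hT (by simp)).geodesicPoint_eq hg zero_le_one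
    (a := a) (e := T • e) (by simp [h0])
  simpa [expMap] using this

end FluctuationGeometry
end

noncomputable section

namespace FluctuationGeometry

open Metric Filter Topology

variable {d : ℕ} {U : Set (Fin d → ℝ)} {g : (Fin d → ℝ) → Matrix (Fin d) (Fin d) ℝ}

/-! ### Paths, length and distance -/

/-- `c` is a `C^1` path in `U` on `[α, β]` with velocity `c'`. -/
structure IsPath (U : Set (Fin d → ℝ)) (c c' : ℝ → Fin d → ℝ) (α β : ℝ) : Prop where
  mem : ∀ t ∈ Icc α β, c t ∈ U
  hasDerivWithinAt : ∀ t ∈ Icc α β, HasDerivWithinAt c (c' t) (Icc α β) t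
  continuousOn_deriv : ContinuousOn c' (Icc α β)

/-- The length of a path. -/
def pathLength (g : (Fin d → ℝ) → Matrix (Fin d) (Fin d) ℝ) (c c' : ℝ → Fin d → ℝ) (α β : ℝ) :
    ℝ :=
  ∫ t in α..β, √(metricInner g (c t) (c' t) (c' t))

/-- The lengths of the `C^1` curves in `U` from `a` to `b`. -/
def lengthSet (U : Set (Fin d → ℝ)) (g : (Fin d → ℝ) → Matrix (Fin d) (Fin d) ℝ)
    (a b : Fin d → ℝ) : Set ℝ :=
  {L : ℝ | ∃ c : ℝ → Fin d → ℝ, ContDiffOn ℝ 1 c (Icc 0 1) ∧ MapsTo c (Icc 0 1) U ∧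
    c 0 = a ∧ c 1 = b ∧ curveLength g c = L}

theorem riemannianDist_eq (a b : Fin d → ℝ) : riemannianDist U g a b = sInf (lengthSet U g a b) :=
  rfl

theorem IsPath.continuousOn {c c' : ℝ → Fin d → ℝ} {α β : ℝ} (h : IsPath U c c' α β) :
    ContinuousOn c (Icc α β) := fun t ht => (h.hasDerivWithinAt t ht).continuousWithinAt

theorem pathLength_congr {c c' b b' : ℝ → Fin d → ℝ} {α β : ℝ} (hαβ : α ≤ β)
    (h : EqOn c b (Icc α β)) (h' : EqOn c' b' (Icc α β)) :
    pathLength g c c' α β = pathLength g b b' α β :=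
  intervalIntegral.integral_congr fun t ht => by
    rw [uIcc_of_le hαβ] at ht
    simp only [h ht, h' ht]

theorem mem_lengthSet_iff {a b : Fin d → ℝ} {L : ℝ} :
    L ∈ lengthSet U g a b ↔
      ∃ c c', IsPath U c c' 0 1 ∧ c 0 = a ∧ c 1 = b ∧ pathLength g c c' 0 1 = L := by
  have hu : UniqueDiffOn ℝ (Icc (0 : ℝ) 1) := uniqueDiffOn_Icc zero_lt_one
  constructor
  · rintro ⟨c, hc, hcU, h0, h1, rfl⟩
    exact ⟨c, derivWithin c (Icc 0 1), ⟨hcU, fun t ht =>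
      (hc.differentiableOn one_ne_zero t ht).hasDerivWithinAt,
      hc.continuousOn_derivWithin hu le_rfl⟩, h0, h1, rfl⟩
  · rintro ⟨c, c', hc, h0, h1, rfl⟩
    have e : EqOn (derivWithin c (Icc 0 1)) c' (Icc 0 1) := fun t ht =>
      (hc.hasDerivWithinAt t ht).derivWithin (hu t ht)
    refine ⟨c, (contDiffOn_one_iff_derivWithin hu).2 ⟨fun t ht =>
      (hc.hasDerivWithinAt t ht).differentiableWithinAt, hc.continuousOn_deriv.congr e⟩, hc.mem,
      h0, h1, pathLength_congr zero_le_one (fun _ _ => rfl) e⟩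

theorem pathLength_nonneg {c c' : ℝ → Fin d → ℝ} {α β : ℝ} (h : α ≤ β) :
    0 ≤ pathLength g c c' α β :=
  intervalIntegral.integral_nonneg h fun _ _ => Real.sqrt_nonneg _

theorem bddBelow_lengthSet (a b : Fin d → ℝ) : BddBelow (lengthSet U g a b) :=
  ⟨0, fun L hL => by
    obtain ⟨c, c', -, -, -, rfl⟩ := mem_lengthSet_iff.1 hL
    exact pathLength_nonneg zero_le_one⟩

theorem riemannianDist_nonneg (a b : Fin d → ℝ) : 0 ≤ riemannianDist U g a b :=
  Real.sInf_nonneg fun L hL => by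
    obtain ⟨c, c', -, -, -, rfl⟩ := mem_lengthSet_iff.1 hL
    exact pathLength_nonneg zero_le_one

theorem IsPath.riemannianDist_le {c c' : ℝ → Fin d → ℝ} (h : IsPath U c c' 0 1) :
    riemannianDist U g (c 0) (c 1) ≤ pathLength g c c' 0 1 :=
  csInf_le (bddBelow_lengthSet _ _) (mem_lengthSet_iff.2 ⟨c, c', h, rfl, rfl, rfl⟩)

theorem IsPath.comp {c c' : ℝ → Fin d → ℝ} {α β p q : ℝ} {σ σ' : ℝ → ℝ}
    (h : IsPath U c c' α β) (hσ : ∀ t ∈ Icc p q, HasDerivWithinAt σ (σ' t) (Icc p q) t)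
    (hσ' : ContinuousOn σ' (Icc p q)) (hm : MapsTo σ (Icc p q) (Icc α β)) :
    IsPath U (c ∘ σ) (fun t => σ' t • c' (σ t)) p q where
  mem t ht := h.mem _ (hm ht)
  hasDerivWithinAt t ht := (h.hasDerivWithinAt _ (hm ht)).scomp t (hσ t ht) hm
  continuousOn_deriv := hσ'.smul (h.continuousOn_deriv.comp
    (fun t ht => (hσ t ht).continuousWithinAt) hm)

theorem pathLength_comp {c c' : ℝ → Fin d → ℝ} {p q : ℝ} {σ σ' : ℝ → ℝ} (hpq : p ≤ q)
    (hσ : ∀ t ∈ Icc p q, HasDerivWithinAt σ (σ' t) (Icc p q) t)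
    (hσ' : ∀ t ∈ Icc p q, 0 ≤ σ' t) :
    pathLength g (c ∘ σ) (fun t => σ' t • c' (σ t)) p q = pathLength g c c' (σ p) (σ q) := by
  unfold pathLength
  rw [← intervalIntegral.integral_comp_mul_deriv_of_deriv_nonneg (f := σ) (f' := σ')]
  · refine intervalIntegral.integral_congr fun t ht => ?_
    rw [uIcc_of_le hpq] at ht
    simp only [Function.comp, metricInner_smul_left, metricInner_smul_right]
    rw [← mul_assoc, Real.sqrt_mul (mul_nonneg (hσ' t ht) (hσ' t ht)),
      Real.sqrt_mul_self (hσ' t ht), mul_comm]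
  · rw [uIcc_of_le hpq]; exact fun t ht => (hσ t ht).continuousWithinAt
  · rw [min_eq_left hpq, max_eq_right hpq]
    exact fun t ht => (hσ t (Ioo_subset_Icc_self ht)).hasDerivAt (Icc_mem_nhds ht.1 ht.2)
  · rw [min_eq_left hpq, max_eq_right hpq]
    exact fun t ht => hσ' t (Ioo_subset_Icc_self ht)

theorem IsRiemannianMetricOn.continuousOn_speed (hg : IsRiemannianMetricOn U g)
    {c c' : ℝ → Fin d → ℝ} {α β : ℝ} (h : IsPath U c c' α β) :
    ContinuousOn (fun t => √(metricInner g (c t) (c' t) (c' t))) (Icc α β) :=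
  (hg.continuousOn_metricInner h.mem h.continuousOn h.continuousOn_deriv
    h.continuousOn_deriv).sqrt

theorem Real.deriv_smoothTransition_of_eq_zero {x : ℝ} (hx : Real.smoothTransition x = 0) :
    deriv Real.smoothTransition x = 0 :=
  IsLocalMin.deriv_eq_zero (Eventually.of_forall fun y => by
    rw [hx]; exact Real.smoothTransition.nonneg y)

theorem Real.deriv_smoothTransition_of_eq_one {x : ℝ} (hx : Real.smoothTransition x = 1) :
    deriv Real.smoothTransition x = 0 :=
  IsLocalMax.deriv_eq_zero (Eventually.of_forall fun y => by
    rw [hx]; exact Real.smoothTransition.le_one y)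

/-- Paths can be concatenated to a `C^1` path without changing the total length. -/
theorem IsPath.exists_concat (hg : IsRiemannianMetricOn U g) {c c' b b' : ℝ → Fin d → ℝ}
    (hc : IsPath U c c' 0 1) (hb : IsPath U b b' 0 1) (hcb : c 1 = b 0) :
    ∃ k k', IsPath U k k' 0 1 ∧ k 0 = c 0 ∧ k 1 = b 1 ∧
      pathLength g k k' 0 1 = pathLength g c c' 0 1 + pathLength g b b' 0 1 := by
  -- Each path is run with a smooth clock that stands still on the half of [0, 1] belonging to the
  -- other path, so the velocities match (both vanish) at the junction.
  set T := Real.smoothTransition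
  have hTd : ∀ x, HasDerivAt T (deriv T x) x := fun x =>
    (Real.smoothTransition.contDiffAt.differentiableAt (n := 1) one_ne_zero).hasDerivAt
  have hT' : Continuous (deriv T) :=
    Real.smoothTransition.contDiff.continuous_deriv (n := 1) le_rfl
  have hT0 : ∀ x, 0 ≤ deriv T x := fun x => Real.smoothTransition.monotone.deriv_nonneg
  let σ : ℝ → ℝ := fun s => T (2 * s)
  let σ' : ℝ → ℝ := fun s => deriv T (2 * s) * 2
  let ρ : ℝ → ℝ := fun s => T (2 * s - 1)
  let ρ' : ℝ → ℝ := fun s => deriv T (2 * s - 1) * 2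
  have hσd : ∀ s, HasDerivAt σ (σ' s) s := fun s => by
    simpa [σ, σ', Function.comp_def] using (hTd (2 * s)).comp s ((hasDerivAt_id s).const_mul 2)
  have hρd : ∀ s, HasDerivAt ρ (ρ' s) s := fun s => by
    simpa [ρ, ρ', Function.comp_def] using
      (hTd (2 * s - 1)).comp s (((hasDerivAt_id s).const_mul 2).sub_const 1)
  have hσc : Continuous σ' := by fun_prop
  have hρc : Continuous ρ' := by fun_prop
  have hσ0 : ∀ s, 0 ≤ σ' s := fun s => mul_nonneg (hT0 _) zero_le_two
  have hρ0 : ∀ s, 0 ≤ ρ' s := fun s => mul_nonneg (hT0 _) zero_le_two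
  have hσm : ∀ s, σ s ∈ Icc (0 : ℝ) 1 := fun s =>
    ⟨Real.smoothTransition.nonneg _, Real.smoothTransition.le_one _⟩
  have hρm : ∀ s, ρ s ∈ Icc (0 : ℝ) 1 := fun s =>
    ⟨Real.smoothTransition.nonneg _, Real.smoothTransition.le_one _⟩
  have hσ1 : ∀ s, 1 / 2 ≤ s → σ s = 1 := fun s hs =>
    Real.smoothTransition.one_of_one_le (by linarith)
  have hρ1 : ∀ s, s ≤ 1 / 2 → ρ s = 0 := fun s hs =>
    Real.smoothTransition.zero_of_nonpos (by linarith)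
  have hσ'1 : ∀ s, 1 / 2 ≤ s → σ' s = 0 := fun s hs => by
    simp only [σ', T, Real.deriv_smoothTransition_of_eq_one (hσ1 s hs), zero_mul]
  have hρ'1 : ∀ s, s ≤ 1 / 2 → ρ' s = 0 := fun s hs => by
    simp only [ρ', T, Real.deriv_smoothTransition_of_eq_zero (hρ1 s hs), zero_mul]
  -- One formula on all of [0, 1] instead of a case distinction: the bracket vanishes on the first
  -- half, and c (σ s) = b 0 on the second.
  let k : ℝ → Fin d → ℝ := fun s => c (σ s) + (b (ρ s) - b 0)
  let k' : ℝ → Fin d → ℝ := fun s => σ' s • c' (σ s) + ρ' s • b' (ρ s)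
  have hcσ := hc.comp (p := 0) (q := 1) (fun s _ => (hσd s).hasDerivWithinAt)
    hσc.continuousOn (fun s _ => hσm s)
  have hbρ := hb.comp (p := 0) (q := 1) (fun s _ => (hρd s).hasDerivWithinAt)
    hρc.continuousOn (fun s _ => hρm s)
  have hk1 : ∀ s, s ≤ 1 / 2 → k s = (c ∘ σ) s := fun s hs => by simp [k, hρ1 s hs]
  have hk2 : ∀ s, 1 / 2 ≤ s → k s = (b ∘ ρ) s := fun s hs => by
    simp [k, hσ1 s hs, hcb]
  have hkp : IsPath U k k' 0 1 := by
    refine ⟨fun s hs => ?_, fun s hs => ?_, hcσ.continuousOn_deriv.add hbρ.continuousOn_deriv⟩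
    · rcases le_total s (1 / 2) with h | h
      · rw [hk1 s h]; exact hcσ.mem s hs
      · rw [hk2 s h]; exact hbρ.mem s hs
    · exact (hcσ.hasDerivWithinAt s hs).add ((hbρ.hasDerivWithinAt s hs).sub_const _)
  have hint := (hg.continuousOn_speed hkp)
  refine ⟨k, k', hkp, ?_, ?_, ?_⟩
  · rw [hk1 0 (by norm_num)]
    exact congrArg c (Real.smoothTransition.zero_of_nonpos (by norm_num))
  · rw [hk2 1 (by norm_num)]
    exact congrArg b (Real.smoothTransition.one_of_one_le (by norm_num))
  · have hsplit : pathLength g k k' 0 1 =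
        pathLength g k k' 0 (1 / 2) + pathLength g k k' (1 / 2) 1 := by
      refine (intervalIntegral.integral_add_adjacent_intervals ?_ ?_).symm
      · exact (hint.mono (Icc_subset_Icc_right (by norm_num))).intervalIntegrable_of_Icc
          (by norm_num)
      · exact (hint.mono (Icc_subset_Icc_left (by norm_num))).intervalIntegrable_of_Icc
          (by norm_num)
    rw [hsplit]
    congr 1
    · rw [pathLength_congr (b := c ∘ σ) (b' := fun t => σ' t • c' (σ t)) (by norm_num)
        (fun s hs => hk1 s hs.2) (fun s hs => by simp [k', hρ'1 s hs.2]),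
        pathLength_comp (by norm_num) (fun s _ => (hσd s).hasDerivWithinAt) (fun s _ => hσ0 s),
        hσ1 _ le_rfl]
      congr 1
      exact Real.smoothTransition.zero_of_nonpos (by norm_num)
    · rw [pathLength_congr (b := b ∘ ρ) (b' := fun t => ρ' t • b' (ρ t)) (by norm_num)
        (fun s hs => hk2 s hs.1) (fun s hs => by simp [k', hσ'1 s hs.1]),
        pathLength_comp (by norm_num) (fun s _ => (hρd s).hasDerivWithinAt) (fun s _ => hρ0 s),
        hρ1 _ le_rfl]
      congr 1
      exact Real.smoothTransition.one_of_one_le (by norm_num)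

/-- Triangle inequality: a nearly shortest curve to c α is continued along c. Some curve to c α must
exist, since the infimum of the empty set is 0. -/
theorem IsPath.riemannianDist_le_add (hg : IsRiemannianMetricOn U g) {a : Fin d → ℝ}
    {c c' : ℝ → Fin d → ℝ} {α β : ℝ} (hαβ : α ≤ β) (hc : IsPath U c c' α β)
    (hne : (lengthSet U g a (c α)).Nonempty) :
    riemannianDist U g a (c β) ≤ riemannianDist U g a (c α) + pathLength g c c' α β := by
  have hσ : ∀ t ∈ Icc (0 : ℝ) 1, HasDerivWithinAt (fun t => α + (β - α) * t) (β - α) (Icc 0 1) t :=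
    fun t _ => by
      simpa using (((hasDerivAt_id t).const_mul (β - α)).const_add α).hasDerivWithinAt
  have h1 := hc.comp hσ continuousOn_const (fun t ht => by
    constructor
    · nlinarith [ht.1, ht.2]
    · nlinarith [ht.1, ht.2])
  have h2 := pathLength_comp (g := g) (c := c) (c' := c') zero_le_one hσ
    (fun t ht => by linarith)
  simp only [mul_zero, add_zero, mul_one, add_sub_cancel] at h2
  refine le_of_forall_pos_le_add fun ε hε => ?_
  obtain ⟨L, hL, hLε⟩ := Real.lt_sInf_add_pos hne hε
  obtain ⟨b, b', hb, hb0, hb1, rfl⟩ := mem_lengthSet_iff.1 hL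
  obtain ⟨k, k', hk, hk0, hk1, hkl⟩ := hb.exists_concat hg h1 (by simp [hb1])
  have := hk.riemannianDist_le (g := g)
  rw [hk0, hk1, hkl, h2, hb0] at this
  simp only [Function.comp, mul_one, add_sub_cancel] at this
  rw [riemannianDist_eq a (c α)]
  linarith

theorem riemannianDist_self {a : Fin d → ℝ} (ha : a ∈ U) : riemannianDist U g a a = 0 := by
  refine le_antisymm ?_ (riemannianDist_nonneg _ _)
  have : IsPath U (fun _ => a) (fun _ => 0) 0 1 :=
    ⟨fun _ _ => ha, fun t _ => hasDerivWithinAt_const _ _ _, continuousOn_const⟩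
  simpa [pathLength, metricInner_zero_left] using this.riemannianDist_le (g := g)

theorem lengthSet_self_nonempty {a : Fin d → ℝ} (ha : a ∈ U) : (lengthSet U g a a).Nonempty :=
  ⟨_, mem_lengthSet_iff.2 ⟨fun _ => a, fun _ => 0, ⟨fun _ _ => ha,
    fun t _ => hasDerivWithinAt_const _ _ _, continuousOn_const⟩, rfl, rfl, rfl⟩⟩

theorem IsGeodesicLift.isPath {T α β : ℝ} {z}
    (h : IsGeodesicLift U g T z) (hα : 0 ≤ α) (hβ : β ≤ T) :
    IsPath U (fun t => (z t).1) (fun t => (z t).2) α β := by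
  have hs : Icc α β ⊆ Icc 0 T := Icc_subset_Icc hα hβ
  refine ⟨fun t ht => (h t (hs ht)).1, fun t ht => ?_, ?_⟩
  · exact (hasFDerivAt_fst (𝕜 := ℝ) (p := z t)).comp_hasDerivWithinAt t ((h t (hs ht)).2.mono hs)
  · exact continuous_snd.comp_continuousOn (h.continuousOn.mono hs)

theorem IsGeodesicLift.pathLength_eq (hg : IsRiemannianMetricOn U g) {T α β : ℝ} {z}
    (h : IsGeodesicLift U g T z) (hu : IsUnitAt g (z 0).1 (z 0).2) (hα : 0 ≤ α) (hαβ : α ≤ β)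
    (hβ : β ≤ T) : pathLength g (fun t => (z t).1) (fun t => (z t).2) α β = β - α := by
  rw [pathLength, intervalIntegral.integral_congr (g := fun _ => (1 : ℝ))]
  · simp
  · intro t ht
    rw [uIcc_of_le hαβ] at ht
    simp only
    rw [h.speed_eq hg ⟨hα.trans ht.1, ht.2.trans hβ⟩, hu, Real.sqrt_one]

theorem IsGeodesicallyJoined.lengthSet_nonempty {a : Fin d → ℝ}
    (h : IsGeodesicallyJoined U g a) {x : Fin d → ℝ} (hx : x ∈ U) :
    (lengthSet U g a x).Nonempty := by
  obtain ⟨e, L, γ, hL, -, hγ, hγL, -⟩ := h x hx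
  obtain ⟨z, hz, h0, hzγ⟩ := isGeodesicFrom_iff.1 hγ
  have hp := (hz.rescale (T' := 1) (s := L) hL (by simp)).isPath le_rfl le_rfl
  exact ⟨_, mem_lengthSet_iff.2 ⟨_, _, hp, by simp [h0], by simp [hzγ, hγL], rfl⟩⟩

/-- A unit speed geodesic from `a` stays within distance `t` at time `t`. -/
theorem IsGeodesicLift.riemannianDist_le (hg : IsRiemannianMetricOn U g) {T t : ℝ} {z}
    (h : IsGeodesicLift U g T z) (hu : IsUnitAt g (z 0).1 (z 0).2) (ht : t ∈ Icc 0 T) :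
    riemannianDist U g (z 0).1 (z t).1 ≤ t := by
  have hU := (h 0 ⟨le_rfl, ht.1.trans ht.2⟩).1
  have := (h.isPath le_rfl ht.2).riemannianDist_le_add hg ht.1 (lengthSet_self_nonempty hU)
  rwa [riemannianDist_self hU, zero_add, h.pathLength_eq hg hu le_rfl ht.1 ht.2, sub_zero] at this

/-- A shortcut to z(t) would shorten the way to z(T): T ≤ d(z(t)) + (T - t). -/
theorem IsGeodesicLift.riemannianDist_eq (hg : IsRiemannianMetricOn U g) {T t : ℝ} {z}
    (h : IsGeodesicLift U g T z) (hu : IsUnitAt g (z 0).1 (z 0).2) (ht : t ∈ Icc 0 T)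
    (hj : IsGeodesicallyJoined U g (z 0).1)
    (hm : riemannianDist U g (z 0).1 (z T).1 = T) :
    riemannianDist U g (z 0).1 (z t).1 = t := by
  refine le_antisymm (h.riemannianDist_le hg hu ht) ?_
  have := (h.isPath ht.1 le_rfl).riemannianDist_le_add hg (a := (z 0).1) ht.2
    (hj.lengthSet_nonempty (h t ht).1)
  rw [hm, h.pathLength_eq hg hu ht.1 ht.2 le_rfl] at this
  linarith

theorem IsRiemannianMetricOn.exists_sqrt_metricInner_le (hg : IsRiemannianMetricOn U g)
    {x : Fin d → ℝ} (hx : x ∈ U) :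
    ∃ C, 0 ≤ C ∧ ∃ r > 0, ball x r ⊆ U ∧
      ∀ y ∈ ball x r, ∀ w, √(metricInner g y w w) ≤ C * ‖w‖ := by
  set S := ∑ i, ∑ j, (|g x i j| + 1) with hS
  have hS0 : 0 ≤ S := by positivity
  have hev : ∀ᶠ y in 𝓝 x, y ∈ U ∧ ∀ i j, |g y i j| < |g x i j| + 1 := by
    refine (hg.isOpen.eventually_mem hx).and ?_
    refine eventually_all.2 fun i => eventually_all.2 fun j => ?_
    have hc : ContinuousAt (fun y => |g y i j|) x :=
      continuous_abs.continuousAt.comp (hg.differentiableAt hx i j).continuousAt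
    exact hc.eventually_lt continuousAt_const (by linarith)
  obtain ⟨r, hr, hball⟩ := Metric.eventually_nhds_iff_ball.1 hev
  refine ⟨√S, Real.sqrt_nonneg _, r, hr, fun y hy => (hball y hy).1, fun y hy w => ?_⟩
  rw [← Real.sqrt_sq (norm_nonneg w), ← Real.sqrt_mul hS0]
  refine Real.sqrt_le_sqrt ?_
  rw [metricInner, hS, Finset.sum_mul]
  refine Finset.sum_le_sum fun i _ => ?_
  rw [Finset.sum_mul]
  refine Finset.sum_le_sum fun j _ => ?_
  calc g y i j * w i * w j ≤ |g y i j * w i * w j| := le_abs_self _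
    _ = |g y i j| * (|w i| * |w j|) := by rw [abs_mul, abs_mul, mul_assoc]
    _ ≤ (|g x i j| + 1) * (‖w‖ * ‖w‖) := by
        gcongr
        · exact ((hball y hy).2 i j).le
        · exact norm_le_pi_norm w i
        · exact norm_le_pi_norm w j
    _ = _ := by rw [pow_two]

/-- The distance is locally Lipschitz: nearby points are joined by straight segments, whose
Riemannian length is at most a local constant times their coordinate length. -/
theorem IsRiemannianMetricOn.continuousOn_riemannianDist (hg : IsRiemannianMetricOn U g)
    {a : Fin d → ℝ} (hj : IsGeodesicallyJoined U g a) :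
    ContinuousOn (riemannianDist U g a) U := by
  intro x hx
  refine ContinuousAt.continuousWithinAt ?_
  obtain ⟨C, hC, r, hr, hrU, hb⟩ := hg.exists_sqrt_metricInner_le hx
  have key : ∀ y₁ ∈ ball x r, ∀ y₂ ∈ ball x r,
      riemannianDist U g a y₂ ≤ riemannianDist U g a y₁ + C * ‖y₂ - y₁‖ := by
    intro y₁ h₁ y₂ h₂
    have hmem : ∀ t ∈ Icc (0 : ℝ) 1, y₁ + t • (y₂ - y₁) ∈ ball x r := fun t ht =>
      (convex_ball x r).add_smul_sub_mem h₁ h₂ ht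
    have hp : IsPath U (fun t : ℝ => y₁ + t • (y₂ - y₁)) (fun _ => y₂ - y₁) 0 1 :=
      ⟨fun t ht => hrU (hmem t ht), fun t _ => by
        simpa using (((hasDerivAt_id t).smul_const (y₂ - y₁)).const_add y₁).hasDerivWithinAt,
        continuousOn_const⟩
    have := hp.riemannianDist_le_add hg (a := a) zero_le_one
      (hj.lengthSet_nonempty (by simpa using hrU h₁))
    simp only [one_smul, zero_smul, add_zero, add_sub_cancel] at this
    refine this.trans (by
      gcongr
      have hI := intervalIntegral.integral_mono_on (μ := volume) zero_le_one
        ((hg.continuousOn_speed hp).intervalIntegrable_of_Icc zero_le_one)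
        (intervalIntegrable_const (c := C * ‖y₂ - y₁‖)) (fun t ht => hb _ (hmem t ht) _)
      simpa [pathLength] using hI)
  rw [ContinuousAt, tendsto_iff_dist_tendsto_zero]
  refine squeeze_zero' (Eventually.of_forall fun _ => dist_nonneg) (g := fun y => C * ‖y - x‖) ?_ ?_
  · filter_upwards [ball_mem_nhds x hr] with y hy
    rw [Real.dist_eq, abs_le]
    have h1 := key y hy x (mem_ball_self hr)
    have h2 := key x (mem_ball_self hr) y hy
    rw [norm_sub_rev] at h1
    constructor <;> linarith
  · have : Continuous fun y => C * ‖y - x‖ := by fun_prop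
    simpa using this.tendsto x

end FluctuationGeometry
end

noncomputable section

namespace FluctuationGeometry

open Metric Filter Topology

variable {d : ℕ} {U : Set (Fin d → ℝ)} {g : (Fin d → ℝ) → Matrix (Fin d) (Fin d) ℝ}

/-! ### The distance function along a minimizing geodesic -/

/-- Taylor remainders come with the sup norm, which is not smooth; the support function is stated
with η ⬝ᵥ η because it will be differentiated. -/
theorem norm_sq_le_dotProduct_self (η : Fin d → ℝ) : ‖η‖ ^ 2 ≤ η ⬝ᵥ η := by
  have h0 : 0 ≤ η ⬝ᵥ η := Finset.sum_nonneg fun i _ => mul_self_nonneg _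
  rw [← Real.sqrt_le_sqrt_iff h0, Real.sqrt_sq (norm_nonneg _), pi_norm_le_iff_of_nonneg
    (Real.sqrt_nonneg _)]
  intro i
  rw [Real.norm_eq_abs, ← Real.sqrt_sq_eq_abs, pow_two]
  exact Real.sqrt_le_sqrt (Finset.single_le_sum (f := fun i => η i * η i)
    (fun i _ => mul_self_nonneg _) (Finset.mem_univ i))

theorem two_mul_kinetic (x v : Fin d → ℝ) : metricInner g x v v = 2 * kinetic g (x, v) := by
  simp [kinetic]

/-- The distance function has a smooth lower support function along a minimizing geodesic,
uniformly before its end. -/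
theorem IsGeodesicLift.exists_metricInner_le (hg : IsRiemannianMetricOn U g) {L ℓ : ℝ} {z}
    (h : IsGeodesicLift U g L z) (hu : IsUnitAt g (z 0).1 (z 0).2) (hℓ : ℓ < L)
    (hj : IsGeodesicallyJoined U g (z 0).1)
    (hm : riemannianDist U g (z 0).1 (z L).1 = L) :
    ∃ C, ∃ δ > 0, ∀ t ∈ Icc 0 ℓ, ∀ η : Fin d → ℝ, ‖η‖ ≤ δ → (z t).1 + η ∈ U ∧
      metricInner g (z t).1 (z t).2 η ≤
        riemannianDist U g (z 0).1 ((z t).1 + η) - t + C * (η ⬝ᵥ η) := by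
  -- The cutoff of the kinetic energy has a global second-order Taylor bound, which makes C uniform
  -- along the geodesic.
  obtain ⟨k, O, hk, hkc, hO, hzO, hOU, hkO⟩ := exists_contDiff_hasCompactSupport_eqOn
    (hg.isOpen.prod isOpen_univ) hg.contDiffOn_kinetic h.isCompact_image h.image_subset
  obtain ⟨C, hC0, hC⟩ := exists_taylor_bound_of_hasCompactSupport hk hkc
  obtain ⟨δ, hδ, hδO⟩ := h.isCompact_image.exists_cthickening_subset_open hO hzO
  -- The perturbation has size at most ‖η‖ and velocity at most ‖η‖/(L - ℓ) for every t ≤ ℓ. This is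
  -- where uniformity in t uses ℓ < L.
  set κ := max 1 (1 / (L - ℓ)) with hκ
  have hκ1 : 1 ≤ κ := le_max_left _ _
  refine ⟨C * κ ^ 2 * L, δ / κ, by positivity, fun t ht η hη => ?_⟩
  have htL : t < L := ht.2.trans_lt hℓ
  have hLt : 0 < L - t := sub_pos.2 htL
  have hL0 : 0 < L := ht.1.trans_lt htL
  have hsub : Icc t L ⊆ Icc 0 L := Icc_subset_Icc_left ht.1
  have hη' : κ * ‖η‖ ≤ δ := by
    rw [le_div_iff₀ (by positivity)] at hη
    linarith
  -- Equal to η at t and to 0 at L, so z + ξ leads from z(t) + η to the end of the minimizing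
  -- geodesic.
  let ξ : ℝ → Fin d → ℝ := fun r => ((L - r) / (L - t)) • η
  let ξ' : Fin d → ℝ := (-1 / (L - t)) • η
  have hξd : ∀ r, HasDerivAt ξ ξ' r := fun r =>
    ((((hasDerivAt_id r).const_sub L).div_const (L - t)).smul_const η)
  have hΞ : ∀ r ∈ Icc t L, ‖(ξ r, ξ')‖ ≤ κ * ‖η‖ := by
    intro r hr
    rw [Prod.norm_def]
    refine max_le ?_ ?_
    · simp only [ξ, norm_smul, Real.norm_eq_abs]
      refine mul_le_mul_of_nonneg_right (le_trans ?_ hκ1) (norm_nonneg _)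
      rw [abs_of_nonneg (div_nonneg (by linarith [hr.2]) hLt.le), div_le_one hLt]
      linarith [hr.1]
    · simp only [ξ', norm_smul, Real.norm_eq_abs]
      refine mul_le_mul_of_nonneg_right (le_trans ?_ (le_max_right _ _)) (norm_nonneg _)
      rw [abs_div, abs_neg, abs_one, abs_of_pos hLt]
      exact one_div_le_one_div_of_le (by linarith) (by linarith [ht.2])
  have hmem : ∀ r ∈ Icc t L, z r + (ξ r, ξ') ∈ O := fun r hr =>
    hδO (mem_cthickening_of_dist_le _ (z r) _ _ ⟨r, hsub hr, rfl⟩ (by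
      rw [dist_eq_norm, add_sub_cancel_left]; exact (hΞ r hr).trans hη'))
  let c : ℝ → Fin d → ℝ := fun r => (z r).1 + ξ r
  let c' : ℝ → Fin d → ℝ := fun r => (z r).2 + ξ'
  have hcp : IsPath U c c' t L := by
    have hp := h.isPath (α := t) (β := L) ht.1 le_rfl
    exact ⟨fun r hr => (hOU (hmem r hr)).1, fun r hr =>
      (hp.hasDerivWithinAt r hr).add (hξd r).hasDerivWithinAt,
      hp.continuousOn_deriv.add continuousOn_const⟩
  have hct : c t = (z t).1 + η := by simp [c, ξ, hLt.ne']
  have hcL : c L = (z L).1 := by simp [c, ξ]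
  have hUt : (z t).1 + η ∈ U := hct ▸ hcp.mem t ⟨le_rfl, htL.le⟩
  refine ⟨hUt, ?_⟩
  have hd := hcp.riemannianDist_le_add hg (a := (z 0).1) htL.le
    (hj.lengthSet_nonempty (hct ▸ hUt))
  rw [hcL, hct, hm] at hd
  set F : ℝ → ℝ := fun r => fderiv ℝ k (z r) (ξ r, ξ') with hF
  have hzc : ContinuousOn z (Icc t L) := h.continuousOn.mono hsub
  have hξc : Continuous ξ := continuous_iff_continuousAt.2 fun r => (hξd r).continuousAt
  have hFc : ContinuousOn F (Icc t L) :=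
    ((hk.continuous_fderiv (by simp)).comp_continuousOn hzc).clm_apply
      (hξc.prodMk continuous_const).continuousOn
  -- Length is compared with energy by √s ≤ (s + 1)/2, which loses nothing to first order at s = 1,
  -- the squared speed of z.
  have hpt : ∀ r ∈ Icc t L, √(metricInner g (c r) (c' r) (c' r)) ≤
      1 + F r + C * κ ^ 2 * ‖η‖ ^ 2 := by
    intro r hr
    have h1 : metricInner g (c r) (c' r) (c' r) = 2 * k (z r + (ξ r, ξ')) := by
      rw [hkO (hmem r hr), two_mul_kinetic]; rfl
    have h2 : k (z r) = 1 / 2 := by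
      rw [hkO (hzO ⟨r, hsub hr, rfl⟩), kinetic, h.speed_eq hg (hsub hr), hu, mul_one]
    have h3 := hC (z r) (ξ r, ξ')
    rw [h2] at h3
    have h4 := (Real.le_norm_self _).trans h3
    have h5 : ‖(ξ r, ξ')‖ ^ 2 ≤ κ ^ 2 * ‖η‖ ^ 2 := by
      rw [← mul_pow]; exact pow_le_pow_left₀ (norm_nonneg _) (hΞ r hr) 2
    have h6 := mul_le_mul_of_nonneg_left h5 hC0
    have h7 : √(metricInner g (c r) (c' r) (c' r)) ≤
        (metricInner g (c r) (c' r) (c' r) + 1) / 2 := by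
      have h0 := hg.metricInner_self_nonneg (hcp.mem r hr) (c' r)
      nlinarith [Real.sq_sqrt h0, sq_nonneg (√(metricInner g (c r) (c' r) (c' r)) - 1)]
    rw [h1] at h7 ⊢
    simp only [hF]
    linarith
  have hint : IntervalIntegrable F volume t L := hFc.intervalIntegrable_of_Icc htL.le
  have hlen : pathLength g c c' t L ≤ ∫ r in t..L, (1 + F r + C * κ ^ 2 * ‖η‖ ^ 2) :=
    intervalIntegral.integral_mono_on htL.le
      ((hg.continuousOn_speed hcp).intervalIntegrable_of_Icc htL.le)
      ((intervalIntegrable_const.add hint).add intervalIntegrable_const) hpt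
  -- By Euler-Lagrange the first variation is the derivative of ⟨z', ξ⟩, so only the boundary term
  -- at t remains.
  have hFTC : ∫ r in t..L, F r = -metricInner g (z t).1 (z t).2 η := by
    rw [intervalIntegral.integral_eq_sub_of_hasDerivAt_of_le htL.le
      (f := fun r => metricInner g (z r).1 (z r).2 (ξ r)) _ _ hint]
    · simp [ξ, hLt.ne', metricInner_zero_right]
    · exact hg.continuousOn_metricInner (fun r hr => (h r (hsub hr)).1)
        (continuous_fst.comp_continuousOn hzc) (continuous_snd.comp_continuousOn hzc)
        hξc.continuousOn
    · intro r hr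
      have hr' := hsub (Ioo_subset_Icc_self hr)
      have hrL : Icc 0 L ∈ 𝓝 r := Icc_mem_nhds (ht.1.trans_lt hr.1) hr.2
      have := hg.hasDerivAt_momentum (h r hr').1 ((h r hr').2.hasDerivAt hrL) (hξd r)
      refine this.congr_deriv ?_
      have hek : k =ᶠ[𝓝 (z r)] kinetic g :=
        Filter.eventuallyEq_of_mem (hO.mem_nhds (hzO ⟨r, hr', rfl⟩)) hkO
      rw [hF]; simp only [hek.fderiv_eq]
  rw [intervalIntegral.integral_add (intervalIntegrable_const.add hint) intervalIntegrable_const,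
    intervalIntegral.integral_add intervalIntegrable_const hint, hFTC] at hlen
  simp only [intervalIntegral.integral_const, smul_eq_mul, mul_one] at hlen
  have hlast : (L - t) * (C * κ ^ 2 * ‖η‖ ^ 2) ≤ C * κ ^ 2 * L * (η ⬝ᵥ η) := by
    have h1 := norm_sq_le_dotProduct_self η
    have h2 : (L - t) * (C * κ ^ 2 * ‖η‖ ^ 2) ≤ L * (C * κ ^ 2 * ‖η‖ ^ 2) :=
      mul_le_mul_of_nonneg_right (by linarith [ht.1]) (by positivity)
    have h3 := mul_le_mul_of_nonneg_left h1 (show 0 ≤ C * κ ^ 2 * L by positivity)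
    linarith
  linarith

theorem HasDerivWithinAt.nonneg_of_eventually_le {ψ : ℝ → ℝ} {ψ' ℓ : ℝ}
    (h : HasDerivWithinAt ψ ψ' (Iic ℓ) ℓ) (hle : ∀ᶠ t in 𝓝[<] ℓ, ψ t ≤ ψ ℓ) : 0 ≤ ψ' := by
  have h1 := hasDerivWithinAt_iff_tendsto_slope.1 h
  rw [Iic_sdiff_right] at h1
  refine ge_of_tendsto h1 ?_
  filter_upwards [hle, self_mem_nhdsWithin] with t ht htℓ
  rw [slope_def_field]
  exact div_nonneg_of_nonpos (by linarith) (by linarith [mem_Iio.1 htℓ])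

/-- A geodesic that reaches a point before the end of a minimizing geodesic, at the same
parameter, arrives with the same velocity. -/
theorem IsGeodesicLift.eq_of_fst_eq (hg : IsRiemannianMetricOn U g) {L ℓ : ℝ} {z z₂}
    (h : IsGeodesicLift U g L z) (hu : IsUnitAt g (z 0).1 (z 0).2) (hℓ0 : 0 < ℓ) (hℓ : ℓ < L)
    (hj : IsGeodesicallyJoined U g (z 0).1)
    (hm : riemannianDist U g (z 0).1 (z L).1 = L) (h₂ : IsGeodesicLift U g ℓ z₂)
    (hu₂ : IsUnitAt g (z₂ 0).1 (z₂ 0).2) (h0 : (z₂ 0).1 = (z 0).1) (he : (z₂ ℓ).1 = (z ℓ).1) :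
    z₂ ℓ = z ℓ := by
  obtain ⟨C, δ, hδ, hC⟩ := h.exists_metricInner_le hg hu hℓ hj hm
  have hℓm : ℓ ∈ Icc 0 ℓ := ⟨hℓ0.le, le_rfl⟩
  have hU : (z ℓ).1 ∈ U := (h ℓ ⟨hℓ0.le, hℓ.le⟩).1
  set x := (z ℓ).1
  set v := (z ℓ).2
  set v₂ := (z₂ ℓ).2
  have hd : HasDerivWithinAt (fun t => (z₂ t).1 - x) v₂ (Iic ℓ) ℓ := by
    refine HasDerivWithinAt.sub_const _ ?_
    exact ((hasFDerivAt_fst (𝕜 := ℝ) (p := z₂ ℓ)).comp_hasDerivWithinAt ℓ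
      (h₂ ℓ hℓm).2).mono_of_mem_nhdsWithin (Icc_mem_nhdsLE hℓ0)
  -- The support inequality at z(ℓ) with η = z₂(t) - x, combined with d(z₂(t)) ≤ t, says that this
  -- function is at most its value -ℓ at t = ℓ. Its left derivative there is ⟨v, v₂⟩ - 1.
  have hψ : HasDerivWithinAt (fun t => ∑ i, ∑ j, g x i j * v i * ((z₂ t).1 j - x j) - t
      - C * ∑ i, ((z₂ t).1 i - x i) * ((z₂ t).1 i - x i))
      (∑ i, ∑ j, g x i j * v i * v₂ j - 1 - C * 0) (Iic ℓ) ℓ := by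
    have hdi : ∀ i, HasDerivWithinAt (fun t => (z₂ t).1 i - x i) (v₂ i) (Iic ℓ) ℓ :=
      hasDerivWithinAt_pi.1 hd
    refine ((HasDerivWithinAt.fun_sum fun i _ => HasDerivWithinAt.fun_sum fun j _ =>
      (hdi j).const_mul _).sub (hasDerivWithinAt_id _ _)).sub (HasDerivWithinAt.const_mul _ ?_)
    refine (HasDerivWithinAt.fun_sum fun i _ => (hdi i).mul (hdi i)).congr_deriv ?_
    simp [he]
  have hψ' := HasDerivWithinAt.nonneg_of_eventually_le hψ (by
    have hcont : ∀ᶠ t in 𝓝[<] ℓ, ‖(z₂ t).1 - x‖ ≤ δ := by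
      have : Tendsto (fun t => ‖(z₂ t).1 - x‖) (𝓝[<] ℓ) (𝓝 ‖(z₂ ℓ).1 - x‖) :=
        (hd.continuousWithinAt.mono Iio_subset_Iic_self).norm
      rw [he, sub_self, norm_zero] at this
      exact (this.eventually (gt_mem_nhds hδ)).mono fun t ht => ht.le
    filter_upwards [hcont, Ioo_mem_nhdsLT hℓ0] with t ht ht0
    have h1 := (hC ℓ hℓm _ ht).2
    have h2 := h₂.riemannianDist_le hg hu₂ ⟨ht0.1.le, ht0.2.le⟩
    rw [h0] at h2
    simp only [add_sub_cancel, x] at h1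
    simp only [metricInner, dotProduct, Pi.sub_apply] at h1
    simp only [he, sub_self, mul_zero, Finset.sum_const_zero, x, v]
    linarith)
  have hv : metricInner g x v v = 1 := by rw [← hu]; exact h.speed_eq hg ⟨hℓ0.le, hℓ.le⟩
  have hv₂ : metricInner g x v₂ v₂ = 1 := by rw [← hu₂, ← h₂.speed_eq hg hℓm, he]
  have hvv : 1 ≤ metricInner g x v v₂ := by
    rw [metricInner]; linarith
  -- Equality case of Cauchy-Schwarz: |v₂ - v|² = 2 - 2⟨v, v₂⟩ ≤ 0.
  have := hg.eq_zero_of_metricInner_self_le_zero hU (v := v₂ - v) (by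
    rw [metricInner_sub_left, metricInner_sub_right, metricInner_sub_right, hv, hv₂,
      hg.metricInner_comm hU v₂ v]
    linarith)
  exact Prod.ext he (sub_eq_zero.1 this)

end FluctuationGeometry
end

noncomputable section

namespace FluctuationGeometry

open Metric Filter Topology

variable {d : ℕ} {U : Set (Fin d → ℝ)} {g : (Fin d → ℝ) → Matrix (Fin d) (Fin d) ℝ}

/-! ### The Gauss lemma -/

namespace IsLocalGeodesicFlow

variable {O : Set ((Fin d → ℝ) × (Fin d → ℝ))}
  {f : (Fin d → ℝ) × (Fin d → ℝ) → (Fin d → ℝ) × (Fin d → ℝ)}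
  {φ : ℝ → (Fin d → ℝ) × (Fin d → ℝ) → (Fin d → ℝ) × (Fin d → ℝ)}
  (h : IsLocalGeodesicFlow U g O f φ)

include h

theorem contDiff_time (t : ℝ) : ContDiff ℝ ∞ (φ t) :=
  h.contDiff_flow.comp (contDiff_const.prodMk contDiff_id)

theorem hasFDerivAt (t : ℝ) (w : (Fin d → ℝ) × (Fin d → ℝ)) :
    HasFDerivAt (φ t) (fderiv ℝ (φ t) w) w :=
  ((h.contDiff_time t).differentiable (by simp) w).hasFDerivAt

theorem fderiv_zero (w : (Fin d → ℝ) × (Fin d → ℝ)) :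
    fderiv ℝ (φ 0) w = ContinuousLinearMap.id ℝ _ := by
  rw [show φ 0 = id from funext h.isFlow.zero, fderiv_id]

theorem hasDerivAt_jacobi (t : ℝ) (w ν : (Fin d → ℝ) × (Fin d → ℝ)) :
    HasDerivAt (fun t => fderiv ℝ (φ t) w ν) (fderiv ℝ f (φ t w) (fderiv ℝ (φ t) w ν)) t :=
  h.isFlow.hasDerivAt_fderiv h.contDiff h.hasCompactSupport t w ν

theorem hasDerivAt_jacobi_fst {t : ℝ} {w : (Fin d → ℝ) × (Fin d → ℝ)} (hw : φ t w ∈ O)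
    (ν : (Fin d → ℝ) × (Fin d → ℝ)) :
    HasDerivAt (fun t => (fderiv ℝ (φ t) w ν).1) (fderiv ℝ (φ t) w ν).2 t := by
  refine ((hasFDerivAt_fst (𝕜 := ℝ) (p := fderiv ℝ (φ t) w ν)).comp_hasDerivAt t
    (h.hasDerivAt_jacobi t w ν)).congr_deriv ?_
  have h1 : HasFDerivAt (fun z => (f z).1)
      ((ContinuousLinearMap.fst ℝ _ _).comp (fderiv ℝ f (φ t w))) (φ t w) :=
    (hasFDerivAt_fst (𝕜 := ℝ)).comp _ (h.contDiff.differentiable (by simp) _).hasFDerivAt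
  have h2 : HasFDerivAt (fun z => (f z).1) (ContinuousLinearMap.snd ℝ _ _) (φ t w) := by
    refine (hasFDerivAt_snd (𝕜 := ℝ) (p := φ t w)).congr_of_eventuallyEq ?_
    filter_upwards [h.isOpen.mem_nhds hw] with z hz
    rw [h.eqOn hz]; rfl
  exact congrArg (fun A => A (fderiv ℝ (φ t) w ν)) (h1.unique h2)

theorem injective_fderiv (t : ℝ) (w : (Fin d → ℝ) × (Fin d → ℝ)) :
    Function.Injective (fderiv ℝ (φ t) w) := by
  have h1 := (h.hasFDerivAt (-t) (φ t w)).comp w (h.hasFDerivAt t w)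
  rw [show φ (-t) ∘ φ t = id from funext (h.flow_neg_flow t)] at h1
  refine Function.LeftInverse.injective (g := fderiv ℝ (φ (-t)) (φ t w)) fun ν => ?_
  exact congrArg (fun A => A ν) (h1.unique (hasFDerivAt_id w))

/-- With J the variation field, the Euler-Lagrange identity makes d/ds⟨γ', J⟩ the variation of the
kinetic energy at time s. Energy is conserved, so this is the variation ⟨w.2, ε⟩ at time 0. Thus
⟨γ', J⟩ is linear in s and vanishes at 0 with J. -/
theorem gauss (hg : IsRiemannianMetricOn U g) {T t : ℝ} (ht : t ∈ Icc 0 T)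
    {w : (Fin d → ℝ) × (Fin d → ℝ)} (hw : ∀ᶠ w' in 𝓝 w, ∀ s ∈ Icc 0 T, φ s w' ∈ O)
    (ε : Fin d → ℝ) :
    metricInner g (φ t w).1 (φ t w).2 (fderiv ℝ (φ t) w (0, ε)).1 =
      t * metricInner g w.1 w.2 ε := by
  have hU : w.1 ∈ U := by
    have := hw.self_of_nhds 0 ⟨le_rfl, ht.1.trans ht.2⟩
    rw [h.isFlow.zero] at this
    exact h.mem this
  have hkin : ∀ z : (Fin d → ℝ) × (Fin d → ℝ), z.1 ∈ U → HasFDerivAt (kinetic g)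
      (fderiv ℝ (kinetic g) z) z := fun z hz =>
    ((hg.contDiffOn_kinetic.contDiffAt ((hg.isOpen.prod isOpen_univ).mem_nhds
      ⟨hz, mem_univ _⟩)).differentiableAt (by simp)).hasFDerivAt
  have hd : ∀ s ∈ Icc 0 T, HasDerivAt (fun s => metricInner g (φ s w).1 (φ s w).2
      (fderiv ℝ (φ s) w (0, ε)).1 - s * metricInner g w.1 w.2 ε) 0 s := by
    intro s hs
    have hO := hw.self_of_nhds s hs
    have h1 := (hg.hasDerivAt_momentum (c := fun s => φ s w) (h.mem hO) (h.hasDerivAt hO)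
      (h.hasDerivAt_jacobi_fst hO (0, ε))).sub
        ((hasDerivAt_id s).mul_const (metricInner g w.1 w.2 ε))
    refine h1.congr_deriv ?_
    have h2 : kinetic g ∘ φ s =ᶠ[𝓝 w] kinetic g := by
      filter_upwards [hw] with w' hw'
      have := (h.isGeodesicLift hw').speed_eq hg hs
      simp only [Function.comp, kinetic, this, h.isFlow.zero]
    have h3 := ((hkin _ (h.mem hO)).comp w (h.hasFDerivAt s w)).congr_of_eventuallyEq h2.symm
    have h4 := congrArg (fun A => A ((0, ε) : (Fin d → ℝ) × (Fin d → ℝ)))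
      (h3.unique (hkin w hU))
    have h5 := hg.fderiv_kinetic hU w.2 0 ε
    simp only [map_zero, zero_mul, Finset.sum_const_zero, mul_zero, zero_add, Prod.mk.eta] at h5
    simp only [ContinuousLinearMap.comp_apply] at h4
    rw [one_mul, sub_eq_zero, ← h5]
    exact h4
  have := constant_of_has_deriv_right_zero (fun s hs => (hd s hs).continuousAt.continuousWithinAt)
    (fun s hs => (hd s (Ico_subset_Icc_self hs)).hasDerivWithinAt) t ht
  simp only [h.fderiv_zero, ContinuousLinearMap.coe_id', id, metricInner_zero_right, zero_mul,
    sub_zero] at this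
  linarith

end IsLocalGeodesicFlow

/-! ### No conjugate points in the interior of a minimizing geodesic -/

/-- If h₂ were positive, x would also be a local minimum; then h would be constant near x and h₂ =
0. -/
theorem IsLocalMax.second_deriv_nonpos {h h₁ : ℝ → ℝ} {h₂ x : ℝ} (hm : IsLocalMax h x)
    (hd : ∀ᶠ y in 𝓝 x, HasDerivAt h (h₁ y) y) (hd₁ : HasDerivAt h₁ h₂ x) : h₂ ≤ 0 := by
  by_contra! hpos
  have e1 : deriv h =ᶠ[𝓝 x] h₁ := hd.mono fun y hy => hy.deriv
  have e2 : deriv (deriv h) x = h₂ := by rw [e1.deriv_eq, hd₁.deriv]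
  have hmin := isLocalMin_of_deriv_deriv_pos (f := h) (x₀ := x) (by rw [e2]; exact hpos)
    hm.deriv_eq_zero hd.self_of_nhds.continuousAt
  have hc : h =ᶠ[𝓝 x] fun _ => h x := by
    filter_upwards [hm, hmin] with y h1 h2 using le_antisymm h1 h2
  have e3 : deriv h =ᶠ[𝓝 x] fun _ => 0 := by
    filter_upwards [hc.deriv] with y hy
    rw [hy, deriv_const]
  rw [e3.deriv_eq, deriv_const] at e2
  exact hpos.ne e2

theorem HasDerivAt.dotProduct {u v : ℝ → Fin d → ℝ} {u' v' : Fin d → ℝ} {t : ℝ}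
    (hu : HasDerivAt u u' t) (hv : HasDerivAt v v' t) :
    HasDerivAt (fun t => u t ⬝ᵥ v t) (u' ⬝ᵥ v t + u t ⬝ᵥ v') t := by
  simp only [_root_.dotProduct]
  refine (HasDerivAt.fun_sum fun i _ =>
    (hasDerivAt_pi.1 hu i).mul (hasDerivAt_pi.1 hv i)).congr_deriv ?_
  simp only [Finset.sum_add_distrib]

/-- At a zero of v the product rule needs only continuity of u, so variation fields never have to be
differentiated in the variation parameter. -/
theorem HasDerivAt.dotProduct_of_eq_zero {u v : ℝ → Fin d → ℝ} {v' : Fin d → ℝ} {t : ℝ}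
    (hu : ContinuousAt u t) (hv : HasDerivAt v v' t) (h0 : v t = 0) :
    HasDerivAt (fun t => u t ⬝ᵥ v t) (u t ⬝ᵥ v') t := by
  rw [hasDerivAt_iff_tendsto_slope] at hv ⊢
  have h1 : slope (fun t => u t ⬝ᵥ v t) t = fun s => u s ⬝ᵥ slope v t s := by
    ext s
    simp [slope, h0, dotProduct_smul]
  rw [h1]
  simp only [_root_.dotProduct]
  refine tendsto_finsetSum _ fun i _ => ?_
  exact ((continuousAt_pi.1 hu i).mono_left nhdsWithin_le_nhds).mul (tendsto_pi_nhds.1 hv i)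

/-- The momentum `g_ij (x) v^j`. -/
def momentum (g : (Fin d → ℝ) → Matrix (Fin d) (Fin d) ℝ)
    (z : (Fin d → ℝ) × (Fin d → ℝ)) : Fin d → ℝ :=
  (g z.1).mulVec z.2

namespace IsRiemannianMetricOn

variable (hg : IsRiemannianMetricOn U g)

include hg

theorem momentum_dotProduct {z : (Fin d → ℝ) × (Fin d → ℝ)} (hz : z.1 ∈ U) (w : Fin d → ℝ) :
    momentum g z ⬝ᵥ w = metricInner g z.1 z.2 w := by
  rw [hg.metricInner_comm hz, metricInner_eq_dotProduct, momentum, dotProduct_comm]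

theorem contDiffAt_momentum {z : (Fin d → ℝ) × (Fin d → ℝ)} (hz : z.1 ∈ U) :
    ContDiffAt ℝ ∞ (momentum g) z := by
  unfold momentum Matrix.mulVec dotProduct
  refine contDiffAt_pi.2 fun i => ContDiffAt.sum fun j _ => ?_
  exact (((hg.contDiffOn i j).contDiffAt (hg.isOpen.mem_nhds hz)).comp z contDiffAt_fst).mul
    (contDiffAt_pi.1 contDiffAt_snd j)

theorem fderiv_momentum {z : (Fin d → ℝ) × (Fin d → ℝ)} (hz : z.1 ∈ U) (k : Fin d → ℝ) :
    fderiv ℝ (momentum g) z (0, k) = (g z.1).mulVec k := by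
  have hl : HasDerivAt (fun t : ℝ => (z.1, z.2 + t • k)) (0, k) 0 :=
    (hasDerivAt_const _ _).prodMk
      (by simpa using ((hasDerivAt_id (0 : ℝ)).smul_const k).const_add z.2)
  have h0 : (fun t : ℝ => (z.1, z.2 + t • k)) 0 = z := by simp
  have h1 := (h0 ▸ ((hg.contDiffAt_momentum hz).differentiableAt
    (by simp)).hasFDerivAt).comp_hasDerivAt (0 : ℝ) hl
  have h2 : HasDerivAt (momentum g ∘ fun t : ℝ => (z.1, z.2 + t • k)) ((g z.1).mulVec k) 0 := by
    have : momentum g ∘ (fun t : ℝ => (z.1, z.2 + t • k)) =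
        fun t : ℝ => (g z.1).mulVec z.2 + t • (g z.1).mulVec k := by
      ext t : 1
      simp [momentum, Matrix.mulVec_add, Matrix.mulVec_smul]
    rw [this]
    simpa using ((hasDerivAt_id (0 : ℝ)).smul_const ((g z.1).mulVec k)).const_add
      ((g z.1).mulVec z.2)
  have h3 := h1.unique h2
  rwa [h0] at h3

theorem metricInner_deriv_eq_zero {a : Fin d → ℝ} (ha : a ∈ U) {E : ℝ → Fin d → ℝ}
    {E' : Fin d → ℝ} {s : ℝ} (hE : HasDerivAt E E' s) (hu : ∀ᶠ s in 𝓝 s, IsUnitAt g a (E s)) :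
    metricInner g a (E s) E' = 0 := by
  have h1 := hg.hasDerivAt_metricInner (x := fun _ => a) ha (hasDerivAt_const s a) hE hE
  have h2 : HasDerivAt (fun s => metricInner g a (E s) (E s)) 0 s :=
    (hasDerivAt_const s (1 : ℝ)).congr_of_eventuallyEq hu
  have h3 := h1.unique h2
  simp only [map_zero, zero_mul, Finset.sum_const_zero, zero_add] at h3
  rw [hg.metricInner_comm ha E'] at h3
  linarith

end IsRiemannianMetricOn

/-- A variation of a minimizing geodesic through unit speed geodesics from the same point whose
variation field vanishes before the end is trivial. -/
theorem IsGeodesicLift.deriv_eq_zero_of_jacobi_eq_zero (hg : IsRiemannianMetricOn U g) {L ℓ : ℝ}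
    {z} (h : IsGeodesicLift U g L z) (hu : IsUnitAt g (z 0).1 (z 0).2) (hℓ0 : 0 < ℓ) (hℓ : ℓ < L)
    (hj : IsGeodesicallyJoined U g (z 0).1) (hm : riemannianDist U g (z 0).1 (z L).1 = L)
    {O f φ} (hf : IsLocalGeodesicFlow U g O f φ) (he : ∀ t ∈ Icc 0 L, z t = φ t (z 0))
    (hO : ∀ᶠ w in 𝓝 (z 0), ∀ t ∈ Icc 0 L, φ t w ∈ O)
    {E : ℝ → Fin d → ℝ} (hE : ContDiffAt ℝ ∞ E 0) (hE0 : E 0 = (z 0).2)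
    (hEu : ∀ᶠ s in 𝓝 0, IsUnitAt g (z 0).1 (E s))
    (hJ : (fderiv ℝ (φ ℓ) (z 0) (0, deriv E 0)).1 = 0) : deriv E 0 = 0 := by
  obtain ⟨C, δ, hδ, hC⟩ := h.exists_metricInner_le hg hu hℓ hj hm
  have haU : (z 0).1 ∈ U := (h 0 ⟨le_rfl, (hℓ0.trans hℓ).le⟩).1
  have hO0 := hO.self_of_nhds
  let w : ℝ → (Fin d → ℝ) × (Fin d → ℝ) := fun s => ((z 0).1, E s)
  have hw0 : w 0 = z 0 := by simp [w, hE0]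
  have hwc : ContinuousAt w 0 := continuousAt_const.prodMk hE.continuousAt
  have hEd : ∀ᶠ s in 𝓝 0, HasDerivAt E (deriv E s) s := by
    have := (hE.of_le (m := 1) (by exact WithTop.coe_le_coe.2 le_top)).eventually (by simp)
    filter_upwards [this] with s hs using (hs.differentiableAt one_ne_zero).hasDerivAt
  have hE' : ContinuousAt (deriv E) 0 := by
    have h1 : ContDiffAt ℝ ∞ (fderiv ℝ E) 0 := hE.fderiv_right (m := ∞) (by simp)
    exact (h1.continuousAt.clm_apply continuousAt_const)
  let J : ℝ → ℝ → Fin d → ℝ := fun t s => (fderiv ℝ (φ t) (w s) (0, deriv E s)).1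
  have hXd : ∀ t, ∀ᶠ s in 𝓝 0, HasDerivAt (fun s => φ t (w s))
      (fderiv ℝ (φ t) (w s) (0, deriv E s)) s := fun t => by
    filter_upwards [hEd] with s hs
    exact (hf.hasFDerivAt t (w s)).comp_hasDerivAt s ((hasDerivAt_const s (z 0).1).prodMk hs)
  have hJd : ∀ t, ∀ᶠ s in 𝓝 0, HasDerivAt (fun s => (φ t (w s)).1) (J t s) s := fun t => by
    filter_upwards [hXd t] with s hs
    exact (hasFDerivAt_fst (𝕜 := ℝ) (p := φ t (w s))).comp_hasDerivAt s hs
  have hJc : ∀ t, ContinuousAt (J t) 0 := fun t => by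
    refine continuous_fst.continuousAt.comp (ContinuousAt.clm_apply ?_
      (continuousAt_const.prodMk hE'))
    exact ((hf.contDiff_time t).continuous_fderiv (by simp)).continuousAt.comp hwc
  -- The derivative of the momentum covector with respect to the variation parameter, at parameter
  -- 0.
  let R : ℝ → Fin d → ℝ := fun t =>
    fderiv ℝ (momentum g) (φ t (z 0)) (fderiv ℝ (φ t) (z 0) (0, deriv E 0))
  have hwO : ∀ᶠ s in 𝓝 0, ∀ t ∈ Icc 0 L, φ t (w s) ∈ O :=
    hwc.eventually (by rw [hw0]; exact hO)
  have hwO' : ∀ᶠ s in 𝓝 0, ∀ᶠ w' in 𝓝 (w s), ∀ t ∈ Icc 0 L, φ t w' ∈ O :=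
    hwc.eventually (by rw [hw0]; exact eventually_eventually_nhds.2 hO)
  -- At fixed t the support function along s ↦ φ_t(w s) is at most d - t ≤ 0, with equality at s =
  -- 0. The left side is its second derivative at this maximum.
  have key : ∀ t ∈ Ioo 0 ℓ, -(R t ⬝ᵥ J t 0) - C * (2 * (J t 0 ⬝ᵥ J t 0)) ≤ 0 := by
    intro t ht
    have htL : t ∈ Icc 0 L := ⟨ht.1.le, (ht.2.trans hℓ).le⟩
    have htO : φ t (z 0) ∈ O := hO0 t htL
    let η : ℝ → Fin d → ℝ := fun s => (φ t (w s)).1 - (φ t (z 0)).1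
    have hη0 : η 0 = 0 := by simp [η, hw0]
    have hηd : ∀ᶠ s in 𝓝 0, HasDerivAt η (J t s) s := by
      filter_upwards [hJd t] with s hs using hs.sub_const _
    let P : ℝ → Fin d → ℝ := fun s => momentum g (φ t (w s))
    have hP0 : P 0 = momentum g (φ t (z 0)) := by simp [P, hw0]
    have hPd : HasDerivAt P (R t) 0 := by
      have h1 := (hXd t).self_of_nhds
      have h2 : HasFDerivAt (momentum g) (fderiv ℝ (momentum g) (φ t (w 0))) (φ t (w 0)) :=
        ((hg.contDiffAt_momentum (by rw [hw0]; exact hf.mem htO)).differentiableAt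
          (by simp)).hasFDerivAt
      have := h2.comp_hasDerivAt 0 h1
      rwa [hw0] at this
    have hgauss : ∀ᶠ s in 𝓝 0, P s ⬝ᵥ J t s = 0 := by
      filter_upwards [hwO', hEd, eventually_eventually_nhds.2 hEu] with s h1 h2 h3
      rw [hg.momentum_dotProduct (hf.mem (h1.self_of_nhds t htL)), hf.gauss hg htL h1,
        hg.metricInner_deriv_eq_zero haU h2 h3, mul_zero]
    -- The first derivative would contain P 0 ⬝ᵥ J t s; the Gauss lemma allows P 0 to be replaced by
    -- P 0 - P s, which vanishes at s = 0.
    refine IsLocalMax.second_deriv_nonpos (x := 0)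
      (h := fun s => P 0 ⬝ᵥ η s - C * (η s ⬝ᵥ η s))
      (h₁ := fun s => J t s ⬝ᵥ (P 0 - P s) - C * (2 * (J t s ⬝ᵥ η s))) ?_ ?_ ?_
    · have hηδ : ∀ᶠ s in 𝓝 0, ‖η s‖ ≤ δ := by
        have := hηd.self_of_nhds.continuousAt.norm
        rw [ContinuousAt, hη0, norm_zero] at this
        exact (this.eventually (gt_mem_nhds hδ)).mono fun s hs => hs.le
      filter_upwards [hηδ, hwO, hEu] with s h1 h2 h3
      have h4 := (hC t ⟨ht.1.le, ht.2.le⟩ (η s) h1).2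
      have hl := hf.isGeodesicLift h2
      have h5 := hl.riemannianDist_le hg (by simpa only [hf.isFlow.zero] using h3) htL
      simp only [hf.isFlow.zero] at h5
      rw [he t htL] at h4
      simp only [η, add_sub_cancel] at h4
      rw [hP0, hg.momentum_dotProduct (hf.mem htO), hg.momentum_dotProduct (hf.mem htO)]
      simp only [hη0, metricInner_zero_right, dotProduct_zero, mul_zero, sub_zero]
      simp only [w] at h5
      linarith
    · filter_upwards [hηd, hgauss] with s h1 h2
      have h3 := (HasDerivAt.dotProduct (hasDerivAt_const s (P 0)) h1).sub
        ((HasDerivAt.dotProduct h1 h1).const_mul C)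
      refine h3.congr_deriv ?_
      have h4 : J t s ⬝ᵥ (P 0 - P s) = P 0 ⬝ᵥ J t s := by
        rw [dotProduct_comm, sub_dotProduct, h2, sub_zero]
      rw [h4, dotProduct_comm (η s) (J t s), zero_dotProduct]
      ring
    · have h1 := HasDerivAt.dotProduct_of_eq_zero (hJc t) (hPd.const_sub (P 0)) (sub_self _)
      have h2 := HasDerivAt.dotProduct_of_eq_zero (hJc t) hηd.self_of_nhds hη0
      refine (h1.sub ((h2.const_mul 2).const_mul C)).congr_deriv ?_
      rw [dotProduct_neg, dotProduct_comm]
  have hℓL : ℓ ∈ Icc 0 L := ⟨hℓ0.le, hℓ.le⟩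
  have hℓO := hO0 ℓ hℓL
  set K := (fderiv ℝ (φ ℓ) (z 0) (0, deriv E 0)).2 with hK
  have hJ0 : J ℓ 0 = 0 := by simp only [J, hw0]; exact hJ
  have hJt : HasDerivAt (fun t => J t 0) K ℓ := by
    simp only [J, hw0]
    exact hf.hasDerivAt_jacobi_fst hℓO _
  have hRc : ContinuousAt R ℓ := by
    refine ContinuousAt.clm_apply ?_ (hf.hasDerivAt_jacobi ℓ (z 0) _).continuousAt
    have h1 : ContDiffAt ℝ ∞ (fderiv ℝ (momentum g)) (φ ℓ (z 0)) :=
      (hg.contDiffAt_momentum (hf.mem hℓO)).fderiv_right (m := ∞) (by simp)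
    exact h1.continuousAt.comp (f := fun t => φ t (z 0)) (hf.isFlow.continuous_time _).continuousAt
  -- Now t varies, with C the same for all t ≤ ℓ. The function is nonpositive before ℓ and zero at
  -- ℓ, and its quadratic term does not contribute to the derivative there, so -(R ℓ ⬝ᵥ K) ≥ 0.
  have hψ : HasDerivAt (fun t => -(R t ⬝ᵥ J t 0) - C * (2 * (J t 0 ⬝ᵥ J t 0)))
      (-(R ℓ ⬝ᵥ K)) ℓ := by
    have h1 := HasDerivAt.dotProduct_of_eq_zero hRc hJt hJ0
    have h2 := HasDerivAt.dotProduct_of_eq_zero hJt.continuousAt hJt hJ0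
    refine (h1.neg.sub ((h2.const_mul 2).const_mul C)).congr_deriv ?_
    simp [hJ0]
  have hle := HasDerivWithinAt.nonneg_of_eventually_le hψ.hasDerivWithinAt (by
    filter_upwards [Ioo_mem_nhdsLT hℓ0] with t ht
    simpa [hJ0] using key t ht)
  -- Since J vanishes at ℓ, the metric itself does not vary, and the inequality reads -⟨K, K⟩ ≥ 0.
  have hR : R ℓ = (g (φ ℓ (z 0)).1).mulVec K := by
    rw [← hg.fderiv_momentum (hf.mem hℓO)]
    simp only [R]
    congr 1
    exact Prod.ext hJ rfl
  rw [hR, dotProduct_comm, ← metricInner_eq_dotProduct] at hle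
  have hK0 := hg.eq_zero_of_metricInner_self_le_zero (hf.mem hℓO) (v := K) (by linarith)
  have hzero : fderiv ℝ (φ ℓ) (z 0) (0, deriv E 0) = 0 := Prod.ext hJ hK0
  have := hf.injective_fderiv ℓ (z 0) (hzero.trans (map_zero _).symm)
  exact congrArg Prod.snd this

end FluctuationGeometry
end

/-! ### The cut locus is a null set -/

noncomputable section

namespace FluctuationGeometry

open Metric Filter Topology
open scoped Pointwise

/-- A measurable set that meets each ray from the origin at most once is a null set. -/
theorem addHaar_eq_zero_of_forall_smul_notMem {E : Type*} [NormedAddCommGroup E] [NormedSpace ℝ E]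
    [FiniteDimensional ℝ E] [MeasurableSpace E] [BorelSpace E] (μ : Measure E)
    [μ.IsAddHaarMeasure] {S : Set E} (hS : MeasurableSet S)
    (h : ∀ v ∈ S, ∀ t : ℝ, 1 < t → t • v ∉ S) : μ S = 0 := by
  have key : ∀ R : ℕ, μ (S ∩ ball 0 R) = 0 := by
    intro R
    set A := S ∩ ball (0 : E) R with hA
    have hAm : MeasurableSet A := hS.inter measurableSet_ball
    -- Distinct factors in (1, 2]: the dilates are pairwise disjoint, no smaller than A, and all lie
    -- in the ball of radius 2R.
    let r : ℕ → ℝ := fun k => 1 + 1 / ((k : ℝ) + 1)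
    have hr1 : ∀ k, 1 < r k := fun k => by
      simp only [r]; linarith [Nat.one_div_pos_of_nat (α := ℝ) (n := k)]
    have hr2 : ∀ k, r k ≤ 2 := fun k => by
      have : 1 / ((k : ℝ) + 1) ≤ 1 := by
        rw [div_le_one (by positivity)]; linarith [k.cast_nonneg (α := ℝ)]
      simp only [r]; linarith
    have hr0 : ∀ k, r k ≠ 0 := fun k => (zero_lt_one.trans (hr1 k)).ne'
    have hanti : ∀ i j, i < j → r j < r i := fun i j hij => by
      simp only [r]
      have : (i : ℝ) < j := by exact_mod_cast hij
      gcongr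
    have hdis : ∀ i j, i < j → Disjoint (r i • A) (r j • A) := by
      intro i j hij
      rw [Set.disjoint_left]
      rintro _ ⟨s, hs, rfl⟩ ⟨s', hs', he⟩
      refine h s hs.1 (r i / r j) ?_ ?_
      · rw [one_lt_div (zero_lt_one.trans (hr1 j))]; exact hanti i j hij
      · have : (r i / r j) • s = s' := by
          simp only at he
          rw [div_eq_inv_mul, mul_smul, ← he, smul_smul, inv_mul_cancel₀ (hr0 j), one_smul]
        rw [this]; exact hs'.1
    have hpd : Pairwise (Function.onFun Disjoint fun k => r k • A) := by
      intro i j hij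
      rcases lt_or_gt_of_ne hij with h1 | h1
      · exact hdis i j h1
      · exact (hdis j i h1).symm
    have hmeas : ∀ k, MeasurableSet (r k • A) := fun k => hAm.const_smul_of_ne_zero (hr0 k)
    have hle : ∀ k, μ A ≤ μ (r k • A) := fun k => by
      rw [Measure.addHaar_smul]
      refine le_mul_of_one_le_left zero_le ?_
      rw [ENNReal.one_le_ofReal, abs_pow, abs_of_pos (zero_lt_one.trans (hr1 k))]
      exact one_le_pow₀ (hr1 k).le
    have hsub : (⋃ k, r k • A) ⊆ ball 0 (2 * R) := by
      refine iUnion_subset fun k => ?_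
      rintro _ ⟨s, hs, rfl⟩
      have h1 : ‖s‖ < R := by simpa using hs.2
      have h2 : ‖r k • s‖ = r k * ‖s‖ := by
        rw [norm_smul, Real.norm_eq_abs, abs_of_pos (zero_lt_one.trans (hr1 k))]
      have : ‖r k • s‖ < 2 * R := by
        rw [h2]
        nlinarith [hr2 k, hr1 k, norm_nonneg s]
      simpa using this
    by_contra hne
    have h1 : ∑' k, μ (r k • A) ≤ μ (ball (0 : E) (2 * R)) := by
      rw [← measure_iUnion hpd hmeas]; exact measure_mono hsub
    have h2 : ∑' _ : ℕ, μ A ≤ ∑' k, μ (r k • A) := ENNReal.tsum_le_tsum hle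
    rw [ENNReal.tsum_const_eq_top_of_ne_zero hne] at h2
    exact absurd (h2.trans h1) (not_le.2 measure_ball_lt_top)
  have : S = ⋃ R : ℕ, S ∩ ball 0 R := by
    rw [← inter_iUnion, iUnion_ball_nat, inter_univ]
  rw [this]
  exact measure_iUnion_null key

variable {d : ℕ} {U : Set (Fin d → ℝ)} {g : (Fin d → ℝ) → Matrix (Fin d) (Fin d) ℝ}
  {a : Fin d → ℝ}

/-- The tangent vectors `v` at `a` for which `t ↦ exp (t v)` is minimizing on `[0, 1]`. -/
def minimizingSet (U : Set (Fin d → ℝ)) (g : (Fin d → ℝ) → Matrix (Fin d) (Fin d) ℝ)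
    (a : Fin d → ℝ) : Set (Fin d → ℝ) :=
  {v | v ∈ expDomain U g a ∧ riemannianDist U g a (expMap U g a v) = √(metricInner g a v v)}

theorem minimizesUpTo_iff {e : Fin d → ℝ} {L : ℝ} :
    MinimizesUpTo U g a e L ↔ ∃ z, IsGeodesicLift U g L z ∧ z 0 = (a, e) ∧
      riemannianDist U g a (z L).1 = L := by
  simp only [MinimizesUpTo, isGeodesicFrom_iff]
  constructor
  · rintro ⟨γ, ⟨z, hz, h0, hγ⟩, hd⟩
    exact ⟨z, hz, h0, by rwa [hγ]⟩
  · rintro ⟨z, hz, h0, hd⟩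
    exact ⟨_, ⟨z, hz, h0, fun _ => rfl⟩, hd⟩

theorem smul_mem_minimizingSet_iff (hg : IsRiemannianMetricOn U g) {e : Fin d → ℝ} {L : ℝ}
    (he : IsUnitAt g a e) (hL : 0 < L) :
    L • e ∈ minimizingSet U g a ↔ MinimizesUpTo U g a e L := by
  have hn : √(metricInner g a (L • e) (L • e)) = L := by
    rw [metricInner_smul_left, metricInner_smul_right, he, mul_one, Real.sqrt_mul_self hL.le]
  rw [minimizingSet, mem_ofPred_eq, mem_expDomain_smul_iff hL, hn, minimizesUpTo_iff]
  constructor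
  · rintro ⟨⟨z, hz, h0⟩, hd⟩
    exact ⟨z, hz, h0, by rwa [hz.expMap_eq hg hL.le h0] at hd⟩
  · rintro ⟨z, hz, h0, hd⟩
    exact ⟨⟨z, hz, h0⟩, by rwa [hz.expMap_eq hg hL.le h0]⟩

theorem MinimizesUpTo.mono (hg : IsRiemannianMetricOn U g) (hj : IsGeodesicallyJoined U g a)
    {e : Fin d → ℝ} {L ℓ : ℝ} (he : IsUnitAt g a e) (hℓ : 0 ≤ ℓ) (hL : ℓ ≤ L)
    (h : MinimizesUpTo U g a e L) : MinimizesUpTo U g a e ℓ := by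
  obtain ⟨z, hz, h0, hd⟩ := minimizesUpTo_iff.1 h
  have ha : a = (z 0).1 := by rw [h0]
  have hee : e = (z 0).2 := by rw [h0]
  refine minimizesUpTo_iff.2 ⟨z, hz.mono hL, h0, ?_⟩
  rw [ha] at hj hd ⊢
  exact hz.riemannianDist_eq hg (by rw [← hee, ← ha]; exact he) ⟨hℓ, hL⟩ hj hd

theorem IsRiemannianMetricOn.exists_unit_smul (hg : IsRiemannianMetricOn U g) (ha : a ∈ U)
    {v : Fin d → ℝ} (hv : v ≠ 0) :
    ∃ (e : Fin d → ℝ) (s : ℝ), IsUnitAt g a e ∧ 0 < s ∧ v = s • e := by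
  have hpos := hg.metricInner_self_pos ha hv
  have hs : 0 < √(metricInner g a v v) := Real.sqrt_pos.2 hpos
  refine ⟨(√(metricInner g a v v))⁻¹ • v, √(metricInner g a v v), ?_, hs, ?_⟩
  · rw [IsUnitAt, metricInner_smul_left, metricInner_smul_right]
    field_simp
    rw [Real.sq_sqrt hpos.le]
  · rw [smul_smul, mul_inv_cancel₀ hs.ne', one_smul]

theorem smul_mem_minimizingSet (hg : IsRiemannianMetricOn U g) (ha : a ∈ U)
    (hj : IsGeodesicallyJoined U g a) {v : Fin d → ℝ} (hv : v ∈ minimizingSet U g a) {t : ℝ}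
    (ht : 0 < t) (ht1 : t ≤ 1) : t • v ∈ minimizingSet U g a := by
  by_cases hv0 : v = 0
  · rw [hv0, smul_zero, ← hv0]; exact hv
  · obtain ⟨e, s, he, hs, rfl⟩ := hg.exists_unit_smul ha hv0
    rw [smul_smul, smul_mem_minimizingSet_iff hg he (by positivity)]
    exact ((smul_mem_minimizingSet_iff hg he hs).1 hv).mono hg hj he (by positivity)
      (by nlinarith)

theorem IsRiemannianMetricOn.mapsTo_expMap (hg : IsRiemannianMetricOn U g) (a : Fin d → ℝ) :
    MapsTo (expMap U g a) (expDomain U g a) U := by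
  rintro v ⟨z, hz, h0⟩
  have := hz.expMap_eq hg zero_le_one h0
  rw [one_smul] at this
  rw [this]
  exact (hz 1 ⟨zero_le_one, le_rfl⟩).1

/-- On the open domain of the exponential map this is the coincidence set of two continuous
functions, hence open minus open. -/
theorem measurableSet_minimizingSet (hg : IsRiemannianMetricOn U g) (ha : a ∈ U)
    (hj : IsGeodesicallyJoined U g a) : MeasurableSet (minimizingSet U g a) := by
  have hW := hg.isOpen_expDomain a
  have h1 : ContinuousOn (fun v => riemannianDist U g a (expMap U g a v)) (expDomain U g a) :=
    (hg.continuousOn_riemannianDist hj).comp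
      (fun v hv => (hg.contDiffAt_expMap hv).continuousAt.continuousWithinAt) (hg.mapsTo_expMap a)
  have h2 : ContinuousOn (fun v => √(metricInner g a v v)) (expDomain U g a) :=
    (hg.continuousOn_metricInner (x := fun _ => a) (fun _ _ => ha) continuousOn_const
      continuousOn_id continuousOn_id).sqrt
  have h3 := (h1.sub h2).isOpen_inter_preimage hW (isOpen_compl_singleton (x := (0 : ℝ)))
  convert hW.measurableSet.diff h3.measurableSet using 1
  ext v
  simp only [minimizingSet, mem_ofPred_eq, Set.mem_sdiff, mem_inter_iff, mem_preimage,
    mem_compl_iff, mem_singleton_iff, Pi.sub_apply, sub_eq_zero]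
  tauto

/-- The tangential cut locus: the end points of maximal minimizing rays. -/
def tangentCutLocus (U : Set (Fin d → ℝ)) (g : (Fin d → ℝ) → Matrix (Fin d) (Fin d) ℝ)
    (a : Fin d → ℝ) : Set (Fin d → ℝ) :=
  {v | v ∈ minimizingSet U g a ∧ ∀ t : ℝ, 1 < t → t • v ∉ minimizingSet U g a}

/-- Each ray is met at most once by definition. For measurability, star-shapedness of the minimizing
set allows the factors t > 1 to be restricted to rational ones. -/
theorem volume_tangentCutLocus (hg : IsRiemannianMetricOn U g) (ha : a ∈ U)
    (hj : IsGeodesicallyJoined U g a) : volume (tangentCutLocus U g a) = 0 := by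
  refine addHaar_eq_zero_of_forall_smul_notMem volume ?_ fun v hv t ht h => hv.2 t ht h.1
  have hM := measurableSet_minimizingSet hg ha hj
  have : tangentCutLocus U g a = minimizingSet U g a \
      ⋃ r : {r : ℚ // 1 < r}, (fun v => (r.1 : ℝ) • v) ⁻¹' minimizingSet U g a := by
    ext v
    simp only [tangentCutLocus, mem_ofPred_eq, Set.mem_sdiff, mem_iUnion, mem_preimage, not_exists]
    refine and_congr_right fun _ => ⟨fun h r => h r (by exact_mod_cast r.2), fun h t ht htv => ?_⟩
    obtain ⟨r, hr1, hrt⟩ := exists_rat_btwn ht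
    refine h ⟨r, by exact_mod_cast hr1⟩ ?_
    have hr0 : (0 : ℝ) < r := zero_lt_one.trans hr1
    have ht0 : 0 < t := zero_lt_one.trans ht
    have := smul_mem_minimizingSet hg ha hj htv (t := r / t) (by positivity)
      ((div_le_one ht0).2 hrt.le)
    rwa [smul_smul, div_mul_cancel₀ _ ht0.ne'] at this
  rw [this]
  exact hM.diff (MeasurableSet.iUnion fun r => (measurable_const_smul _) hM)

/-- The points before the cut locus fill the domain up to a null set. -/
theorem volume_compl_minimizing_eq_zero {n : ℕ} {U : Set (Fin (n + 1) → ℝ)}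
    {g : (Fin (n + 1) → ℝ) → Matrix (Fin (n + 1)) (Fin (n + 1)) ℝ} {a : Fin (n + 1) → ℝ}
    (hg : IsRiemannianMetricOn U g) (ha : a ∈ U) (hj : IsGeodesicallyJoined U g a) :
    volume {x | x ∈ U ∧ ¬ ∃ (e : Fin (n + 1) → ℝ) (ℓ L : ℝ), IsUnitAt g a e ∧ 0 < ℓ ∧ ℓ < L ∧
      MinimizesUpTo U g a e L ∧ geodesicPoint U g a e ℓ = x} = 0 := by
  have hnull : volume (expMap U g a '' tangentCutLocus U g a) = 0 :=
    addHaar_image_eq_zero_of_differentiableOn_of_addHaar_eq_zero volume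
      (fun v hv => ((hg.contDiffAt_expMap hv.1.1).differentiableAt
        (by simp)).differentiableWithinAt) (volume_tangentCutLocus hg ha hj)
  refine measure_mono_null ?_ (measure_union_null (measure_singleton a) hnull)
  rintro x ⟨hx, hno⟩
  obtain ⟨e, L, γ, hL, he, hγ, hγL, hd⟩ := hj x hx
  obtain ⟨z, hz, h0, hzγ⟩ := isGeodesicFrom_iff.1 hγ
  have hzL : (z L).1 = x := by rw [hzγ, hγL]
  rcases hL.eq_or_lt with rfl | hL
  · left
    rw [mem_singleton_iff, ← hzL, h0]
  · right
    have hmin : MinimizesUpTo U g a e L := minimizesUpTo_iff.2 ⟨z, hz, h0, by rw [hzL, hd]⟩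
    -- If some t • (L • e) with t > 1 were still minimizing, x would be admissible with parameter L
    -- and end tL.
    refine ⟨L • e, ⟨(smul_mem_minimizingSet_iff hg he hL).2 hmin, fun t ht htm => hno ?_⟩, ?_⟩
    · rw [smul_smul] at htm
      exact ⟨e, L, t * L, he, hL, by nlinarith,
        (smul_mem_minimizingSet_iff hg he (by positivity)).1 htm,
        by rw [hz.geodesicPoint_eq hg hL.le h0, hzL]⟩
    · rw [hz.expMap_eq hg hL.le h0, hzL]

end FluctuationGeometry
end

noncomputable section

namespace FluctuationGeometry

open Metric Filter Topology

/-! ### Geodesic spherical coordinates -/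

variable {n : ℕ} {U : Set (Fin (n + 1) → ℝ)}
  {g : (Fin (n + 1) → ℝ) → Matrix (Fin (n + 1)) (Fin (n + 1)) ℝ} {a : Fin (n + 1) → ℝ}
  {Q : Set (Fin n → ℝ)} {e : (Fin n → ℝ) → Fin (n + 1) → ℝ}

/-- This writes the domain as a countable union of preimages of the minimizing set, so it is Borel
without any appeal to continuity of the cut time. -/
theorem mem_sphericalDomain_iff_exists_rat (hg : IsRiemannianMetricOn U g)
    (hj : IsGeodesicallyJoined U g a) (he : IsDirectionChart g a Q e) {z : ℝ × (Fin n → ℝ)} :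
    z ∈ sphericalDomain U g a Q e ↔ (z.2 ∈ Q ∧ 0 < z.1) ∧
      ∃ r : {r : ℚ // 1 < r}, (r.1 * z.1 : ℝ) • e z.2 ∈ minimizingSet U g a := by
  simp only [sphericalDomain, mem_ofPred_eq, and_assoc]
  refine and_congr_right fun hq => and_congr_right fun hz => ?_
  constructor
  · rintro ⟨L, hL, hm⟩
    obtain ⟨r, hr1, hrL⟩ := exists_rat_btwn ((one_lt_div hz).2 hL)
    have hr0 : (0 : ℝ) < r := zero_lt_one.trans hr1
    refine ⟨⟨r, by exact_mod_cast hr1⟩, ?_⟩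
    rw [smul_mem_minimizingSet_iff hg (he.unit _ hq) (by positivity)]
    exact hm.mono hg hj (he.unit _ hq) (by positivity) ((lt_div_iff₀ hz).1 hrL).le
  · rintro ⟨r, hr⟩
    have hr1 : (1 : ℝ) < r.1 := by exact_mod_cast r.2
    have hr0 : (0 : ℝ) < r.1 := zero_lt_one.trans hr1
    rw [smul_mem_minimizingSet_iff hg (he.unit _ hq) (by positivity)] at hr
    exact ⟨_, by nlinarith, hr⟩

theorem ContinuousOn.measurableSet_inter_preimage {X Y : Type*} [TopologicalSpace X]
    [MeasurableSpace X] [BorelSpace X] [TopologicalSpace Y] [MeasurableSpace Y] [BorelSpace Y]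
    {f : X → Y} {s : Set X} (hf : ContinuousOn f s) (hs : MeasurableSet s) {t : Set Y}
    (ht : MeasurableSet t) : MeasurableSet (s ∩ f ⁻¹' t) := by
  have h1 : MeasurableSet (s.domRestrict f ⁻¹' t) :=
    (continuousOn_iff_continuous_domRestrict.1 hf).measurable ht
  convert hs.subtype_image h1 using 1
  ext x
  simp [Set.domRestrict_apply, and_comm]

theorem measurableSet_sphericalDomain (hg : IsRiemannianMetricOn U g) (ha : a ∈ U)
    (hj : IsGeodesicallyJoined U g a) (he : IsDirectionChart g a Q e) :
    MeasurableSet (sphericalDomain U g a Q e) := by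
  set S : Set (ℝ × (Fin n → ℝ)) := {z | z.2 ∈ Q ∧ 0 < z.1} with hS
  have hSo : IsOpen S :=
    (he.isOpen.preimage continuous_snd).inter (isOpen_lt continuous_const continuous_fst)
  have hec : ContinuousOn (fun z : ℝ × (Fin n → ℝ) => e z.2) S :=
    he.contDiffOn.continuousOn.comp continuousOn_snd fun z hz => hz.1
  have : sphericalDomain U g a Q e = ⋃ r : {r : ℚ // 1 < r},
      S ∩ (fun z : ℝ × (Fin n → ℝ) => (r.1 * z.1 : ℝ) • e z.2) ⁻¹' minimizingSet U g a := by
    ext z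
    rw [mem_sphericalDomain_iff_exists_rat hg hj he]
    simp [hS]
  rw [this]
  refine MeasurableSet.iUnion fun r => ContinuousOn.measurableSet_inter_preimage ?_
    hSo.measurableSet (measurableSet_minimizingSet hg ha hj)
  exact (continuousOn_const.mul continuousOn_fst).smul hec

theorem exists_isGeodesicLift_of_mem_sphericalDomain (hg : IsRiemannianMetricOn U g)
    {z : ℝ × (Fin n → ℝ)} (hz : z ∈ sphericalDomain U g a Q e) :
    ∃ L ζ, z.1 < L ∧ IsGeodesicLift U g L ζ ∧ ζ 0 = (a, e z.2) ∧
      riemannianDist U g a (ζ L).1 = L ∧ sphericalMap U g a e z = (ζ z.1).1 := by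
  obtain ⟨-, hz0, L, hL, hm⟩ := hz
  obtain ⟨ζ, hζ, h0, hd⟩ := minimizesUpTo_iff.1 hm
  exact ⟨L, ζ, hL, hζ, h0, hd, (hζ.mono hL.le).geodesicPoint_eq hg hz0.le h0⟩

theorem riemannianDist_sphericalMap (hg : IsRiemannianMetricOn U g)
    (hj : IsGeodesicallyJoined U g a) (he : IsDirectionChart g a Q e) {z : ℝ × (Fin n → ℝ)}
    (hz : z ∈ sphericalDomain U g a Q e) :
    sphericalMap U g a e z ∈ U ∧ riemannianDist U g a (sphericalMap U g a e z) = z.1 := by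
  obtain ⟨L, ζ, hL, hζ, h0, hd, hΦ⟩ := exists_isGeodesicLift_of_mem_sphericalDomain hg hz
  have hu := he.unit _ hz.1
  have h01 : (ζ 0).1 = a := by rw [h0]
  have h02 : (ζ 0).2 = e z.2 := by rw [h0]
  have hm : z.1 ∈ Icc 0 L := ⟨hz.2.1.le, hL.le⟩
  rw [hΦ]
  refine ⟨(hζ _ hm).1, ?_⟩
  have := hζ.riemannianDist_eq hg (by rw [h01, h02]; exact hu) hm (by rwa [h01]) (by rwa [h01])
  rwa [h01] at this

/-- The distance recovers ℓ. Then both geodesics arrive with the same velocity, and running them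
back gives the same direction. -/
theorem injOn_sphericalMap (hg : IsRiemannianMetricOn U g)
    (hj : IsGeodesicallyJoined U g a) (he : IsDirectionChart g a Q e) :
    InjOn (sphericalMap U g a e) (sphericalDomain U g a Q e) := by
  rintro ⟨ℓ₁, q₁⟩ hz₁ ⟨ℓ₂, q₂⟩ hz₂ h
  have hℓ : ℓ₁ = ℓ₂ := by
    have h₁ := (riemannianDist_sphericalMap hg hj he hz₁).2
    rw [h, (riemannianDist_sphericalMap hg hj he hz₂).2] at h₁
    exact h₁.symm
  subst hℓ
  obtain ⟨L₁, ζ₁, hL₁, hζ₁, h₁, hd₁, hΦ₁⟩ := exists_isGeodesicLift_of_mem_sphericalDomain hg hz₁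
  obtain ⟨L₂, ζ₂, hL₂, hζ₂, h₂, -, hΦ₂⟩ := exists_isGeodesicLift_of_mem_sphericalDomain hg hz₂
  have hu₁ := he.unit _ hz₁.1
  have hu₂ := he.unit _ hz₂.1
  have h0 : (0 : ℝ) < ℓ₁ := hz₁.2.1
  have heq := hζ₁.eq_of_fst_eq hg (by rw [h₁]; exact hu₁) h0 hL₁ (by rwa [h₁]) (by rwa [h₁])
    (hζ₂.mono hL₂.le) (by rw [h₂]; exact hu₂) (by rw [h₁, h₂])
    (by rw [hΦ₁, hΦ₂] at h; exact h.symm)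
  have := (hζ₂.mono hL₂.le).eq_zero_of_eq hg (hζ₁.mono hL₁.le) ⟨h0.le, le_rfl⟩ heq
  rw [h₁, h₂, Prod.mk.injEq] at this
  rw [Prod.mk.injEq]
  exact ⟨rfl, he.injOn hz₁.1 hz₂.1 this.2.symm⟩

/-- Near a point of the domain the geodesics still exist, minimizing or not, so the coordinate map
can be differentiated there although the domain is not shown to be open. -/
theorem eventually_sphericalMap_eq (hg : IsRiemannianMetricOn U g)
    (he : IsDirectionChart g a Q e) {z : ℝ × (Fin n → ℝ)} (hz0 : 0 < z.1) (hzQ : z.2 ∈ Q)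
    {O f φ} (hf : IsLocalGeodesicFlow U g O f φ) {L ε : ℝ} (hL : z.1 < L) (hε : 0 < ε)
    (hO : ∀ w ∈ ball (a, e z.2) ε, ∀ t ∈ Icc (-ε) (L + ε), φ t w ∈ O) :
    sphericalMap U g a e =ᶠ[𝓝 z] fun z' => (φ z'.1 (a, e z'.2)).1 := by
  have hec : ContinuousAt (fun z' : ℝ × (Fin n → ℝ) => (a, e z'.2)) z :=
    continuousAt_const.prodMk ((he.contDiffOn.continuousOn.continuousAt
      (he.isOpen.mem_nhds hzQ)).comp continuousAt_snd)
  filter_upwards [hec.eventually (ball_mem_nhds _ hε),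
    continuousAt_fst.eventually (lt_mem_nhds hz0),
    continuousAt_fst.eventually (gt_mem_nhds hL)] with z' h1 h2 h3
  have hl : IsGeodesicLift U g z'.1 fun t => φ t (a, e z'.2) := hf.isGeodesicLift fun t ht =>
    hO _ h1 t ⟨by linarith [ht.1], by linarith [ht.2]⟩
  exact hl.geodesicPoint_eq hg h2.le (hf.isFlow.zero _)

/-- The structure of the spherical coordinate map at a point before the cut locus. -/
theorem exists_fderiv_sphericalMap (hg : IsRiemannianMetricOn U g) (ha : a ∈ U)
    (hj : IsGeodesicallyJoined U g a) (he : IsDirectionChart g a Q e) {z : ℝ × (Fin n → ℝ)}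
    (hz : z ∈ sphericalDomain U g a Q e) :
    ContDiffAt ℝ ∞ (sphericalMap U g a e) z ∧
      ∃ (V : Fin (n + 1) → ℝ) (J : (Fin n → ℝ) → Fin (n + 1) → ℝ),
        (∀ α w, fderiv ℝ (sphericalMap U g a e) z (α, w) = α • V + J w) ∧
        metricInner g (sphericalMap U g a e z) V V = 1 ∧
        (∀ w, metricInner g (sphericalMap U g a e z) V (J w) = 0) ∧
        ∀ w, J w = 0 → w = 0 := by
  obtain ⟨L, ζ, hL, hζ, h0, hd, hΦ⟩ := exists_isGeodesicLift_of_mem_sphericalDomain hg hz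
  have hz0 : 0 < z.1 := hz.2.1
  have hzQ : z.2 ∈ Q := hz.1
  have hL0 : 0 < L := hz0.trans hL
  have hm : z.1 ∈ Icc 0 L := ⟨hz0.le, hL.le⟩
  have hu := he.unit _ hzQ
  obtain ⟨O, f, φ, hf, hφ, ε, hε, hO⟩ := hζ.exists_flow hg hL0.le
  have hOev : ∀ᶠ w in 𝓝 (ζ 0), ∀ t ∈ Icc 0 L, φ t w ∈ O := by
    filter_upwards [ball_mem_nhds _ hε] with w hw t ht
    exact hO w hw t ⟨by linarith [ht.1], by linarith [ht.2]⟩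
  have hloc := eventually_sphericalMap_eq hg he hz0 hzQ hf hL hε (by rwa [h0] at hO)
  have heC : ContDiffAt ℝ ∞ e z.2 := he.contDiffOn.contDiffAt (he.isOpen.mem_nhds hzQ)
  have hsm : ContDiffAt ℝ ∞ (fun z' : ℝ × (Fin n → ℝ) => (φ z'.1 (a, e z'.2)).1) z :=
    contDiffAt_fst.comp z (hf.contDiff_flow.contDiffAt.comp z
      (contDiffAt_fst.prodMk (contDiffAt_const.prodMk (heC.comp z contDiffAt_snd))))
  have hΦd : ContDiffAt ℝ ∞ (sphericalMap U g a e) z := hsm.congr_of_eventuallyEq hloc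
  refine ⟨hΦd, ?_⟩
  set D := fderiv ℝ (sphericalMap U g a e) z with hD
  have hDd : HasFDerivAt (fun z' : ℝ × (Fin n → ℝ) => (φ z'.1 (a, e z'.2)).1) D z :=
    (hΦd.differentiableAt (by simp)).hasFDerivAt.congr_of_eventuallyEq hloc.symm
  have hzO : φ z.1 (ζ 0) ∈ O := hOev.self_of_nhds z.1 hm
  have hζφ : ζ z.1 = φ z.1 (ζ 0) := hφ z.1 hm
  have hV : D (1, 0) = (φ z.1 (ζ 0)).2 := by
    have h1 := hDd.comp_hasDerivAt z.1
      ((hasDerivAt_id z.1).prodMk (hasDerivAt_const z.1 z.2))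
    have h2 := (hasFDerivAt_fst (𝕜 := ℝ) (p := φ z.1 (ζ 0))).comp_hasDerivAt z.1
      (hf.hasDerivAt hzO)
    rw [h0] at h2 ⊢
    exact h1.unique h2
  have hJ : ∀ w, D (0, w) = (fderiv ℝ (φ z.1) (ζ 0) (0, fderiv ℝ e z.2 w)).1 := by
    intro w
    have h1 := HasFDerivAt.comp z.2 (g := fun z' : ℝ × (Fin n → ℝ) => (φ z'.1 (a, e z'.2)).1)
      (f := fun q => (z.1, q)) hDd (hasFDerivAt_prodMk_right z.1 z.2)
    have h2 : HasFDerivAt (fun q => ((a, e q) : (Fin (n + 1) → ℝ) × (Fin (n + 1) → ℝ)))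
        ((0 : (Fin n → ℝ) →L[ℝ] (Fin (n + 1) → ℝ)).prod (fderiv ℝ e z.2)) z.2 :=
      (hasFDerivAt_const a z.2).prodMk (heC.differentiableAt (by simp)).hasFDerivAt
    have h3 := (hasFDerivAt_fst (𝕜 := ℝ) (p := φ z.1 (a, e z.2))).comp z.2
      ((hf.hasFDerivAt z.1 (a, e z.2)).comp z.2 h2)
    have := congrArg (fun A => A w) (h1.unique h3)
    rw [h0]
    simpa using this
  -- Each angular direction w is realised by a curve of unit vectors; this is the variation fed to
  -- the Gauss lemma and to the absence of conjugate points.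
  have hline : ∀ w, ContDiffAt ℝ ∞ (fun s : ℝ => e (z.2 + s • w)) 0 ∧
      HasDerivAt (fun s : ℝ => e (z.2 + s • w)) (fderiv ℝ e z.2 w) 0 ∧
      ∀ᶠ s in 𝓝 (0 : ℝ), IsUnitAt g a (e (z.2 + s • w)) := by
    intro w
    have hl : ContDiff ℝ ∞ fun s : ℝ => z.2 + s • w :=
      contDiff_const.add (contDiff_id.smul contDiff_const)
    have hl0 : z.2 + (0 : ℝ) • w = z.2 := by simp
    refine ⟨ContDiffAt.comp (g := e) (0 : ℝ) (by rwa [hl0]) hl.contDiffAt, ?_, ?_⟩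
    · have h1 : HasDerivAt (fun s : ℝ => z.2 + s • w) w 0 := by
        simpa using ((hasDerivAt_id (0 : ℝ)).smul_const w).const_add z.2
      have h2 : HasFDerivAt e (fderiv ℝ e z.2) (z.2 + (0 : ℝ) • w) := by
        rw [hl0]; exact (heC.differentiableAt (by simp)).hasFDerivAt
      exact h2.comp_hasDerivAt (0 : ℝ) h1
    · have h1 : ContinuousAt (fun s : ℝ => z.2 + s • w) 0 := hl.continuous.continuousAt
      filter_upwards [h1.eventually (he.isOpen.mem_nhds (by simpa using hzQ))] with s hs
      exact he.unit _ hs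
  have hΦ' : sphericalMap U g a e z = (φ z.1 (ζ 0)).1 := by rw [hΦ, hζφ]
  refine ⟨(φ z.1 (ζ 0)).2, fun w => D (0, w), fun α w => ?_, ?_, fun w => ?_, fun w hw => ?_⟩
  · rw [← hV, ← map_smul, ← map_add]; simp
  · rw [hΦ', ← hζφ, hζ.speed_eq hg hm, h0]; exact hu
  · simp only
    rw [hΦ', hJ, hf.gauss hg hm hOev, h0]
    obtain ⟨-, h2, h3⟩ := hline w
    have := hg.metricInner_deriv_eq_zero ha h2 h3
    simp only [zero_smul, add_zero] at this
    simp [this]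
  · obtain ⟨h1, h2, h3⟩ := hline w
    have := hζ.deriv_eq_zero_of_jacobi_eq_zero hg (by rw [h0]; exact hu) hz0 hL (by rwa [h0])
      (by rwa [h0]) hf hφ hOev h1 (by simp [h0]) (by rw [h0]; exact h3)
      (by rw [h2.deriv, ← hJ]; exact hw)
    rw [h2.deriv] at this
    exact he.immersion _ hzQ (this.trans (map_zero _).symm)

theorem bijective_fderiv_sphericalMap (hg : IsRiemannianMetricOn U g) (ha : a ∈ U)
    (hj : IsGeodesicallyJoined U g a) (he : IsDirectionChart g a Q e) {z : ℝ × (Fin n → ℝ)}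
    (hz : z ∈ sphericalDomain U g a Q e) :
    Function.Bijective (fderiv ℝ (sphericalMap U g a e) z) := by
  obtain ⟨-, V, J, hVJ, hVV, hVJ0, hJ⟩ := exists_fderiv_sphericalMap hg ha hj he hz
  have hinj : Function.Injective (fderiv ℝ (sphericalMap U g a e) z) := by
    rw [injective_iff_map_eq_zero]
    rintro ⟨α, w⟩ h
    rw [hVJ] at h
    have h1 := congrArg (metricInner g (sphericalMap U g a e z) V) h
    rw [metricInner_add_right, metricInner_smul_right, hVV, hVJ0, metricInner_zero_right] at h1
    have hα : α = 0 := by linarith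
    rw [hα, zero_smul, zero_add] at h
    rw [hα, hJ w h]; rfl
  refine ⟨hinj, ?_⟩
  exact (LinearMap.injective_iff_surjective_of_finrank_eq_finrank
    (f := (fderiv ℝ (sphericalMap U g a e) z : ℝ × (Fin n → ℝ) →ₗ[ℝ] Fin (n + 1) → ℝ))
    (by simp [add_comm])).1 hinj

end FluctuationGeometry
end

/-! ### The metric and the gaussian measure in spherical coordinates -/

noncomputable section

namespace FluctuationGeometry

open Metric Filter Topology

variable {n : ℕ} {U : Set (Fin (n + 1) → ℝ)}
  {g : (Fin (n + 1) → ℝ) → Matrix (Fin (n + 1)) (Fin (n + 1)) ℝ} {a : Fin (n + 1) → ℝ}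
  {Q : Set (Fin n → ℝ)} {e : (Fin n → ℝ) → Fin (n + 1) → ℝ}

theorem radialField_angularField_inner (hg : IsRiemannianMetricOn U g) (ha : a ∈ U)
    (hj : IsGeodesicallyJoined U g a) (he : IsDirectionChart g a Q e) {z : ℝ × (Fin n → ℝ)}
    (hz : z ∈ sphericalDomain U g a Q e) :
    metricInner g (sphericalMap U g a e z) (radialField (sphericalMap U g a e) z)
      (radialField (sphericalMap U g a e) z) = 1 ∧
    ∀ α, metricInner g (sphericalMap U g a e z) (radialField (sphericalMap U g a e) z)
      (angularField (sphericalMap U g a e) α z) = 0 := by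
  obtain ⟨-, V, J, hVJ, hVV, hVJ0, hJ⟩ := exists_fderiv_sphericalMap hg ha hj he hz
  have hJ0 : J 0 = 0 := by
    have := hVJ 0 0
    rwa [← Prod.zero_eq_mk, map_zero, zero_smul, zero_add, eq_comm] at this
  have hr : radialField (sphericalMap U g a e) z = V := by
    rw [radialField, hVJ, hJ0, one_smul, add_zero]
  rw [hr]
  refine ⟨hVV, fun α => ?_⟩
  rw [angularField, hVJ, zero_smul, zero_add, hVJ0]

/-- The splitting `x ↦ (x 0, (x 1, …, x n))` of `ℝ^(n+1)`. -/
def splitCLM (n : ℕ) : (Fin (n + 1) → ℝ) →L[ℝ] ℝ × (Fin n → ℝ) :=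
  (ContinuousLinearMap.proj 0).prod
    (ContinuousLinearMap.pi fun j => ContinuousLinearMap.proj j.succ)

theorem splitCLM_single_zero : splitCLM n (Pi.single 0 1) = (1, 0) := by
  ext <;> simp [splitCLM]

theorem splitCLM_single_succ (α : Fin n) :
    splitCLM n (Pi.single α.succ 1) = (0, Pi.single α 1) := by
  ext
  · simp [splitCLM]
  · simp [splitCLM, Pi.single_apply]

theorem splitCLM_eq_piFinSuccAbove :
    ⇑(splitCLM n) = MeasurableEquiv.piFinSuccAbove (fun _ => ℝ) 0 := by
  ext x
  · simp [splitCLM]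
  · simp [splitCLM, Fin.tail]

theorem measurableEmbedding_splitCLM : MeasurableEmbedding (splitCLM n) := by
  rw [splitCLM_eq_piFinSuccAbove]; exact MeasurableEquiv.measurableEmbedding _

theorem measurePreserving_splitCLM : MeasurePreserving (splitCLM n) volume volume := by
  rw [splitCLM_eq_piFinSuccAbove]; exact volume_preserving_piFinSuccAbove (fun _ => ℝ) 0

theorem splitCLM_surjective : Function.Surjective (splitCLM n) := by
  rw [splitCLM_eq_piFinSuccAbove]; exact MeasurableEquiv.surjective _

/-- The Jacobian identity of orthogonal coordinates with unit radial field. -/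
theorem abs_det_mul_sqrt_det {x : Fin (n + 1) → ℝ}
    (A : ℝ × (Fin n → ℝ) →L[ℝ] Fin (n + 1) → ℝ)
    (h1 : metricInner g x (A (1, 0)) (A (1, 0)) = 1)
    (h0 : ∀ α, metricInner g x (A (1, 0)) (A (0, Pi.single α 1)) = 0) :
    |(A.comp (splitCLM n)).det| * √(((2 * Real.pi)⁻¹ • g x).det) =
      1 / √(2 * Real.pi) * √(((2 * Real.pi)⁻¹ • Matrix.of fun α β : Fin n =>
        metricInner g x (A (0, Pi.single α 1)) (A (0, Pi.single β 1))).det) := by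
  set B : (Fin (n + 1) → ℝ) →ₗ[ℝ] (Fin (n + 1) → ℝ) :=
    (A.comp (splitCLM n)).toLinearMap with hB
  set M := LinearMap.toMatrix' B with hM
  have hdet : (A.comp (splitCLM n)).det = M.det := by
    rw [hM, LinearMap.det_toMatrix']
  set I : Matrix (Fin n) (Fin n) ℝ := Matrix.of fun α β : Fin n =>
        metricInner g x (A (0, Pi.single α 1)) (A (0, Pi.single β 1)) with hI
  have hN : ∀ i j, (M.transpose * g x * M) i j =
      metricInner g x (B (Pi.single i 1)) (B (Pi.single j 1)) := by
    intro i j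
    simp only [Matrix.mul_apply, Matrix.transpose_apply, Finset.sum_mul, metricInner, hM,
      LinearMap.toMatrix'_apply]
    rw [Finset.sum_comm]
    exact Finset.sum_congr rfl fun k _ => Finset.sum_congr rfl fun l _ => by ring
  have hB0 : B (Pi.single 0 1) = A (1, 0) := by
    simp only [hB, ContinuousLinearMap.coe_coe, ContinuousLinearMap.comp_apply,
      splitCLM_single_zero]
  have hBs : ∀ α : Fin n, B (Pi.single α.succ 1) = A (0, Pi.single α 1) := fun α => by
    simp only [hB, ContinuousLinearMap.coe_coe, ContinuousLinearMap.comp_apply,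
      splitCLM_single_succ]
  -- The Gram matrix of the coordinate fields is the block matrix 1 ⊕ I; its determinant is expanded
  -- along the first row.
  have hNdet : (M.transpose * g x * M).det = I.det := by
    rw [Matrix.det_succ_row_zero, Fin.sum_univ_succ, Finset.sum_eq_zero, add_zero]
    · have : (M.transpose * g x * M).submatrix Fin.succ (Fin.succAbove 0) = I := by
        ext α β
        rw [Matrix.submatrix_apply, hN, Fin.succAbove_zero, hBs, hBs, hI, Matrix.of_apply]
      rw [this, hN, hB0, h1]
      simp
    · intro α _
      rw [hN, hB0, hBs, h0]
      simp
  have hsq : M.det ^ 2 * (g x).det = I.det := by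
    rw [← hNdet, Matrix.det_mul, Matrix.det_mul, Matrix.det_transpose]; ring
  have hc : (0 : ℝ) ≤ (2 * Real.pi)⁻¹ := by positivity
  -- The scalings contribute (2π)^-(n+1) on the left and (2π)^-n on the right; the spare factor
  -- gives 1/√(2π).
  rw [hdet, Matrix.det_smul, Matrix.det_smul, Fintype.card_fin, Fintype.card_fin, ← hsq,
    ← Real.sqrt_sq_eq_abs, ← Real.sqrt_mul (sq_nonneg _), one_div, ← Real.sqrt_inv,
    ← Real.sqrt_mul hc]
  congr 1
  ring

/-- Change of variables for the injective map Φ, precomposed with the volume-preserving splitting so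
that source and target are the same space and the Jacobian is a determinant. -/
theorem restrict_image_eq_map (hg : IsRiemannianMetricOn U g) (ha : a ∈ U)
    (hj : IsGeodesicallyJoined U g a) (he : IsDirectionChart g a Q e)
    {p : Measure (Fin (n + 1) → ℝ)} {Z : ℝ} (hp : IsRiemannianGaussian U g a Z p) :
    p.restrict (sphericalMap U g a e '' sphericalDomain U g a Q e) =
      Measure.map (sphericalMap U g a e)
        ((volume.restrict (sphericalDomain U g a Q e)).withDensity fun z =>
          ENNReal.ofReal (Z⁻¹ * (1 / √(2 * Real.pi)) * Real.exp (-(1 / 2) * z.1 ^ 2) *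
            surfaceDensity g (sphericalMap U g a e) z)) := by
  set Φ := sphericalMap U g a e with hΦ
  set D := sphericalDomain U g a Q e with hD
  have hDm : MeasurableSet D := measurableSet_sphericalDomain hg ha hj he
  have hΦd : ∀ z ∈ D, HasFDerivAt Φ (fderiv ℝ Φ z) z := fun z hz =>
    ((exists_fderiv_sphericalMap hg ha hj he hz).1.differentiableAt (by simp)).hasFDerivAt
  have hΦc : ContinuousOn Φ D := fun z hz => (hΦd z hz).continuousAt.continuousWithinAt
  have hΦU : MapsTo Φ D U := fun z hz => (riemannianDist_sphericalMap hg hj he hz).1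
  have hUm : MeasurableSet U := hg.isOpen.measurableSet
  obtain ⟨hZ, hp⟩ := hp
  set ρ₁ : (Fin (n + 1) → ℝ) → ENNReal :=
    fun x => ENNReal.ofReal (√(((2 * Real.pi)⁻¹ • g x).det)) with hρ₁
  set ρ₂ : (Fin (n + 1) → ℝ) → ENNReal :=
    fun x => ENNReal.ofReal (Z⁻¹ * Real.exp (-(1 / 2) * riemannianDist U g a x ^ 2)) with hρ₂
  have hm₁ : AEMeasurable ρ₁ (volume.restrict U) := by
    refine ContinuousOn.aemeasurable (ENNReal.continuous_ofReal.comp_continuousOn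
      (Real.continuous_sqrt.comp_continuousOn ?_)) hUm
    simp only [Matrix.det_smul]
    exact continuousOn_const.mul hg.contDiffOn_det.continuousOn
  have hm₂ : AEMeasurable ρ₂ (volume.restrict U) := by
    refine ContinuousOn.aemeasurable (ENNReal.continuous_ofReal.comp_continuousOn ?_) hUm
    exact continuousOn_const.mul (Real.continuous_exp.comp_continuousOn
      (continuousOn_const.mul ((hg.continuousOn_riemannianDist hj).pow 2)))
  have hp' : p = (volume.restrict U).withDensity (ρ₁ * ρ₂) := by
    rw [hp, withDensity_mul₀ hm₁ hm₂]; rfl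
  ext s hs
  have hA : MeasurableSet (Φ ⁻¹' s ∩ D) := by
    rw [inter_comm]; exact ContinuousOn.measurableSet_inter_preimage hΦc hDm hs
  have himg : s ∩ Φ '' D = (Φ ∘ splitCLM n) '' (splitCLM n ⁻¹' (Φ ⁻¹' s ∩ D)) := by
    rw [image_comp, image_preimage_eq _ splitCLM_surjective, image_preimage_inter]
  have hsub : s ∩ Φ '' D ⊆ U := fun x hx => by
    obtain ⟨z, hz, rfl⟩ := hx.2; exact hΦU hz
  -- Φ is controlled only on D, where the measure lives; without a.e. measurability `Measure.map`
  -- would be 0 by convention.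
  have hRm : AEMeasurable Φ ((volume.restrict D).withDensity fun z =>
      ENNReal.ofReal (Z⁻¹ * (1 / √(2 * Real.pi)) * Real.exp (-(1 / 2) * z.1 ^ 2) *
        surfaceDensity g Φ z)) :=
    (hΦc.aemeasurable hDm).mono_ac (withDensity_absolutelyContinuous _ _)
  rw [Measure.map_apply_of_aemeasurable hRm hs, withDensity_apply', Measure.restrict_restrict' hDm,
    Measure.restrict_apply hs, hp', withDensity_apply', Measure.restrict_restrict' hUm,
    inter_eq_left.2 hsub, himg,
    ← measurePreserving_splitCLM.setLIntegral_comp_preimage_emb measurableEmbedding_splitCLM]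
  have hAs : MeasurableSet (splitCLM n ⁻¹' (Φ ⁻¹' s ∩ D)) :=
    (splitCLM n).continuous.measurable hA
  rw [lintegral_image_eq_lintegral_abs_det_fderiv_mul (f := Φ ∘ splitCLM n)
    (f' := fun x => (fderiv ℝ Φ (splitCLM n x)).comp (splitCLM n)) volume hAs
    (fun x hx => ((hΦd _ hx.2).comp x (splitCLM n).hasFDerivAt).hasFDerivWithinAt)
    (fun x hx y hy hxy => measurableEmbedding_splitCLM.injective
      (injOn_sphericalMap hg hj he hx.2 hy.2 hxy))]
  refine setLIntegral_congr_fun hAs fun x hx => ?_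
  have hz : splitCLM n x ∈ D := hx.2
  set z := splitCLM n x
  have hdet := abs_det_mul_sqrt_det (fderiv ℝ Φ z)
    (radialField_angularField_inner hg ha hj he hz).1
    (radialField_angularField_inner hg ha hj he hz).2
  simp only [Pi.mul_apply, hρ₁, hρ₂, Function.comp]
  rw [← ENNReal.ofReal_mul (Real.sqrt_nonneg _), ← ENNReal.ofReal_mul (abs_nonneg _)]
  congr 1
  rw [← mul_assoc, hdet, (riemannianDist_sphericalMap hg hj he hz).2]
  simp only [surfaceDensity, inducedMetric, angularField]
  ring

end FluctuationGeometry
end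

/-! ### The theorem -/

open FluctuationGeometry
theorem lemma2 {n : ℕ} (U : Set (Fin (n + 1) → ℝ))
    (g : (Fin (n + 1) → ℝ) → Matrix (Fin (n + 1)) (Fin (n + 1)) ℝ)
    (hg : IsRiemannianMetricOn U g)
    (xbar : Fin (n + 1) → ℝ) (hxbar : xbar ∈ U)
    (hjoin : IsGeodesicallyJoined U g xbar)
    (p : Measure (Fin (n + 1) → ℝ)) [IsProbabilityMeasure p]
    (Z : ℝ) (hp : IsRiemannianGaussian U g xbar Z p) :
    -- every system `q` of local coordinates on the sphere of directions at `xbar`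
    (∀ (Q : Set (Fin n → ℝ)) (e : (Fin n → ℝ) → Fin (n + 1) → ℝ),
      IsDirectionChart g xbar Q e →
      ∀ (Φ : ℝ × (Fin n → ℝ) → Fin (n + 1) → ℝ) (D : Set (ℝ × (Fin n → ℝ))),
        Φ = sphericalMap U g xbar e →
        D = sphericalDomain U g xbar Q e →
        -- `(ℓ, q)` are coordinates of `Φ (ℓ, q)`
        MeasurableSet D ∧ InjOn Φ D ∧
        (∀ z ∈ D, ContDiffAt ℝ ∞ Φ z ∧ Function.Bijective (fderiv ℝ Φ z)) ∧
        -- `ℓ` is the radius of the geodesic sphere through `Φ (ℓ, q)`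
        (∀ z ∈ D, Φ z ∈ geodesicSphere U g xbar z.1) ∧
        -- `g_ℓℓ = 1`, `g_ℓα = 0`
        (∀ z ∈ D, metricInner g (Φ z) (radialField Φ z) (radialField Φ z) = 1 ∧
          ∀ α, metricInner g (Φ z) (radialField Φ z) (angularField Φ α z) = 0) ∧
        -- `dp = Z⁻¹ (2π)^(-1/2) exp (-ℓ²/2) dℓ dΣ_g (q | ℓ)`
        p.restrict (Φ '' D) =
          Measure.map Φ ((volume.restrict D).withDensity fun z =>
            ENNReal.ofReal (Z⁻¹ * (1 / √(2 * Real.pi)) * Real.exp (-(1 / 2) * z.1 ^ 2) *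
              surfaceDensity g Φ z))) ∧
    -- the points `x_g (ℓ; e)`, `e` in the whole sphere of directions, fill `U` up to a null set
    volume {x | x ∈ U ∧ ¬ ∃ (e : Fin (n + 1) → ℝ) (ℓ L : ℝ), IsUnitAt g xbar e ∧ 0 < ℓ ∧ ℓ < L ∧
      MinimizesUpTo U g xbar e L ∧ geodesicPoint U g xbar e ℓ = x} = 0 := by
  refine ⟨?_, volume_compl_minimizing_eq_zero hg hxbar hjoin⟩
  rintro Q e he Φ D rfl rfl
  exact ⟨measurableSet_sphericalDomain hg hxbar hjoin he, injOn_sphericalMap hg hjoin he,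
    fun z hz => ⟨(exists_fderiv_sphericalMap hg hxbar hjoin he hz).1,
      bijective_fderiv_sphericalMap hg hxbar hjoin he hz⟩,
    fun z hz => riemannianDist_sphericalMap hg hjoin he hz,
    fun z hz => radialField_angularField_inner hg hxbar hjoin he hz,
    restrict_image_eq_map hg hxbar hjoin he hp⟩
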